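/- Let $\mathbb{D}$ be the open unit disc. A radial weight is a nonnegative function $\omega\in L^1([0,1))$, extended to $\mathbb{D}$ by $\omega(z)=\omega(|z|)$, such that $\widehat{\omega}(r)=\int_r^1\omega(s)\,ds>0$ for all $0\le r<1$; we write $\omega\in\widehat{\mathcal{D}}$ if, in addition, there is a constant $C\ge 1$ such that $\widehat{\omega}(r)\le C\,\widehat{\omega}\left(\frac{1+r}{2}\right)$ for all $0\le r<1$. For $0<p<\infty$, $A^p_\omega$ is the space of analytic functions $f$ on $\mathbb{D}$ with $\|f\|_{A^p_\omega}^p=\int_{\mathbb{D}}|f|^p\,\omega\,dA<\infty$, where $dA$ is Lebesgue area measure, and for a positive Borel measure $\nu$ on $\mathbb{D}$ and $0<q<\infty$, $L^q_\nu$ is the space of complex-valued $\nu$-measurable functions $g$ on $\mathbb{D}$ with $\|g\|_{L^q_\nu}^q=\int_{\mathbb{D}}|g|^q\,d\nu<\infty$. A linear operator $T:A^p_\omega\to L^q_\nu$ is bounded if there is a finite constant $C$ with $\|Tf\|_{L^q_\nu}\le C\|f\|_{A^p_\omega}$ for all $f\in A^p_\omega$, and compact if for every norm-bounded sequence $(f_n)$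 in $A^p_\omega$ the sequence $(Tf_n)$ has a subsequence converging in $L^q_\nu$. Let $0<p\le q<\infty$ and $\omega\in\widehat{\mathcal{D}}$, and let $\nu$ be a positive Borel measure on $\mathbb{D}$. Let $\varphi,\psi:\mathbb{D}\to\mathbb{D}$ be analytic, let $C_\varphi f=f\circ\varphi$ and $C_\psi f=f\circ\psi$, and put $$\delta(z)=\frac{\psi(z)-\varphi(z)}{1-\overline{\psi(z)}\,\varphi(z)},\qquad z\in\mathbb{D}.$$ 1. If the operators $\delta C_\varphi$ and $\delta C_\psi$ (that is, $f\mapsto\delta\cdot(f\circ\varphi)$ and $f\mapsto\delta\cdot(f\circ\psi)$) are both bounded from $A^p_\omega$ to $L^q_\nu$, then $C_\varphi-C_\psi:A^p_\omega\to L^q_\nu$ is bounded. 2. If $\delta C_\varphi$ and $\delta C_\psi$ are both compact from $A^p_\omega$ to $L^q_\nu$, then $C_\varphi-C_\psi:A^p_\omega\to L^q_\nu$ is compact. -/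

import Mathlib

open MeasureTheory Set Filter Topology
open scoped NNReal ENNReal ComplexConjugate

noncomputable section

namespace DoublingBergman

/-- The open unit disc of the complex plane. -/
def disc : Set ℂ := Metric.ball 0 1

/-- The tail integral `∫_r^1 ω(s) ds`; the function `ω̂` of the disc is `z ↦ tail ω ‖z‖`. -/
def tail (ω : ℝ → ℝ) (r : ℝ) : ℝ := ∫ s in Ico r 1, ω s

/-- A radial weight, given by its profile on `[0,1)` (values elsewhere play no role): nonnegative,
integrable on `[0,1)`, and with a strictly positive tail at every point of the disc. -/
structure IsRadialWeight (ω : ℝ → ℝ) : Prop where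
  nonneg : ∀ r ∈ Ico (0 : ℝ) 1, 0 ≤ ω r
  integrable : IntegrableOn ω (Ico (0 : ℝ) 1)
  tail_pos : ∀ r ∈ Ico (0 : ℝ) 1, 0 < tail ω r

/-- The class of radial weights with the upper doubling condition
`ω̂(r) ≤ C ω̂((1 + r) / 2)` for all `0 ≤ r < 1`. -/
structure IsUpperDoubling (ω : ℝ → ℝ) : Prop extends IsRadialWeight ω where
  doubling : ∃ C : ℝ, 1 ≤ C ∧ ∀ r ∈ Ico (0 : ℝ) 1, tail ω r ≤ C * tail ω ((1 + r) / 2)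

/-- The measure `ω(|z|) dA(z)` on the unit disc. -/
def weightMeasure (ω : ℝ → ℝ) : Measure ℂ :=
  (volume.restrict disc).withDensity fun z => ENNReal.ofReal (ω ‖z‖)

/-- The weighted Bergman space: analytic functions on the disc which belong to `L^p` of the
weight. Functions are represented on all of `ℂ`; only their values on the disc play a role. -/
def bergman (p : ℝ) (ω : ℝ → ℝ) : Set (ℂ → ℂ) :=
  {f | DifferentiableOn ℂ f disc ∧ MemLp f (ENNReal.ofReal p) (weightMeasure ω)}

/-- The (quasi-)norm of the weighted Bergman space. -/
def bergmanNorm (p : ℝ) (ω : ℝ → ℝ) (f : ℂ → ℂ) : ℝ≥0∞ :=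
  eLpNorm f (ENNReal.ofReal p) (weightMeasure ω)

/-- Membership in the Lebesgue space `L^q_ν` on the disc. A Borel measure on the disc is
represented as the restriction to the disc of a Borel measure `ν` on `ℂ`. -/
def MemLebesgue (q : ℝ) (ν : Measure ℂ) (g : ℂ → ℂ) : Prop :=
  MemLp g (ENNReal.ofReal q) (ν.restrict disc)

/-- The (quasi-)norm of `L^q_ν` on the disc. -/
def lebesgueNorm (q : ℝ) (ν : Measure ℂ) (g : ℂ → ℂ) : ℝ≥0∞ :=
  eLpNorm g (ENNReal.ofReal q) (ν.restrict disc)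

/-- `T` is a bounded operator from the weighted Bergman space to `L^q_ν`. -/
def IsBoundedOp (p q : ℝ) (ω : ℝ → ℝ) (ν : Measure ℂ) (T : (ℂ → ℂ) →ₗ[ℂ] (ℂ → ℂ)) : Prop :=
  (∀ f ∈ bergman p ω, MemLebesgue q ν (T f)) ∧
    ∃ C : ℝ≥0, ∀ f ∈ bergman p ω, lebesgueNorm q ν (T f) ≤ C * bergmanNorm p ω f

/-- `T` is a compact operator from the weighted Bergman space to `L^q_ν`: the image of every
norm-bounded sequence has a subsequence converging in `L^q_ν`. -/
def IsCompactOp (p q : ℝ) (ω : ℝ → ℝ) (ν : Measure ℂ) (T : (ℂ → ℂ) →ₗ[ℂ] (ℂ → ℂ)) : Prop :=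
  (∀ f ∈ bergman p ω, MemLebesgue q ν (T f)) ∧
    ∀ F : ℕ → ℂ → ℂ, (∀ n, F n ∈ bergman p ω) →
      (∃ M : ℝ≥0, ∀ n, bergmanNorm p ω (F n) ≤ M) →
      ∃ g : ℂ → ℂ, MemLebesgue q ν g ∧ ∃ k : ℕ → ℕ, StrictMono k ∧
        Tendsto (fun n => lebesgueNorm q ν (T (F (k n)) - g)) atTop (𝓝 0)

/-- An analytic self-map of the unit disc. -/
def IsAnalyticSelfMap (φ : ℂ → ℂ) : Prop :=
  DifferentiableOn ℂ φ disc ∧ MapsTo φ disc disc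

/-- The composition operator `f ↦ f ∘ φ`. -/
def compOp (φ : ℂ → ℂ) : (ℂ → ℂ) →ₗ[ℂ] (ℂ → ℂ) := LinearMap.funLeft ℂ ℂ φ

/-- The weighted composition operator `f ↦ u · (f ∘ φ)`. -/
def weightedCompOp (u φ : ℂ → ℂ) : (ℂ → ℂ) →ₗ[ℂ] (ℂ → ℂ) :=
  LinearMap.mulLeft ℂ u ∘ₗ compOp φ

/-- The function `δ = (ψ - φ) / (1 - conj ψ · φ)`. -/
def delta (φ ψ : ℂ → ℂ) (z : ℂ) : ℂ := (ψ z - φ z) / (1 - conj (ψ z) * φ z)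

end DoublingBergman

end

namespace DoublingBergman

/-! The proof is a Carleson embedding combined with the Schwarz lemma, applied to the push-forward
`μ` of `|δ|^q dν` under `φ`.

Where `|δ| ≥ 1/20`, the difference `|f∘φ - f∘ψ|` is at most `20 |δ| (|f∘φ| + |f∘ψ|)`, which the two
hypotheses control. Where `|δ| < 1/20`, the point `ψ(z)` lies well inside the Euclidean disc of
radius `(1 - |φ(z)|)/4` about `φ(z)`, and the Schwarz lemma gives `|f(φ(z)) - f(ψ(z))| ≤ 20 |δ(z)|
G(φ(z))`, with `G` a majorant of `|f|` on such discs. Everything then rests on bounding `∫ G^q dμ`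
by the `q`-th power of the Bergman norm of `f`.

That bound is `IsDoublingMeasure.exists_embedding`: it holds once `μ(S) ≤ ε σ(S)^(q/p)` on Carleson
squares `S`, where `σ(S)` is essentially the weighted mass of `S`. Subharmonicity of `|f|^(p/2)`,
with a rapidly decaying analytic factor, dominates `G^(p/2)` by a decaying sum of averages over the
squares of the same generation (`exists_local_bound`). Upper doubling enters here, and a dyadic
Carleson embedding (`carleson_embedding`) sums the averages. Conversely, normalized powers of `1/(1
- c̄ z)` show that boundedness of `δ C_φ` forces the condition on squares (`exists_test_functions`).
`IsCarlesonScale` packages these facts.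

For compactness, normal families reduce the claim to bounded sequences tending to zero pointwise.
The test functions of generation `n` tend to zero pointwise, so `ε` may be taken arbitrarily small
on squares near the circle. On the remaining part, where `φ` stays away from the circle, dominated
convergence applies with a multiple of `|δ|^q` as majorant. -/

/-! ### Subharmonicity of powers of the modulus and a crude Poisson estimate -/

/-- Jensen's formula gives the sub-mean value property of `log ‖G‖`, because each zero in the closed
disc contributes a nonnegative term. The convexity bound `1 + y ≤ exp y` at `y = α (log ‖G z‖ - log
‖G 0‖)` transfers it to `‖G‖ ^ α`. -/
theorem norm_rpow_le_circleAverage {G : ℂ → ℂ} (hG : AnalyticOnNhd ℂ G (Metric.closedBall 0 1))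
    {α : ℝ} (hα : 0 < α) :
    ‖G 0‖ ^ α ≤ Real.circleAverage (fun z => ‖G z‖ ^ α) 0 1 := by
  have hcont : ContinuousOn (fun z => ‖G z‖ ^ α) (Metric.sphere 0 1) := by
    apply ContinuousOn.rpow_const
    · exact (hG.continuousOn.mono Metric.sphere_subset_closedBall).norm
    · intro x _; right; exact hα.le
  have hint : CircleIntegrable (fun z => ‖G z‖ ^ α) 0 1 := hcont.circleIntegrable zero_le_one
  by_cases h0 : G 0 = 0
  · rw [h0, norm_zero, Real.zero_rpow hα.ne']
    apply Real.circleAverage_nonneg_of_nonneg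
    intro z _
    positivity
  have hG' : AnalyticOnNhd ℂ G (Metric.closedBall 0 |1|) := by simpa using hG
  have hlog : CircleIntegrable (fun z => Real.log ‖G z‖) 0 1 :=
    (hG'.mono Metric.sphere_subset_closedBall).meromorphicOn.circleIntegrable_log_norm
  set c : ℝ := ‖G 0‖ with hc
  have hcpos : 0 < c := norm_pos_iff.2 h0
  have hJ : Real.log c ≤ Real.circleAverage (fun z => Real.log ‖G z‖) 0 1 := by
    rw [AnalyticOnNhd.circleAverage_log_norm one_ne_zero hG' h0]
    have : 0 ≤ ∑ᶠ u, MeromorphicOn.divisor G (Metric.closedBall 0 |1|) u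
        * Real.log (1 * ‖0 - u‖⁻¹) := by
      apply finsum_nonneg
      intro u
      by_cases hu : u ∈ Metric.closedBall (0 : ℂ) |1|
      · apply mul_nonneg
        · exact_mod_cast (MeromorphicOn.AnalyticOnNhd.divisor_nonneg hG') u
        · by_cases hu0 : u = 0
          · simp [hu0]
          apply Real.log_nonneg
          rw [one_mul, zero_sub, norm_neg]
          apply (one_le_inv₀ (norm_pos_iff.2 hu0)).2
          simpa using hu
      · rw [Function.locallyFinsuppWithin.apply_eq_zero_of_notMem _ hu]; simp
    linarith
  have hne : ∀ᶠ z in codiscreteWithin (Metric.sphere (0 : ℂ) |1|), G z ≠ 0 := by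
    have h1 := hG'.preimage_zero_mem_codiscreteWithin (x := 0) h0 (by simp)
      ((convex_closedBall (0 : ℂ) |1|).isConnected ⟨0, by simp⟩)
    have := Filter.codiscreteWithin_mono (Metric.sphere_subset_closedBall (x := (0 : ℂ)) (ε := |1|)) h1
    filter_upwards [this] with z hz
    simpa using hz
  -- Since `Real.log 0 = 0`, the tangent minorant may fail at zeros of `G` on the circle. There the
  -- function is replaced by the minorant itself, which changes no average because the zeros are
  -- isolated.
  have key : Real.circleAverage (fun z => if G z = 0 then c ^ α * (1 + α * (Real.log ‖G z‖ - Real.log c)) else ‖G z‖ ^ α) 0 1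
      = Real.circleAverage (fun z => ‖G z‖ ^ α) 0 1 := by
    apply Real.circleAverage_congr_codiscreteWithin _ one_ne_zero
    filter_upwards [hne] with z hz
    simp [hz]
  have hint' : CircleIntegrable (fun z => if G z = 0 then c ^ α * (1 + α * (Real.log ‖G z‖ - Real.log c)) else ‖G z‖ ^ α) 0 1 := by
    apply hint.congr_codiscreteWithin
    filter_upwards [hne] with z hz
    simp [hz]
  have hint2 : CircleIntegrable (fun z => c ^ α * (1 + α * (Real.log ‖G z‖ - Real.log c))) 0 1 := by
    have h1 : CircleIntegrable (fun z => Real.log ‖G z‖ - Real.log c) 0 1 := hlog.sub (circleIntegrable_const _ _ _)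
    exact (((circleIntegrable_const (1:ℝ) 0 1).add (h1.const_smul (a := α))).const_smul (a := c ^ α))
  rw [← key]
  have e : Real.circleAverage (fun z => c ^ α * (1 + α * (Real.log ‖G z‖ - Real.log c))) 0 1
      = c ^ α * (1 + α * (Real.circleAverage (fun z => Real.log ‖G z‖) 0 1 - Real.log c)) := by
    have h1 : CircleIntegrable ((fun z => Real.log ‖G z‖) - fun _ => Real.log c) 0 1 :=
      hlog.sub (circleIntegrable_const _ _ _)
    have e1 : (fun z => c ^ α * (1 + α * (Real.log ‖G z‖ - Real.log c)))
      = c ^ α • ((fun _ => (1:ℝ)) + α • ((fun z => Real.log ‖G z‖) - fun _ => Real.log c)) := by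
      ext z; simp
    rw [e1, Real.circleAverage_smul, Real.circleAverage_add (circleIntegrable_const _ _ _) (h1.const_smul (a := α)),
      Real.circleAverage_smul, Real.circleAverage_sub hlog (circleIntegrable_const _ _ _),
      Real.circleAverage_const, Real.circleAverage_const]
    simp
  calc c ^ α ≤ c ^ α * (1 + α * (Real.circleAverage (fun z => Real.log ‖G z‖) 0 1 - Real.log c)) := by
        apply le_mul_of_one_le_right (by positivity)
        have := mul_nonneg hα.le (sub_nonneg.2 hJ)
        linarith
    _ ≤ _ := by
        rw [← e]
        apply Real.circleAverage_mono hint2 hint'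
        intro z _
        split_ifs with hz
        · exact le_rfl
        · have hzp : 0 < ‖G z‖ := norm_pos_iff.2 hz
          have : ‖G z‖ ^ α = c ^ α * Real.exp (α * (Real.log ‖G z‖ - Real.log c)) := by
            rw [Real.rpow_def_of_pos hzp, Real.rpow_def_of_pos hcpos, ← Real.exp_add]
            congr 1; ring
          rw [this]
          gcongr
          have := Real.add_one_le_exp (α * (Real.log ‖G z‖ - Real.log c))
          linarith

/-- The Möbius map carries `exp (i t)` to `exp (i θ(t))`, where `θ'` is the Poisson kernel `κ ≥ (1 -
‖a‖) / 2`. Inserting `κ` into the integral therefore costs at most `2 / (1 - ‖a‖)`, after which `θ`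
is a change of variables. -/
theorem circleAverage_comp_moebius_le {a : ℂ} (ha : ‖a‖ < 1) {g : ℂ → ℝ}
    (hg : ContinuousOn g (Metric.sphere 0 1)) (hg0 : ∀ z, 0 ≤ g z) :
    Real.circleAverage (fun z => g ((z + a) / (1 + conj a * z))) 0 1
      ≤ 2 / (1 - ‖a‖) * Real.circleAverage g 0 1 := by
  set e : ℝ → ℂ := circleMap 0 1 with he
  have hnorm : ∀ t, ‖e t‖ = 1 := fun t => by simp [he]
  have hconj : ∀ t, e t * conj (e t) = 1 := fun t => by
    rw [Complex.mul_conj, Complex.normSq_eq_norm_sq, hnorm]; simp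
  set d : ℝ → ℂ := fun t => 1 + conj a * e t with hd
  have hdne : ∀ t, d t ≠ 0 := fun t h => by
    have : ‖conj a * e t‖ = 1 := by
      rw [show conj a * e t = -1 by linear_combination h]; simp
    rw [norm_mul, hnorm, RCLike.norm_conj] at this
    linarith
  have hdle : ∀ t, ‖d t‖ ≤ 1 + ‖a‖ := fun t => by
    refine (norm_add_le _ _).trans ?_
    rw [norm_mul, hnorm, RCLike.norm_conj]; simp
  set M : ℝ → ℂ := fun t => (e t + a) / d t with hM
  have hea : ∀ t, e t + a = e t * conj (d t) := fun t => by
    simp only [hd, map_add, map_one, map_mul, Complex.conj_conj]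
    linear_combination (-a) * hconj t
  have hMne : ∀ t, M t ≠ 0 := fun t => by
    have h1 : e t ≠ 0 := by rw [← norm_ne_zero_iff, hnorm]; exact one_ne_zero
    have h2 : conj (d t) ≠ 0 := by simpa using hdne t
    simp only [hM, hea]
    exact div_ne_zero (mul_ne_zero h1 h2) (hdne t)
  have hMnorm : ∀ t, ‖M t‖ = 1 := fun t => by
    simp only [hM, hea]
    rw [norm_div, norm_mul, hnorm, RCLike.norm_conj, one_mul, div_self (norm_ne_zero_iff.2 (hdne t))]
  have hecont : Continuous e := continuous_circleMap 0 1
  have hdcont : Continuous d := by fun_prop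
  have hMcont : Continuous M := (by fun_prop : Continuous fun t => e t + a).div hdcont hdne
  set κ : ℝ → ℝ := fun t => (1 - ‖a‖ ^ 2) / ‖d t‖ ^ 2 with hκ
  have hκcont : Continuous κ :=
    continuous_const.div (by fun_prop) fun t => by have := norm_ne_zero_iff.2 (hdne t); positivity
  have hκpos : ∀ t, (1 - ‖a‖) / 2 ≤ κ t := fun t => by
    have h1 : 0 < ‖d t‖ := norm_pos_iff.2 (hdne t)
    have h2 := hdle t
    have h3 := norm_nonneg a
    rw [hκ, div_le_div_iff₀ two_pos (by positivity)]
    have h4 : ‖d t‖ ^ 2 ≤ (1 + ‖a‖) ^ 2 := by gcongr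
    nlinarith [mul_nonneg (sub_nonneg.2 ha.le) (sub_nonneg.2 h4), mul_nonneg (sub_nonneg.2 ha.le) h3]
  obtain ⟨β, hβ⟩ : ∃ β : ℝ, e β = M 0 := by
    refine ⟨(M 0).arg, ?_⟩
    have := Complex.norm_mul_exp_arg_mul_I (M 0)
    rw [hMnorm] at this
    simpa [he, circleMap] using this
  set θ : ℝ → ℝ := fun t => β + ∫ s in (0 : ℝ)..t, κ s with hθ
  have hθd : ∀ t, HasDerivAt θ (κ t) t := fun t =>
    (intervalIntegral.integral_hasDerivAt_right (hκcont.intervalIntegrable _ _)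
      (hκcont.stronglyMeasurableAtFilter _ _) hκcont.continuousAt).const_add β
  have hed : ∀ t, HasDerivAt e (e t * Complex.I) t := fun t => by
    simpa [he] using hasDerivAt_circleMap 0 1 t
  have hMd : ∀ t, HasDerivAt M (M t * (κ t * Complex.I)) t := fun t => by
    have h1 : HasDerivAt M _ t :=
      ((hed t).add_const a).div (((hed t).const_mul (conj a)).const_add 1) (hdne t)
    convert h1 using 1
    have h2 : (κ t : ℂ) = (1 - a * conj a) / (d t * conj (d t)) := by
      rw [Complex.mul_conj, Complex.mul_conj, Complex.normSq_eq_norm_sq, Complex.normSq_eq_norm_sq]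
      simp [hκ]
    have h3 : conj (d t) ≠ 0 := by simpa using hdne t
    have h4 := hdne t
    simp only [hM, h2]
    change _ = (e t * Complex.I * d t - (e t + a) * (conj a * (e t * Complex.I))) / d t ^ 2
    rw [hea]
    field_simp
    have h5 : (conj (d t)) * e t = e t + a := by rw [hea]; ring
    have h6 : d t = 1 + conj a * e t := rfl
    linear_combination (-e t) * h6 + e t * conj a * h5
  have hMe : ∀ t, M t = e (θ t) := by
    have h1 : ∀ t, HasDerivAt (fun t => e (θ t)) (κ t * (e (θ t) * Complex.I)) t := fun t => by
      simpa [Function.comp_def] using (hed (θ t)).scomp t (hθd t)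
    have hne : ∀ t, e t ≠ 0 := fun t => by rw [← norm_ne_zero_iff, hnorm]; exact one_ne_zero
    have h2 : ∀ t, HasDerivAt (fun t => M t / e (θ t)) 0 t := fun t => by
      refine ((hMd t).div (h1 t) (hne _)).congr_deriv ?_
      ring
    intro t
    have h3 := is_const_of_deriv_eq_zero (fun t => (h2 t).differentiableAt) (fun t => (h2 t).deriv) t 0
    have h4 : θ 0 = β := by simp [hθ]
    rw [h4, hβ, div_self (hMne 0), div_eq_one_iff_eq (hne _)] at h3
    exact h3
  have hge : Continuous fun t => g (e t) :=
    hg.comp_continuous hecont fun t => by simp [hnorm]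
  -- The map winds once around the circle: the Poisson kernel with pole `-a` has mean one.
  have hθ2 : θ (2 * Real.pi) = β + 2 * Real.pi := by
    have h1 := (InnerProductSpace.HarmonicOnNhd.circleAverage_poissonKernel_smul
      (f := fun _ : ℂ => (1 : ℝ)) (c := 0) (R := 1) (w := -a)
      (fun x _ => InnerProductSpace.harmonicAt_const 1) (by simpa using ha))
    rw [Real.circleAverage_def] at h1
    have h2 : ∀ t, (poissonKernel 0 (-a) • fun _ : ℂ => (1 : ℝ)) (circleMap 0 1 t) = κ t := fun t => by
      have : ‖e t + a‖ = ‖d t‖ := by rw [hea, norm_mul, hnorm, RCLike.norm_conj, one_mul]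
      simp [poissonKernel_def, hκ, ← this, he]
    simp_rw [h2] at h1
    rw [smul_eq_mul, inv_mul_eq_one₀ (by positivity)] at h1
    simp [hθ, ← h1]
  have hsub : ∫ t in (0 : ℝ)..2 * Real.pi, g (M t) * κ t = ∫ t in (0 : ℝ)..2 * Real.pi, g (e t) := by
    have h1 := intervalIntegral.integral_comp_mul_deriv (a := 0) (b := 2 * Real.pi) (f := θ) (f' := κ)
      (g := fun t => g (e t)) (fun t _ => hθd t) hκcont.continuousOn hge
    have h2 : θ 0 = β := by simp [hθ]
    have h3 : Function.Periodic (fun t => g (e t)) (2 * Real.pi) := fun t => by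
      simp [he, periodic_circleMap 0 1 t]
    rw [h2, hθ2, h3.intervalIntegral_add_eq β 0, zero_add] at h1
    rw [← h1]
    simp [hMe]
  rw [Real.circleAverage_def, Real.circleAverage_def, smul_eq_mul, smul_eq_mul, ← hsub,
    mul_left_comm]
  gcongr
  rw [← intervalIntegral.integral_const_mul]
  have hgM : Continuous fun t => g (M t) := hg.comp_continuous hMcont fun t => by simp [hMnorm]
  apply intervalIntegral.integral_mono (by positivity)
  · exact hgM.intervalIntegrable _ _
  · exact (continuous_const.mul (hgM.mul hκcont)).intervalIntegrable _ _
  · intro t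
    have h1 : 0 < 1 - ‖a‖ := sub_pos.2 ha
    have h2 : 1 ≤ 2 / (1 - ‖a‖) * κ t := by
      have := hκpos t
      rw [div_mul_eq_mul_div, le_div_iff₀ h1]
      linarith
    change g (M t) ≤ 2 / (1 - ‖a‖) * (g (M t) * κ t)
    nlinarith [hg0 (M t)]

/-- A crude form of the Poisson estimate for the subharmonic function `‖F‖ ^ α`. -/
theorem norm_rpow_le_circleAverage_of_norm_lt {F : ℂ → ℂ} (hF : DifferentiableOn ℂ F disc)
    {α : ℝ} (hα : 0 < α) {ρ : ℝ} (hρ : ρ < 1) {ζ : ℂ} (hζ : ‖ζ‖ < ρ) :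
    ‖F ζ‖ ^ α ≤ 2 * ρ / (ρ - ‖ζ‖) * Real.circleAverage (fun z => ‖F z‖ ^ α) 0 ρ := by
  have hρ0 : 0 < ρ := (norm_nonneg _).trans_lt hζ
  set a : ℂ := ζ / ρ with ha
  have hna : ‖a‖ = ‖ζ‖ / ρ := by simp [ha, abs_of_pos hρ0]
  have ha1 : ‖a‖ < 1 := by rw [hna, div_lt_one hρ0]; exact hζ
  have hmem : ∀ w : ℂ, ‖w‖ ≤ 1 → (ρ : ℂ) * w ∈ disc := fun w hw => by
    simp only [disc, mem_ball_zero_iff, norm_mul, Complex.norm_real, Real.norm_eq_abs, abs_of_pos hρ0]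
    nlinarith [norm_nonneg w]
  -- The estimate at `ζ` is the mean value inequality at `0` for `F` precomposed with `ρ` times the
  -- disc automorphism that sends `0` to `a = ζ / ρ`.
  have hden : ∀ z : ℂ, ‖a‖ * ‖z‖ < 1 → 1 + conj a * z ≠ 0 := fun z hz h => by
    have : ‖conj a * z‖ = 1 := by rw [show conj a * z = -1 by linear_combination h]; simp
    rw [norm_mul, RCLike.norm_conj] at this
    linarith
  have hle : ∀ z : ℂ, ‖z‖ ≤ 1 → ‖(z + a) / (1 + conj a * z)‖ ≤ 1 := fun z hz => by
    have h1 : ‖a‖ * ‖z‖ < 1 := by nlinarith [norm_nonneg z, norm_nonneg a]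
    rw [norm_div, div_le_one (norm_pos_iff.2 (hden z h1))]
    apply le_of_sq_le_sq _ (norm_nonneg _)
    have e1 : ‖1 + conj a * z‖ ^ 2 - ‖z + a‖ ^ 2 = (1 - ‖z‖ ^ 2) * (1 - ‖a‖ ^ 2) := by
      simp only [← Complex.normSq_eq_norm_sq, Complex.normSq_apply]
      simp
      ring
    have : 0 ≤ (1 - ‖z‖ ^ 2) * (1 - ‖a‖ ^ 2) := by
      apply mul_nonneg <;> nlinarith [norm_nonneg z, norm_nonneg a]
    linarith
  set M : ℂ → ℂ := fun z => (z + a) / (1 + conj a * z) with hM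
  have hG : AnalyticOnNhd ℂ (fun z => F (ρ * M z)) (Metric.closedBall 0 1) := by
    intro z hz
    have hz : ‖z‖ ≤ 1 := by simpa using hz
    have h1 : ‖a‖ * ‖z‖ < 1 := by nlinarith [norm_nonneg z, norm_nonneg a]
    have h2 : AnalyticAt ℂ (fun z => ρ * M z) z :=
      analyticAt_const.mul ((analyticAt_id.add analyticAt_const).div
        (analyticAt_const.add (analyticAt_const.mul analyticAt_id)) (hden z h1))
    have h3 : AnalyticAt ℂ F ((fun z => ρ * M z) z) :=
      hF.analyticAt (Metric.isOpen_ball.mem_nhds (hmem _ (hle z hz)))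
    exact AnalyticAt.fun_comp (g := F) (f := fun z => ρ * M z) h3 h2
  have h1 := norm_rpow_le_circleAverage hG hα
  have h2 : (ρ : ℂ) * M 0 = ζ := by
    have : (ρ : ℂ) ≠ 0 := by exact_mod_cast hρ0.ne'
    simp [hM, ha]; field_simp
  rw [h2] at h1
  refine h1.trans ((circleAverage_comp_moebius_le ha1 (g := fun w => ‖F (ρ * w)‖ ^ α) ?_ ?_).trans ?_)
  · apply ContinuousOn.rpow_const _ fun _ _ => Or.inr hα.le
    apply ContinuousOn.norm
    exact hF.continuousOn.comp (by fun_prop) fun w hw => hmem w (by simpa using hw.le)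
  · intro z; positivity
  · rw [Real.circleAverage_eq_circleAverage_zero_one (R := ρ)]
    simp only [add_zero]
    apply le_of_eq
    congr 1
    have : ρ - ‖ζ‖ ≠ 0 := by linarith
    rw [hna]; field_simp

/-- The starting angle `x` is free so that the period can later be centred at the argument of a
given point. -/
theorem enorm_rpow_le_lintegral_circleMap {F : ℂ → ℂ} (hF : DifferentiableOn ℂ F disc)
    {α : ℝ} (hα : 0 < α) {ρ : ℝ} (hρ : ρ < 1) {ζ : ℂ} (hζ : ‖ζ‖ < ρ) (x : ℝ) :
    ‖F ζ‖ₑ ^ α ≤ ENNReal.ofReal (ρ / (ρ - ‖ζ‖)) *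
      ∫⁻ θ in Ioc x (x + 2 * Real.pi), ‖F (circleMap 0 ρ θ)‖ₑ ^ α := by
  have hρ0 : 0 < ρ := (norm_nonneg _).trans_lt hζ
  have h1 := norm_rpow_le_circleAverage_of_norm_lt hF hα hρ hζ
  have hcont : Continuous fun θ => ‖F (circleMap 0 ρ θ)‖ ^ α := by
    apply Continuous.rpow_const _ fun _ => Or.inr hα.le
    apply Continuous.norm
    apply hF.continuousOn.comp_continuous (continuous_circleMap 0 ρ)
    intro θ
    simp [disc, abs_of_pos hρ0, hρ]
  have hper : Function.Periodic (fun θ => ‖F (circleMap 0 ρ θ)‖ ^ α) (2 * Real.pi) := fun θ => by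
    simp [periodic_circleMap 0 ρ θ]
  have h2 : Real.circleAverage (fun z => ‖F z‖ ^ α) 0 ρ
      = (2 * Real.pi)⁻¹ * ∫ θ in Ioc x (x + 2 * Real.pi), ‖F (circleMap 0 ρ θ)‖ ^ α := by
    rw [Real.circleAverage_def, smul_eq_mul,
      ← intervalIntegral.integral_of_le (by linarith [Real.pi_pos]),
      hper.intervalIntegral_add_eq x 0, zero_add]
  have h3 : ∀ z, ‖F z‖ₑ ^ α = ENNReal.ofReal (‖F z‖ ^ α) := fun z => by
    rw [← ofReal_norm, ENNReal.ofReal_rpow_of_nonneg (norm_nonneg _) hα.le]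
  simp_rw [h3]
  rw [← ofReal_integral_eq_lintegral_ofReal
    ((hcont.integrableOn_Icc (a := x) (b := x + 2 * Real.pi)).mono_set Ioc_subset_Icc_self)
    (Eventually.of_forall fun θ => by positivity),
    ← ENNReal.ofReal_mul (div_nonneg hρ0.le (sub_pos.2 hζ).le)]
  apply ENNReal.ofReal_le_ofReal
  rw [h2] at h1
  refine h1.trans ?_
  set J := ∫ θ in Ioc x (x + 2 * Real.pi), ‖F (circleMap 0 ρ θ)‖ ^ α
  have hJ : 0 ≤ J := integral_nonneg fun θ => by positivity
  have : 2 * ρ / (ρ - ‖ζ‖) * ((2 * Real.pi)⁻¹ * J) = Real.pi⁻¹ * (ρ / (ρ - ‖ζ‖) * J) := by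
    field_simp
  rw [this]
  apply mul_le_of_le_one_left (mul_nonneg (div_nonneg hρ0.le (sub_pos.2 hζ).le) hJ)
  apply inv_le_one_of_one_le₀
  linarith [Real.pi_gt_three]

/-! ### Dyadic forests and the dyadic Carleson embedding -/

/-- The ancestor of generation `n` of the dyadic index `Q = (generation, position)`. -/
def ancestor (n : ℕ) (Q : ℕ × ℤ) : ℕ × ℤ := (n, Q.2 / 2 ^ (Q.1 - n))

/-- `R` is an ancestor of `Q` (or `Q` itself) in the dyadic forest. -/
def IsAncestor (R Q : ℕ × ℤ) : Prop := R.1 ≤ Q.1 ∧ ancestor R.1 Q = R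

theorem ancestor_self (Q : ℕ × ℤ) : ancestor Q.1 Q = Q := by simp [ancestor]

theorem ancestor_ancestor {n m : ℕ} {Q : ℕ × ℤ} (h : n ≤ m) (h' : m ≤ Q.1) :
    ancestor n (ancestor m Q) = ancestor n Q := by
  simp only [ancestor, Prod.mk.injEq, true_and]
  rw [Int.ediv_ediv_of_nonneg (by positivity), ← pow_add]
  congr 2
  omega

/-- A family of measurable sets indexed by the dyadic forest, decreasing along the forest and
disjoint within each generation. -/
structure IsDyadicFamily {X : Type*} [MeasurableSpace X] (S : ℕ × ℤ → Set X) : Prop where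
  measurableSet : ∀ Q, MeasurableSet (S Q)
  subset_ancestor : ∀ Q, ∀ n ≤ Q.1, S Q ⊆ S (ancestor n Q)
  disjoint : ∀ n k l, k ≠ l → Disjoint (S (n, k)) (S (n, l))

theorem ENNReal.tsum_rpow_le {ι : Type*} (x : ι → ℝ≥0∞) {t : ℝ} (ht : 1 ≤ t) :
    ∑' i, x i ^ t ≤ (∑' i, x i) ^ t := by
  have h : ∀ y : ℝ≥0∞, y ^ t = y * y ^ (t - 1) := fun y => by
    conv_lhs => rw [show t = 1 + (t - 1) by ring]
    rw [ENNReal.rpow_add_of_nonneg _ _ zero_le_one (by linarith), ENNReal.rpow_one]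
  calc ∑' i, x i ^ t ≤ ∑' i, x i * (∑' i, x i) ^ (t - 1) := by
        refine ENNReal.tsum_le_tsum fun i => ?_
        rw [h]
        gcongr
        exact ENNReal.le_tsum i
    _ = _ := by rw [ENNReal.tsum_mul_right, ← h]

/-- If `2 ^ J < x ≤ 2 ^ (J + 1)`, only `j ≤ J + 1` contribute, and the geometric sum is `2 ^ (J + 2)
= 4 * 2 ^ J`. -/
theorem ENNReal.tsum_zpow_ite_le (x : ℝ≥0∞) :
    ∑' j : ℤ, (if (2 : ℝ≥0∞) ^ (j - 1) < x then (2 : ℝ≥0∞) ^ j else 0) ≤ 4 * x := by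
  rcases eq_or_ne x 0 with rfl | h0
  · simp
  rcases eq_or_ne x ∞ with rfl | hT
  · simp [ENNReal.mul_top]
  obtain ⟨J, hJ1, hJ2⟩ := ENNReal.exists_mem_Ioc_zpow h0 hT (y := 2) (by norm_num) (by norm_num)
  have h2 : ∀ i j : ℤ, (2 : ℝ≥0∞) ^ (i + j) = 2 ^ i * 2 ^ j := fun i j =>
    ENNReal.zpow_add (by norm_num) (by norm_num) i j
  calc ∑' j : ℤ, (if (2 : ℝ≥0∞) ^ (j - 1) < x then (2 : ℝ≥0∞) ^ j else 0)
      ≤ ∑' j : ℤ, (if j ≤ J + 1 then (2 : ℝ≥0∞) ^ j else 0) := by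
        refine ENNReal.tsum_le_tsum fun j => ?_
        split_ifs with h1 h3 h3
        · exact le_rfl
        · exfalso
          have : (2 : ℝ≥0∞) ^ (J + 1) ≤ 2 ^ (j - 1) :=
            ENNReal.zpow_le_of_le (by norm_num) (by omega)
          exact absurd (h1.trans_le hJ2) (not_lt.2 this)
        · exact zero_le
        · exact le_rfl
    _ = ∑' n : ℕ, (2 : ℝ≥0∞) ^ (J + 1) * 2⁻¹ ^ n := by
        have hinj : Function.Injective fun n : ℕ => J + 1 - (n : ℤ) := fun a b h => by
          simpa using h
        rw [← hinj.tsum_eq]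
        · refine tsum_congr fun n => ?_
          rw [if_pos (by omega), sub_eq_add_neg, h2, ENNReal.zpow_neg, zpow_natCast, ENNReal.inv_pow]
        · intro j hj
          have : j ≤ J + 1 := by
            by_contra h
            simp [h] at hj
          exact ⟨(J + 1 - j).toNat, by dsimp only; omega⟩
    _ = 4 * 2 ^ J := by
        rw [ENNReal.tsum_mul_left, ENNReal.tsum_geometric, ENNReal.one_sub_inv_two, inv_inv, h2,
          zpow_one]
        ring
    _ ≤ 4 * x := by gcongr

section Embedding

variable {X : Type*} [MeasurableSpace X] {m : Measure X} {S : ℕ × ℤ → Set X}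

/-- Average of `u` over the set `S Q`. -/
noncomputable def dyadicAverage (m : Measure X) (S : ℕ × ℤ → Set X) (u : X → ℝ≥0∞) (Q : ℕ × ℤ) :
    ℝ≥0∞ := (m (S Q))⁻¹ * ∫⁻ x in S Q, u x ∂m

/-- The maximal dyadic sets on which the average exceeds `c`. -/
def stoppingSet (a : ℕ × ℤ → ℝ≥0∞) (c : ℝ≥0∞) : Set (ℕ × ℤ) :=
  {R | c < a R ∧ ∀ n < R.1, ¬ c < a (ancestor n R)}

/-- The stopping set above `Q` is found by taking the ancestor of least generation whose value
exceeds `c`. -/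
theorem exists_stopping {a : ℕ × ℤ → ℝ≥0∞} {c : ℝ≥0∞} {Q : ℕ × ℤ} (hQ : c < a Q) :
    ∃ R ∈ stoppingSet a c, IsAncestor R Q := by
  classical
  have hex : ∃ n, n ≤ Q.1 ∧ c < a (ancestor n Q) := ⟨Q.1, le_rfl, by rwa [ancestor_self]⟩
  obtain ⟨h1, h2⟩ := Nat.find_spec hex
  refine ⟨ancestor (Nat.find hex) Q, ⟨h2, fun n hn hlt => ?_⟩, h1, rfl⟩
  have hn : n < Nat.find hex := hn
  rw [ancestor_ancestor hn.le h1] at hlt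
  exact Nat.find_min hex hn ⟨hn.le.trans h1, hlt⟩

theorem IsDyadicFamily.disjoint_stopping (hS : IsDyadicFamily S) {a : ℕ × ℤ → ℝ≥0∞} {c : ℝ≥0∞}
    {R R' : ℕ × ℤ} (hR : R ∈ stoppingSet a c) (hR' : R' ∈ stoppingSet a c) (hne : R ≠ R') :
    Disjoint (S R) (S R') := by
  wlog h : R.1 ≤ R'.1 generalizing R R'
  · exact (this hR' hR hne.symm (le_of_not_ge h)).symm
  by_cases he : ancestor R.1 R' = R
  · rcases h.eq_or_lt with h' | h'
    · rw [h', ancestor_self] at he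
      exact absurd he.symm hne
    · exact absurd (he ▸ hR.1) (hR'.2 _ h')
  · have h1 := hS.subset_ancestor R' _ h
    refine Disjoint.mono_right h1 ?_
    refine hS.disjoint R.1 R.2 _ fun h2 => he ?_
    ext <;> simp [ancestor] at h2 ⊢
    exact h2.symm

/-- The points with `u ≤ c` contribute at most `c * m s` to the integral, so at least as much again
must come from `u > c`. -/
theorem mul_measure_le_setLIntegral {u : X → ℝ≥0∞} {c : ℝ≥0∞} (hc : c ≠ ∞)
    {s : Set X} (hs : m s ≠ ∞) (h : 2 * c * m s ≤ ∫⁻ x in s, u x ∂m) :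
    c * m s ≤ ∫⁻ x in s, (if c < u x then u x else 0) ∂m := by
  have h1 : ∫⁻ x in s, u x ∂m ≤ ∫⁻ x in s, (if c < u x then u x else 0) ∂m + c * m s := by
    calc ∫⁻ x in s, u x ∂m ≤ ∫⁻ x in s, ((if c < u x then u x else 0) + c) ∂m := by
          refine lintegral_mono fun x => ?_
          dsimp only
          split_ifs with hx
          · exact le_self_add
          · rw [zero_add]; exact not_lt.1 hx
      _ = _ := by rw [lintegral_add_right _ measurable_const]; simp
  have h2 : c * m s ≠ ∞ := ENNReal.mul_ne_top hc hs
  have h3 : c * m s + c * m s ≤ ∫⁻ x in s, (if c < u x then u x else 0) ∂m + c * m s := by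
    refine le_trans (le_of_eq ?_) (h.trans h1)
    ring
  exact (ENNReal.add_le_add_iff_right h2).1 h3

/-- A weak-type maximal inequality: stopping sets are pairwise disjoint, and on each the average
exceeds `2 * c`, so the mass of `u` above level `c` dominates. -/
theorem IsDyadicFamily.tsum_stopping_le (hS : IsDyadicFamily S) (hm0 : ∀ Q, m (S Q) ≠ 0)
    (hmT : ∀ Q, m (S Q) ≠ ∞) {u : X → ℝ≥0∞} (c : ℝ≥0∞) (hc : c ≠ ∞) :
    c * ∑' R : stoppingSet (dyadicAverage m S u) (2 * c), m (S R)
      ≤ ∫⁻ x, (if c < u x then u x else 0) ∂m := by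
  rw [← ENNReal.tsum_mul_left]
  have h1 : ∀ R : stoppingSet (dyadicAverage m S u) (2 * c), c * m (S R)
      ≤ ∫⁻ x in S R, (if c < u x then u x else 0) ∂m := fun R => by
    refine mul_measure_le_setLIntegral hc (hmT _) ?_
    have h2 : 2 * c ≤ (∫⁻ x in S R, u x ∂m) / m (S R) := by
      refine R.2.1.le.trans (le_of_eq ?_)
      rw [dyadicAverage, mul_comm, div_eq_mul_inv]
    exact (ENNReal.le_div_iff_mul_le (Or.inl (hm0 _)) (Or.inl (hmT _))).1 h2
  refine (ENNReal.tsum_le_tsum h1).trans ?_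
  rw [← lintegral_iUnion (fun R => hS.measurableSet _)]
  · exact setLIntegral_le_lintegral _ _
  · intro R R' hne
    exact hS.disjoint_stopping R.2 R'.2 (Subtype.coe_ne_coe.2 hne)

/-- The dyadic Carleson embedding theorem with exponents `2 ≤ 2 t`. -/
theorem IsDyadicFamily.carleson_embedding (hS : IsDyadicFamily S) (hm0 : ∀ Q, m (S Q) ≠ 0)
    (hmT : ∀ Q, m (S Q) ≠ ∞) {u : X → ℝ≥0∞} (hu : Measurable u) (hU : ∫⁻ x, u x ^ (2 : ℝ) ∂m ≠ ∞)
    {t : ℝ} (ht : 1 ≤ t) {b : ℕ × ℤ → ℝ≥0∞} {ε : ℝ≥0∞}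
    (hb : ∀ R, ∑' Q : {Q // IsAncestor R Q}, b Q ≤ ε * m (S R) ^ t) :
    ∑' Q, b Q * dyadicAverage m S u Q ^ (2 * t)
      ≤ ε * (32 * ∫⁻ x, u x ^ (2 : ℝ) ∂m) ^ t := by
  classical
  have ht0 : 0 < t := by linarith
  set a := dyadicAverage m S u with ha
  have haT : ∀ Q, a Q ≠ ∞ := fun Q => by
    refine ENNReal.mul_ne_top (ENNReal.inv_ne_top.2 (hm0 Q)) (ne_top_of_le_ne_top
      (ENNReal.add_ne_top.2 ⟨hmT Q, hU⟩) ?_)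
    calc ∫⁻ x in S Q, u x ∂m ≤ ∫⁻ x in S Q, (1 + u x ^ (2 : ℝ)) ∂m := by
          refine lintegral_mono fun x => ?_
          rcases le_total (u x) 1 with h | h
          · exact h.trans le_self_add
          · refine le_trans ?_ le_add_self
            rw [ENNReal.rpow_ofNat, pow_two]
            exact le_mul_of_one_le_left' h
      _ = m (S Q) + ∫⁻ x in S Q, u x ^ (2 : ℝ) ∂m := by
          rw [lintegral_add_left measurable_const]; simp
      _ ≤ _ := by gcongr; exact Measure.restrict_le_self
  have h2 : ∀ j : ℤ, (2 : ℝ≥0∞) ^ j ≠ ∞ := fun j => ENNReal.zpow_ne_top (by norm_num) (by norm_num) j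
  have hz : ∀ j : ℤ, (2 : ℝ≥0∞) * 2 ^ (j - 1) = 2 ^ j := fun j => by
    conv_rhs => rw [← sub_add_cancel j 1, ENNReal.zpow_add (by norm_num) (by norm_num), zpow_one]
    rw [mul_comm]
  -- Only the level `2 ^ j < a Q ≤ 2 ^ (j + 1)` is needed; there `a Q ^ 2 ≤ 4 * 2 ^ j * 2 ^ j`.
  have step1 : ∀ Q, b Q * a Q ^ (2 * t)
      ≤ ∑' j : ℤ, (if (2 : ℝ≥0∞) ^ j < a Q then b Q * (4 * (2 : ℝ≥0∞) ^ j * 2 ^ j) ^ t else 0) := by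
    intro Q
    rcases eq_or_ne (a Q) 0 with h0 | h0
    · rw [h0, ENNReal.zero_rpow_of_pos (by linarith), mul_zero]; exact zero_le
    obtain ⟨J, hJ1, hJ2⟩ := ENNReal.exists_mem_Ioc_zpow h0 (haT Q) (y := 2) (by norm_num) (by norm_num)
    refine le_trans ?_ (ENNReal.le_tsum J)
    rw [if_pos hJ1, ENNReal.rpow_mul]
    gcongr
    calc a Q ^ (2 : ℝ) ≤ (2 ^ (J + 1) : ℝ≥0∞) ^ (2 : ℝ) := by gcongr
      _ = _ := by
        rw [ENNReal.rpow_ofNat, ENNReal.zpow_add (by norm_num) (by norm_num), zpow_one]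
        ring
  -- Every `Q` with a large average descends from a stopping set, so the Carleson condition bounds
  -- the sum of `b`. Superadditivity of `x ^ t` (this is where `t ≥ 1` enters) and the weak-type
  -- inequality at level `2 ^ (j - 1)` then finish the level.
  have step2 : ∀ j : ℤ, ∑' Q, (if (2 : ℝ≥0∞) ^ j < a Q then b Q * (4 * (2 : ℝ≥0∞) ^ j * 2 ^ j) ^ t else 0)
      ≤ ε * (8 * ∫⁻ x, (if (2 : ℝ≥0∞) ^ (j - 1) < u x then 2 ^ j * u x else 0) ∂m) ^ t := by
    intro j
    have h3 : ∑' Q, (if (2 : ℝ≥0∞) ^ j < a Q then b Q else 0)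
        ≤ ε * (∑' R : stoppingSet a (2 ^ j), m (S R)) ^ t := by
      calc ∑' Q, (if (2 : ℝ≥0∞) ^ j < a Q then b Q else 0)
          ≤ ∑' Q, ∑' R : stoppingSet a (2 ^ j), (if IsAncestor R.1 Q then b Q else 0) := by
            refine ENNReal.tsum_le_tsum fun Q => ?_
            split_ifs with hQ
            · obtain ⟨R, hR, hRQ⟩ := exists_stopping hQ
              refine le_trans ?_ (ENNReal.le_tsum ⟨R, hR⟩)
              rw [if_pos hRQ]
            · exact zero_le
        _ = ∑' R : stoppingSet a (2 ^ j), ∑' Q, (if IsAncestor R.1 Q then b Q else 0) :=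
            ENNReal.tsum_comm
        _ ≤ ∑' R : stoppingSet a (2 ^ j), ε * m (S R) ^ t := by
            refine ENNReal.tsum_le_tsum fun R => (le_of_eq ?_).trans (hb R)
            exact (tsum_subtype {Q | IsAncestor R.1 Q} b).symm
        _ ≤ _ := by
            rw [ENNReal.tsum_mul_left]
            gcongr
            exact ENNReal.tsum_rpow_le _ ht
    have h4 := hS.tsum_stopping_le (u := u) hm0 hmT (2 ^ (j - 1)) (h2 _)
    rw [hz, ← ha] at h4
    calc _ = (∑' Q, (if (2 : ℝ≥0∞) ^ j < a Q then b Q else 0)) * (4 * (2 : ℝ≥0∞) ^ j * 2 ^ j) ^ t := by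
          rw [← ENNReal.tsum_mul_right]
          refine tsum_congr fun Q => ?_
          split_ifs <;> simp
      _ ≤ ε * (∑' R : stoppingSet a (2 ^ j), m (S R)) ^ t * (4 * (2 : ℝ≥0∞) ^ j * 2 ^ j) ^ t := by gcongr
      _ = ε * (8 * (2 ^ j * (2 ^ (j - 1) * ∑' R : stoppingSet a (2 ^ j), m (S R)))) ^ t := by
          rw [mul_assoc, ← ENNReal.mul_rpow_of_nonneg _ _ ht0.le, ← hz j]
          congr 2
          ring
      _ ≤ ε * (8 * (2 ^ j * ∫⁻ x, (if (2 : ℝ≥0∞) ^ (j - 1) < u x then u x else 0) ∂m)) ^ t := by gcongr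
      _ = _ := by
          rw [← lintegral_const_mul' _ _ (h2 j)]
          simp only [mul_ite, mul_zero]
  calc ∑' Q, b Q * a Q ^ (2 * t)
      ≤ ∑' Q, ∑' j : ℤ, (if (2 : ℝ≥0∞) ^ j < a Q then b Q * (4 * (2 : ℝ≥0∞) ^ j * 2 ^ j) ^ t else 0) :=
        ENNReal.tsum_le_tsum step1
    _ = ∑' j : ℤ, ∑' Q, (if (2 : ℝ≥0∞) ^ j < a Q then b Q * (4 * (2 : ℝ≥0∞) ^ j * 2 ^ j) ^ t else 0) :=
        ENNReal.tsum_comm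
    _ ≤ ∑' j : ℤ, ε * (8 * ∫⁻ x, (if (2 : ℝ≥0∞) ^ (j - 1) < u x then 2 ^ j * u x else 0) ∂m) ^ t :=
        ENNReal.tsum_le_tsum step2
    -- Summing over levels, the weights `2 ^ j` with `2 ^ (j - 1) < u x` add up to at most `4 * u
    -- x`; this gives the constant `32 = 8 * 4`.
    _ ≤ ε * (8 * ∫⁻ x, 4 * u x ^ (2 : ℝ) ∂m) ^ t := by
        rw [ENNReal.tsum_mul_left]
        gcongr
        refine (ENNReal.tsum_rpow_le _ ht).trans ?_
        gcongr
        rw [ENNReal.tsum_mul_left]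
        gcongr
        rw [← lintegral_tsum]
        · refine lintegral_mono fun x => ?_
          have := ENNReal.tsum_zpow_ite_le (u x)
          calc ∑' j : ℤ, (if (2 : ℝ≥0∞) ^ (j - 1) < u x then 2 ^ j * u x else 0)
              = (∑' j : ℤ, (if (2 : ℝ≥0∞) ^ (j - 1) < u x then (2 : ℝ≥0∞) ^ j else 0)) * u x := by
                rw [← ENNReal.tsum_mul_right]
                refine tsum_congr fun Q => ?_
                split_ifs <;> simp
            _ ≤ 4 * u x * u x := by gcongr
            _ = _ := by rw [ENNReal.rpow_ofNat]; ring
        · intro j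
          exact (Measurable.ite (measurableSet_lt measurable_const hu) (by fun_prop) measurable_const).aemeasurable
    _ = _ := by
        rw [lintegral_const_mul' _ _ (by norm_num), ← mul_assoc]
        norm_num

end Embedding

/-! ### Polar coordinates and the doubling measure of a radial weight -/

/-- The radii `1 - 2⁻ⁿ`. -/
noncomputable def dyadicRadius (n : ℕ) : ℝ := 1 - 2⁻¹ ^ n

theorem dyadicRadius_zero : dyadicRadius 0 = 0 := by simp [dyadicRadius]

theorem dyadicRadius_mono : Monotone dyadicRadius := fun m n h => by
  have : (2⁻¹ : ℝ) ^ n ≤ 2⁻¹ ^ m := pow_le_pow_of_le_one (by norm_num) (by norm_num) h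
  simp only [dyadicRadius]
  linarith

theorem dyadicRadius_lt_one (n : ℕ) : dyadicRadius n < 1 := by
  have : (0 : ℝ) < 2⁻¹ ^ n := by positivity
  simp only [dyadicRadius]; linarith

theorem dyadicRadius_nonneg (n : ℕ) : 0 ≤ dyadicRadius n := by
  rw [← dyadicRadius_zero]; exact dyadicRadius_mono n.zero_le

theorem dyadicRadius_succ (n : ℕ) : dyadicRadius (n + 1) = (1 + dyadicRadius n) / 2 := by
  simp only [dyadicRadius, pow_succ]; ring

/-- A finite measure on `(0, 1)` with positive tails that satisfy the upper doubling condition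
along the dyadic radii. -/
structure IsDoublingMeasure (lam : Measure ℝ) (K : ℝ≥0) : Prop where
  finite : IsFiniteMeasure lam
  support : ∀ᵐ ρ ∂lam, ρ ∈ Ioo (0 : ℝ) 1
  pos : ∀ n, lam (Ici (dyadicRadius n)) ≠ 0
  doubling : ∀ n, lam (Ici (dyadicRadius n)) ≤ K * lam (Ici (dyadicRadius (n + 1)))

theorem isOpen_disc : IsOpen disc := Metric.isOpen_ball

theorem measurableSet_disc : MeasurableSet disc := isOpen_disc.measurableSet

theorem mem_disc {z : ℂ} : z ∈ disc ↔ ‖z‖ < 1 := mem_ball_zero_iff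

theorem measurable_circleMap_prod : Measurable fun p : ℝ × ℝ => circleMap 0 p.1 p.2 := by
  unfold circleMap
  fun_prop

theorem volume_preimage_norm_eq_zero {N : Set ℝ} (hN : volume N = 0) :
    volume ((fun z : ℂ => ‖z‖) ⁻¹' N) = 0 := by
  obtain ⟨N', hsub, hmeas, h0⟩ := exists_measurable_superset_of_null hN
  refine measure_mono_null (preimage_mono hsub) ?_
  have hm : MeasurableSet ((fun z : ℂ => ‖z‖) ⁻¹' N') := measurable_norm hmeas
  rw [← lintegral_indicator_one hm, ← Complex.lintegral_comp_polarCoord_symm]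
  have hz : ∀ᵐ p : ℝ × ℝ ∂(volume.restrict polarCoord.target), p.1 ∉ N' := by
    apply ae_restrict_of_ae
    rw [ae_iff]
    simp only [not_not]
    have : {a : ℝ × ℝ | a.1 ∈ N'} = N' ×ˢ univ := by ext; simp
    rw [this, Measure.volume_eq_prod, Measure.prod_prod, h0, zero_mul]
  rw [lintegral_congr_ae (g := 0), Pi.zero_def, lintegral_zero]
  filter_upwards [hz, ae_restrict_mem polarCoord.open_target.measurableSet] with p hp hpt
  have hp0 : 0 < p.1 := hpt.1
  simp [indicator, abs_of_pos hp0, hp]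

/-- A radial weight is only almost everywhere measurable; this permits replacing it by a measurable
representative. -/
theorem weightMeasure_congr {ω ω' : ℝ → ℝ} (h : ω =ᵐ[volume.restrict (Ico 0 1)] ω') :
    weightMeasure ω = weightMeasure ω' := by
  apply withDensity_congr_ae
  rw [Filter.EventuallyEq, ae_restrict_iff' measurableSet_disc]
  have h1 := (ae_restrict_iff' measurableSet_Ico).1 h
  rw [ae_iff] at h1
  rw [ae_iff]
  refine measure_mono_null ?_ (volume_preimage_norm_eq_zero h1)
  intro z hz
  simp only [mem_ofPred_eq, mem_preimage, disc, mem_ball_zero_iff] at hz ⊢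
  intro h2
  exact hz fun h3 => by rw [h2 ⟨norm_nonneg z, h3⟩]

theorem lintegral_weightMeasure {ω : ℝ → ℝ} (hω : AEMeasurable ω (volume.restrict (Ico 0 1)))
    {g : ℂ → ℝ≥0∞} (hg : Measurable g) :
    ∫⁻ z, g z ∂(weightMeasure ω) = ∫⁻ ρ, (∫⁻ θ in Ioc (-Real.pi) Real.pi, g (circleMap 0 ρ θ))
      ∂((volume.restrict (Ioo (0 : ℝ) 1)).withDensity fun ρ => ENNReal.ofReal (ρ * ω ρ)) := by
  have hω' := hω.ae_eq_mk
  have hmk := hω.measurable_mk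
  set w := hω.mk ω
  have hlam : (volume.restrict (Ioo (0 : ℝ) 1)).withDensity (fun ρ => ENNReal.ofReal (ρ * ω ρ))
      = (volume.restrict (Ioo (0 : ℝ) 1)).withDensity (fun ρ => ENNReal.ofReal (ρ * w ρ)) := by
    apply withDensity_congr_ae
    have := ae_restrict_of_ae_restrict_of_subset (Ioo_subset_Ico_self (a := (0 : ℝ)) (b := 1)) hω'
    filter_upwards [this] with ρ hρ
    rw [hρ]
  have hcm := measurable_circleMap_prod
  have hgm : Measurable fun ρ => ∫⁻ θ in Ioc (-Real.pi) Real.pi, g (circleMap 0 ρ θ) :=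
    Measurable.lintegral_prod_right' (f := fun p : ℝ × ℝ => g (circleMap 0 p.1 p.2)) (hg.comp hcm)
  have hfm : Measurable fun ρ => ENNReal.ofReal (ρ * w ρ) := by fun_prop
  rw [weightMeasure_congr hω', hlam, weightMeasure,
    lintegral_withDensity_eq_lintegral_mul _ (by fun_prop) hg,
    lintegral_withDensity_eq_lintegral_mul _ hfm hgm,
    ← lintegral_indicator measurableSet_disc,
    ← Complex.lintegral_comp_polarCoord_symm]
  have htar : polarCoord.target = Ioi (0 : ℝ) ×ˢ Ioo (-Real.pi) Real.pi := rfl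
  have hrestr : (volume : Measure (ℝ × ℝ)).restrict polarCoord.target
      = (volume.restrict (Ioi (0 : ℝ))).prod (volume.restrict (Ioc (-Real.pi) Real.pi)) := by
    rw [htar, Measure.volume_eq_prod, ← Measure.prod_restrict, restrict_Ioo_eq_restrict_Ioc]
  have hF : Measurable fun p : ℝ × ℝ => (Ioo (0 : ℝ) 1).indicator (fun ρ => ENNReal.ofReal (ρ * w ρ)) p.1
      * g (circleMap 0 p.1 p.2) := by
    apply Measurable.mul _ (hg.comp hcm)
    exact Measurable.comp (g := (Ioo (0 : ℝ) 1).indicator (fun ρ => ENNReal.ofReal (ρ * w ρ)))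
      (Measurable.indicator (by fun_prop) measurableSet_Ioo) measurable_fst
  have e1 : ∫⁻ p in polarCoord.target, ENNReal.ofReal p.1 • (disc.indicator
        ((fun z : ℂ => ENNReal.ofReal (w ‖z‖)) * g)) (Complex.polarCoord.symm p)
      = ∫⁻ p in polarCoord.target, (Ioo (0 : ℝ) 1).indicator (fun ρ => ENNReal.ofReal (ρ * w ρ)) p.1
      * g (circleMap 0 p.1 p.2) := by
    apply setLIntegral_congr_fun polarCoord.open_target.measurableSet
    intro p hp
    have hp0 : 0 < p.1 := hp.1
    have h1 : ‖Complex.polarCoord.symm p‖ = p.1 := by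
      rw [Complex.norm_polarCoord_symm, abs_of_pos hp0]
    have h2 : Complex.polarCoord.symm p = circleMap 0 p.1 p.2 := by
      rw [Complex.polarCoord_symm_apply, circleMap, Complex.exp_mul_I]; simp
    dsimp only
    by_cases h3 : p.1 < 1
    · have h4 : Complex.polarCoord.symm p ∈ disc := by rwa [mem_disc, h1]
      have h5 : p.1 ∈ Ioo (0 : ℝ) 1 := ⟨hp0, h3⟩
      rw [indicator_of_mem h4, indicator_of_mem h5]
      simp only [Pi.mul_apply, smul_eq_mul, h1]
      rw [← mul_assoc, ← ENNReal.ofReal_mul hp0.le, h2]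
    · have h4 : Complex.polarCoord.symm p ∉ disc := by rwa [mem_disc, h1]
      have h5 : p.1 ∉ Ioo (0 : ℝ) 1 := fun h => h3 h.2
      rw [indicator_of_notMem h4, indicator_of_notMem h5, smul_zero, zero_mul]
  rw [e1, hrestr, lintegral_prod _ hF.aemeasurable]
  simp only [Pi.mul_apply]
  rw [← lintegral_indicator measurableSet_Ioo, ← lintegral_indicator measurableSet_Ioi]
  apply lintegral_congr
  intro ρ
  by_cases h1 : ρ ∈ Ioo (0 : ℝ) 1
  · have h2 : ρ ∈ Ioi (0 : ℝ) := h1.1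
    rw [indicator_of_mem h2, indicator_of_mem h1]
    simp_rw [indicator_of_mem h1]
    rw [lintegral_const_mul' _ _ ENNReal.ofReal_ne_top]
  · rw [indicator_of_notMem h1]
    simp [indicator, h1]

theorem measure_Ici_le_ofReal_tail {ω : ℝ → ℝ} (hω : IsRadialWeight ω) {r : ℝ} (hr : r ∈ Ico (0 : ℝ) 1) :
    ((volume.restrict (Ioo (0 : ℝ) 1)).withDensity fun ρ => ENNReal.ofReal (ρ * ω ρ)) (Ici r)
      ≤ ENNReal.ofReal (tail ω r) := by
  have hsub : Ico r 1 ⊆ Ico 0 1 := Ico_subset_Ico_left hr.1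
  rw [withDensity_apply _ measurableSet_Ici, Measure.restrict_restrict measurableSet_Ici, tail,
    ofReal_integral_eq_lintegral_ofReal (hω.integrable.mono_set hsub)
      ((ae_restrict_iff' measurableSet_Ico).2 (Eventually.of_forall fun s hs => hω.nonneg s (hsub hs)))]
  calc _ ≤ ∫⁻ ρ in Ici r ∩ Ioo 0 1, ENNReal.ofReal (ω ρ) := by
        apply setLIntegral_mono' (measurableSet_Ici.inter measurableSet_Ioo)
        intro ρ hρ
        apply ENNReal.ofReal_le_ofReal
        exact mul_le_of_le_one_left (hω.nonneg ρ ⟨hρ.2.1.le, hρ.2.2⟩) hρ.2.2.le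
    _ ≤ _ := lintegral_mono_set (show Ici r ∩ Ioo 0 1 ⊆ Ico r 1 from fun ρ hρ => ⟨hρ.1, hρ.2.2⟩)

theorem ofReal_tail_le_measure_Ici {ω : ℝ → ℝ} (hω : IsRadialWeight ω) {r : ℝ}
    (hr : r ∈ Ico (1 / 2 : ℝ) 1) :
    ENNReal.ofReal (tail ω r) ≤ 2 *
    ((volume.restrict (Ioo (0 : ℝ) 1)).withDensity fun ρ => ENNReal.ofReal (ρ * ω ρ)) (Ici r) := by
  have hr0 : 0 ≤ r := by linarith [hr.1]
  have hsub : Ico r 1 ⊆ Ico 0 1 := Ico_subset_Ico_left hr0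
  rw [withDensity_apply _ measurableSet_Ici, Measure.restrict_restrict measurableSet_Ici, tail,
    ofReal_integral_eq_lintegral_ofReal (hω.integrable.mono_set hsub)
      ((ae_restrict_iff' measurableSet_Ico).2 (Eventually.of_forall fun s hs => hω.nonneg s (hsub hs))),
    ← lintegral_const_mul' _ _ (by norm_num)]
  calc ∫⁻ ρ in Ico r 1, ENNReal.ofReal (ω ρ) ≤ ∫⁻ ρ in Ico r 1, 2 * ENNReal.ofReal (ρ * ω ρ) := by
        apply setLIntegral_mono' measurableSet_Ico
        intro ρ hρ
        have h0 := hω.nonneg ρ (hsub hρ)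
        rw [← ENNReal.ofReal_ofNat, ← ENNReal.ofReal_mul (by norm_num)]
        apply ENNReal.ofReal_le_ofReal
        have : 1 / 2 ≤ ρ := hr.1.trans hρ.1
        nlinarith
    _ ≤ _ := lintegral_mono_set (show Ico r 1 ⊆ Ici r ∩ Ioo 0 1 from
        fun ρ hρ => ⟨hρ.1, by linarith [hr.1, hρ.1], hρ.2⟩)

/-- The measure is `ρ ω(ρ) dρ` on `(0, 1)`. The factor `ρ` is at most `1`, and at least `1 / 2`
beyond every dyadic radius except the zeroth, so the doubling constant `C` becomes `2 C`. -/
theorem IsUpperDoubling.exists_isDoublingMeasure {ω : ℝ → ℝ} (hω : IsUpperDoubling ω) :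
    ∃ (lam : Measure ℝ) (K : ℝ≥0), IsDoublingMeasure lam K ∧ ∀ g : ℂ → ℝ≥0∞, Measurable g →
      ∫⁻ z, g z ∂(weightMeasure ω)
        = ∫⁻ ρ, (∫⁻ θ in Ioc (-Real.pi) Real.pi, g (circleMap 0 ρ θ)) ∂lam := by
  have hr := hω.toIsRadialWeight
  obtain ⟨C, hC1, hC⟩ := hω.doubling
  refine ⟨(volume.restrict (Ioo (0 : ℝ) 1)).withDensity fun ρ => ENNReal.ofReal (ρ * ω ρ),
    Real.toNNReal (C * 2), ?_, fun g hg => lintegral_weightMeasure hr.integrable.aemeasurable hg⟩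
  have hmem : ∀ n, dyadicRadius n ∈ Ico (0 : ℝ) 1 := fun n => ⟨dyadicRadius_nonneg n, dyadicRadius_lt_one n⟩
  have hmem' : ∀ n, dyadicRadius (n + 1) ∈ Ico (1 / 2 : ℝ) 1 := fun n =>
    ⟨by rw [dyadicRadius_succ]; linarith [dyadicRadius_nonneg n], dyadicRadius_lt_one _⟩
  have hd : ∀ n, ((volume.restrict (Ioo (0 : ℝ) 1)).withDensity fun ρ => ENNReal.ofReal (ρ * ω ρ))
      (Ici (dyadicRadius n)) ≤ (Real.toNNReal (C * 2) : ℝ≥0∞) *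
      ((volume.restrict (Ioo (0 : ℝ) 1)).withDensity fun ρ => ENNReal.ofReal (ρ * ω ρ))
      (Ici (dyadicRadius (n + 1))) := fun n => by
    refine (measure_Ici_le_ofReal_tail hr (hmem n)).trans ?_
    have h1 := hC _ (hmem n)
    rw [← dyadicRadius_succ] at h1
    refine (ENNReal.ofReal_le_ofReal h1).trans ?_
    rw [ENNReal.ofReal_mul (by linarith), ← ENNReal.ofReal, ENNReal.ofReal_mul (by linarith), mul_assoc]
    gcongr
    simpa using ofReal_tail_le_measure_Ici hr (hmem' n)
  have hs : ∀ᵐ ρ ∂((volume.restrict (Ioo (0 : ℝ) 1)).withDensity fun ρ => ENNReal.ofReal (ρ * ω ρ)),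
      ρ ∈ Ioo (0 : ℝ) 1 :=
    (withDensity_absolutelyContinuous _ _).ae_le (ae_restrict_mem measurableSet_Ioo)
  refine ⟨?_, hs, ?_, ?_⟩
  · refine ⟨?_⟩
    have h1 := measure_Ici_le_ofReal_tail hr (hmem 0)
    refine lt_of_le_of_lt (measure_mono_ae ?_) (h1.trans_lt ENNReal.ofReal_lt_top)
    filter_upwards [hs] with ρ hρ _
    rw [dyadicRadius_zero]
    exact hρ.1.le
  -- Vanishing is passed on to the next radius, because the lower bound by the tail needs a radius
  -- of at least `1 / 2`.
  · intro n h0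
    have h1 := hd n
    have h2 := ofReal_tail_le_measure_Ici hr (hmem' n)
    have h3 : 0 < ENNReal.ofReal (tail ω (dyadicRadius (n + 1))) :=
      ENNReal.ofReal_pos.2 (hr.tail_pos _ (hmem _))
    have h4 := measure_mono_null (Ici_subset_Ici.2 (dyadicRadius_mono n.le_succ)) h0
    rw [h4, mul_zero] at h2
    exact absurd h3 (not_lt.2 h2)
  · intro n
    exact hd n

/-! ### Lifted Carleson squares and the local bound -/

/-- The index of the dyadic arc of generation `n` (of length `2π / 2ⁿ`) that contains `θ`. -/
noncomputable def arcIndex (n : ℕ) (θ : ℝ) : ℤ := ⌊θ * 2 ^ n / (2 * Real.pi)⌋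

theorem measurable_arcIndex (n : ℕ) : Measurable (arcIndex n) := by
  unfold arcIndex
  fun_prop

theorem arcIndex_ediv {m n : ℕ} (h : m ≤ n) (θ : ℝ) :
    arcIndex n θ / 2 ^ (n - m) = arcIndex m θ := by
  have h1 : θ * 2 ^ m / (2 * Real.pi) = (θ * 2 ^ n / (2 * Real.pi)) / ((2 ^ (n - m) : ℕ) : ℝ) := by
    rw [← Nat.sub_add_cancel h, pow_add, Nat.sub_add_cancel h]
    push_cast
    field_simp
  rw [arcIndex, arcIndex, h1, Int.floor_div_natCast]
  norm_cast

theorem arcIndex_eq_iff {n : ℕ} {θ : ℝ} {k : ℤ} :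
    arcIndex n θ = k ↔ θ ∈ Ico (2 * Real.pi / 2 ^ n * k) (2 * Real.pi / 2 ^ n * (k + 1)) := by
  have hp : 0 < 2 * Real.pi := by positivity
  have h2 : (0 : ℝ) < 2 ^ n := by positivity
  rw [arcIndex, Int.floor_eq_iff, mem_Ico, le_div_iff₀ hp, div_lt_iff₀ hp, div_mul_eq_mul_div,
    div_mul_eq_mul_div, div_le_iff₀ h2, lt_div_iff₀ h2, mul_comm (k : ℝ), mul_comm ((k : ℝ) + 1)]

theorem abs_sub_le_of_arcIndex_eq {n : ℕ} {θ θ₀ : ℝ} {d : ℤ} (h : arcIndex n θ = arcIndex n θ₀ + d) :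
    2 * Real.pi / 2 ^ n * (|(d : ℝ)| - 1) ≤ |θ - θ₀| := by
  have h1 := arcIndex_eq_iff.1 h
  have h2 := arcIndex_eq_iff.1 (rfl : arcIndex n θ₀ = arcIndex n θ₀)
  have hc : 0 < 2 * Real.pi / 2 ^ n := by positivity
  set c := 2 * Real.pi / 2 ^ n
  set k := arcIndex n θ₀
  obtain ⟨h3, h4⟩ := h1
  obtain ⟨h5, h6⟩ := h2
  push_cast at h3 h4
  rcases le_total 0 (d : ℝ) with hd | hd
  · rw [abs_of_nonneg hd]
    refine le_trans ?_ (le_abs_self _)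
    nlinarith
  · rw [abs_of_nonpos hd]
    refine le_trans ?_ (neg_le_abs _)
    nlinarith

/-- The lifted Carleson square with index `Q`, in the polar coordinates `(ρ, θ)`. -/
def cell (Q : ℕ × ℤ) : Set (ℝ × ℝ) := Ici (dyadicRadius Q.1) ×ˢ {θ | arcIndex Q.1 θ = Q.2}

theorem measurableSet_arc (n : ℕ) (k : ℤ) : MeasurableSet {θ | arcIndex n θ = k} :=
  measurable_arcIndex n (measurableSet_singleton k)

theorem volume_arc (n : ℕ) (k : ℤ) :
    volume {θ | arcIndex n θ = k} = ENNReal.ofReal (2 * Real.pi / 2 ^ n) := by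
  have : {θ | arcIndex n θ = k} = Ico (2 * Real.pi / 2 ^ n * k) (2 * Real.pi / 2 ^ n * (k + 1)) := by
    ext θ; exact arcIndex_eq_iff
  rw [this, Real.volume_Ico]
  congr 1; ring

/-- Angles run over the whole line rather than the circle: the squares then never wrap around, and a
shift of the position by any integer stays in the family. -/
theorem isDyadicFamily_cell : IsDyadicFamily cell where
  measurableSet Q := measurableSet_Ici.prod (measurableSet_arc _ _)
  subset_ancestor Q n hn := by
    rintro ⟨ρ, θ⟩ ⟨h1, h2⟩
    refine ⟨(dyadicRadius_mono hn).trans h1, ?_⟩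
    have h2 : arcIndex Q.1 θ = Q.2 := h2
    change arcIndex n θ = Q.2 / 2 ^ (Q.1 - n)
    rw [← h2, arcIndex_ediv hn]
  disjoint n k l hkl := by
    rw [Set.disjoint_left]
    rintro ⟨ρ, θ⟩ ⟨_, h1⟩ ⟨_, h2⟩
    exact hkl (h1.symm.trans h2)

/-- The common measure of the Carleson squares of generation `n`. -/
noncomputable def cellMass (lam : Measure ℝ) (n : ℕ) : ℝ≥0∞ :=
  lam (Ici (dyadicRadius n)) * ENNReal.ofReal (2 * Real.pi / 2 ^ n)

theorem prod_cell (lam : Measure ℝ) (Q : ℕ × ℤ) : (lam.prod volume) (cell Q) = cellMass lam Q.1 := by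
  rw [cell, Measure.prod_prod, volume_arc, cellMass]

theorem IsDoublingMeasure.cellMass_ne_zero {lam : Measure ℝ} {K : ℝ≥0} (h : IsDoublingMeasure lam K)
    (n : ℕ) : cellMass lam n ≠ 0 := by
  refine mul_ne_zero (h.pos n) ?_
  rw [ENNReal.ofReal_ne_zero_iff]
  positivity

theorem IsDoublingMeasure.cellMass_ne_top {lam : Measure ℝ} {K : ℝ≥0} (h : IsDoublingMeasure lam K)
    (n : ℕ) : cellMass lam n ≠ ∞ := by
  have := h.finite
  exact ENNReal.mul_ne_top (measure_ne_top _ _) ENNReal.ofReal_ne_top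

/-- If `cos s ≤ 0`, the real part alone is at least `1`. Otherwise the distance from `1` to the ray
of angle `s` is `|sin s| ≥ 2 |s| / π`. -/
theorem abs_div_pi_le_norm_one_sub {r s : ℝ} (hr : 0 ≤ r) (hs : |s| ≤ Real.pi) :
    |s| / Real.pi ≤ ‖1 - circleMap 0 r s‖ := by
  have hpi := Real.pi_pos
  have hre : (1 - circleMap 0 r s).re = 1 - r * Real.cos s := by
    simp [circleMap, Complex.exp_re]
  have him : (1 - circleMap 0 r s).im = -(r * Real.sin s) := by
    simp [circleMap, Complex.exp_im]
  rcases le_total (Real.cos s) 0 with hc | hc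
  · refine le_trans ((div_le_one hpi).2 hs) (le_trans ?_ (Complex.re_le_norm _))
    rw [hre]; nlinarith
  · have h1 : |s| ≤ Real.pi / 2 := by
      by_contra h
      push Not at h
      have := Real.cos_neg_of_pi_div_two_lt_of_lt h (by linarith)
      rw [Real.cos_abs] at this
      linarith
    have h2 := Real.mul_le_sin (abs_nonneg s) h1
    have h4 : Real.sin |s| ^ 2 = Real.sin s ^ 2 := by
      rcases abs_choice s with h | h <;> simp [h]
    have h3 : |s| / Real.pi ≤ Real.sin |s| := by
      refine le_trans ?_ h2
      rw [div_mul_eq_mul_div]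
      gcongr
      linarith [abs_nonneg s]
    refine h3.trans (le_of_sq_le_sq ?_ (norm_nonneg _))
    rw [h4, ← Complex.normSq_eq_norm_sq, Complex.normSq_apply, hre, him]
    nlinarith [Real.sin_sq_add_cos_sq s, sq_nonneg (r - Real.cos s)]

theorem conj_mul_circleMap (w : ℂ) (ρ θ : ℝ) :
    conj w * circleMap 0 ρ θ = circleMap 0 (‖w‖ * ρ) (θ - w.arg) := by
  conv_lhs => rw [← Complex.norm_mul_exp_arg_mul_I w]
  simp only [circleMap, zero_add, map_mul, Complex.conj_ofReal, ← Complex.exp_conj, Complex.conj_I]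
  push_cast
  rw [mul_mul_mul_comm, ← Complex.exp_add]
  congr 2
  ring

/-- The decay factor `1 / (1 + |d|)`. -/
noncomputable def decay (d : ℤ) : ℝ := (1 + |(d : ℝ)|)⁻¹

theorem decay_pos (d : ℤ) : 0 < decay d := by unfold decay; positivity

theorem decay_le_one (d : ℤ) : decay d ≤ 1 := by
  unfold decay
  apply inv_le_one_of_one_le₀
  linarith [abs_nonneg (d : ℝ)]

/-- The denominator is at least `1 - ‖w‖`, which settles `|d| ≤ 2`. For larger `|d|` it is at least
the angular distance divided by `π`, hence at least `2 (|d| - 1) (1 - ‖w‖)`. -/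
theorem norm_weight_le_decay {n : ℕ} {w : ℂ} (hw : w ∈ disc) (hwn : 1 - ‖w‖ ≤ 2⁻¹ ^ n) {ρ θ : ℝ}
    (hρ : ρ ∈ Ico (0 : ℝ) 1) (hθ : |θ - w.arg| ≤ Real.pi) {d : ℤ}
    (hd : arcIndex n θ = arcIndex n w.arg + d) :
    ‖(1 - ‖w‖ : ℂ) / (1 - conj w * circleMap 0 ρ θ)‖ ≤ 3 * decay d := by
  have hw1 : 0 < 1 - ‖w‖ := by rw [mem_disc] at hw; linarith
  have h1 : 1 - ‖w‖ ≤ ‖1 - conj w * circleMap 0 ρ θ‖ := by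
    have h := norm_sub_norm_le 1 (conj w * circleMap 0 ρ θ)
    rw [norm_mul, RCLike.norm_conj, norm_circleMap_zero, abs_of_nonneg hρ.1, norm_one] at h
    nlinarith [hρ.2, norm_nonneg w]
  have h2 : |θ - w.arg| / Real.pi ≤ ‖1 - conj w * circleMap 0 ρ θ‖ := by
    rw [conj_mul_circleMap]
    exact abs_div_pi_le_norm_one_sub (mul_nonneg (norm_nonneg _) hρ.1) hθ
  have h3 := abs_sub_le_of_arcIndex_eq hd
  have hpi := Real.pi_pos
  set D := ‖1 - conj w * circleMap 0 ρ θ‖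
  have h4 : 2 * 2⁻¹ ^ n * (|(d : ℝ)| - 1) ≤ D := by
    refine le_trans ?_ h2
    rw [le_div_iff₀ hpi]
    refine le_trans (le_of_eq ?_) h3
    rw [inv_pow]; field_simp
  have h5 : ‖(1 - ‖w‖ : ℂ)‖ = 1 - ‖w‖ := by
    rw [← Complex.ofReal_one, ← Complex.ofReal_sub, Complex.norm_real, Real.norm_of_nonneg hw1.le]
  have hD : 0 < D := hw1.trans_le h1
  rw [norm_div, h5, decay, ← div_eq_mul_inv, div_le_div_iff₀ hD (by positivity)]
  rcases le_total |(d : ℝ)| 2 with hd2 | hd2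
  · nlinarith [abs_nonneg (d : ℝ)]
  · have : (1 - ‖w‖) * (2 * (|(d : ℝ)| - 1)) ≤ D :=
      le_trans (by nlinarith) h4
    nlinarith

/-- The function `‖f‖ ^ α` in polar coordinates, extended by zero off the disc. -/
noncomputable def polarPow (f : ℂ → ℂ) (α : ℝ) (x : ℝ × ℝ) : ℝ≥0∞ :=
  ‖disc.indicator f (circleMap 0 x.1 x.2)‖ₑ ^ α

theorem measurable_indicator_disc {f : ℂ → ℂ} (hf : ContinuousOn f disc) :
    Measurable (disc.indicator f) := by
  classical
  rw [← piecewise_eq_indicator]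
  exact hf.measurable_piecewise continuousOn_const measurableSet_disc

theorem measurable_polarPow {f : ℂ → ℂ} (hf : ContinuousOn f disc) (α : ℝ) :
    Measurable (polarPow f α) :=
  ((measurable_indicator_disc hf).comp measurable_circleMap_prod).enorm.pow_const α

theorem polarPow_eq {f : ℂ → ℂ} {α ρ θ : ℝ} (hρ : ρ ∈ Ico (0 : ℝ) 1) :
    polarPow f α (ρ, θ) = ‖f (circleMap 0 ρ θ)‖ₑ ^ α := by
  rw [polarPow, indicator_of_mem]
  rw [mem_disc, norm_circleMap_zero, abs_of_nonneg hρ.1]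
  exact hρ.2

theorem lintegral_le_tsum_arc (n : ℕ) (k₀ : ℤ) (μ : Measure ℝ) (F : ℝ → ℝ≥0∞) :
    ∫⁻ θ, F θ ∂μ ≤ ∑' d : ℤ, ∫⁻ θ in {θ | arcIndex n θ = k₀ + d}, F θ ∂μ := by
  have h : (⋃ d : ℤ, {θ | arcIndex n θ = k₀ + d}) = univ := by
    ext θ
    simp only [mem_iUnion, mem_univ, iff_true]
    exact ⟨arcIndex n θ - k₀, by change arcIndex n θ = _; ring⟩
  rw [← setLIntegral_univ, ← h]
  exact lintegral_iUnion_le _ _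

/-- The circle estimate is applied to `f * v ^ N` in place of `f`. The analytic factor `v` is
bounded below near `w` and decays away from the direction of `w`, so it localizes the circle
integral to arcs near `arg w`. -/
theorem enorm_rpow_le_tsum_arc {f : ℂ → ℂ} (hf : DifferentiableOn ℂ f disc) {α : ℝ} (hα : 0 < α)
    {N : ℕ} {n : ℕ} {w ζ : ℂ} (hw : w ∈ disc) (hwn : 1 - ‖w‖ ∈ Ioc ((2⁻¹ : ℝ) ^ (n + 1)) (2⁻¹ ^ n))
    (hζ : ‖ζ - w‖ ≤ (1 - ‖w‖) / 4) {ρ : ℝ} (hρ : ρ ∈ Ico (dyadicRadius (n + 2)) 1) :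
    ‖f ζ‖ₑ ^ α ≤ ENNReal.ofReal ((9 / 4) ^ (N * α) * (8 * 2 ^ n)) *
      ∑' d : ℤ, ENNReal.ofReal ((3 * decay d) ^ (N * α)) *
        ∫⁻ θ in {θ | arcIndex n θ = arcIndex n w.arg + d}, polarPow f α (ρ, θ) := by
  have hw1 : 0 < 1 - ‖w‖ := by rw [mem_disc] at hw; linarith
  have hρ0 : ρ ∈ Ico (0 : ℝ) 1 := ⟨(dyadicRadius_nonneg _).trans hρ.1, hρ.2⟩
  have h2n : (0 : ℝ) < 2⁻¹ ^ n := by positivity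
  have hζn : ‖ζ‖ ≤ ‖w‖ + (1 - ‖w‖) / 4 := by
    have := norm_le_norm_add_norm_sub' ζ w
    linarith
  -- Here `1 - ‖ζ‖ ≥ (3 / 4) (1 - ‖w‖) > (3 / 8) 2⁻ⁿ`, whereas `1 - ρ ≤ (1 / 4) 2⁻ⁿ`.
  have hgap : 2⁻¹ ^ n / 8 ≤ ρ - ‖ζ‖ := by
    have h1 := hρ.1
    have h2 := hwn.1
    simp only [dyadicRadius, pow_add] at h1 h2
    norm_num at h1 h2 ⊢
    linarith
  have hζρ : ‖ζ‖ < ρ := by have := div_pos h2n (by norm_num : (0:ℝ) < 8); linarith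
  have hden : ∀ z : ℂ, ‖z‖ < 1 → 1 - conj w * z ≠ 0 := fun z hz h => by
    have : ‖conj w * z‖ = 1 := by rw [show conj w * z = 1 by linear_combination -h]; simp
    rw [norm_mul, RCLike.norm_conj] at this
    nlinarith [norm_nonneg z, norm_nonneg w]
  have hζ1 : ‖ζ‖ < 1 := by linarith [hρ.2]
  set v : ℂ → ℂ := fun z => (1 - ‖w‖ : ℂ) / (1 - conj w * z) with hv
  set F : ℂ → ℂ := fun z => f z * v z ^ N with hF
  have hFd : DifferentiableOn ℂ F disc := by
    apply hf.mul
    apply DifferentiableOn.pow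
    apply DifferentiableOn.div (differentiableOn_const _) (by fun_prop)
    intro z hz
    exact hden z (mem_disc.1 hz)
  have hNα : 0 ≤ N * α := by positivity
  have hFe : ∀ z, ‖F z‖ₑ ^ α = ‖f z‖ₑ ^ α * ENNReal.ofReal (‖v z‖ ^ (N * α)) := fun z => by
    rw [hF]
    simp only [enorm_mul, enorm_pow]
    rw [ENNReal.mul_rpow_of_nonneg _ _ hα.le, ← ENNReal.rpow_natCast, ← ENNReal.rpow_mul,
      ← ofReal_norm (v z), ENNReal.ofReal_rpow_of_nonneg (norm_nonneg _) hNα]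
  have hvζ : 1 ≤ 9 / 4 * ‖v ζ‖ := by
    have h5 : ‖(1 - ‖w‖ : ℂ)‖ = 1 - ‖w‖ := by
      rw [← Complex.ofReal_one, ← Complex.ofReal_sub, Complex.norm_real, Real.norm_of_nonneg hw1.le]
    have h6 : ‖1 - conj w * ζ‖ ≤ 9 / 4 * (1 - ‖w‖) := by
      have e : 1 - conj w * ζ = (1 - conj w * w) + conj w * (w - ζ) := by ring
      have e2 : ‖1 - conj w * w‖ = 1 - ‖w‖ ^ 2 := by
        rw [← Complex.normSq_eq_conj_mul_self, Complex.normSq_eq_norm_sq, ← Complex.ofReal_one,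
          ← Complex.ofReal_sub, Complex.norm_real, Real.norm_of_nonneg]
        nlinarith [norm_nonneg w]
      rw [e]
      refine (norm_add_le _ _).trans ?_
      rw [e2, norm_mul, RCLike.norm_conj, norm_sub_rev w ζ]
      nlinarith [norm_nonneg w, norm_nonneg (ζ - w)]
    rw [hv]
    simp only [norm_div, h5]
    rw [← mul_div_assoc, le_div_iff₀ (norm_pos_iff.2 (hden ζ hζ1))]
    linarith
  have hmain := enorm_rpow_le_lintegral_circleMap hFd hα hρ.2 hζρ (w.arg - Real.pi)
  have hf1 : ‖f ζ‖ₑ ^ α ≤ ENNReal.ofReal ((9 / 4) ^ (N * α)) * ‖F ζ‖ₑ ^ α := by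
    rw [hFe, mul_left_comm, ← ENNReal.ofReal_mul (by positivity),
      ← Real.mul_rpow (by norm_num) (norm_nonneg _)]
    apply le_mul_of_one_le_right'
    rw [ENNReal.one_le_ofReal]
    exact Real.one_le_rpow hvζ hNα
  have hr : ρ / (ρ - ‖ζ‖) ≤ 8 * 2 ^ n := by
    rw [div_le_iff₀ (by linarith)]
    have : (8 * 2 ^ n) * (2⁻¹ ^ n / 8) = (1 : ℝ) := by rw [inv_pow]; field_simp
    have h8 : (8 * 2 ^ n) * (2⁻¹ ^ n / 8) ≤ (8 * 2 ^ n) * (ρ - ‖ζ‖) := by gcongr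
    linarith [hρ.2]
  have hsum : ∫⁻ θ in Ioc (w.arg - Real.pi) (w.arg - Real.pi + 2 * Real.pi), ‖F (circleMap 0 ρ θ)‖ₑ ^ α
      ≤ ∑' d : ℤ, ENNReal.ofReal ((3 * decay d) ^ (N * α)) *
        ∫⁻ θ in {θ | arcIndex n θ = arcIndex n w.arg + d}, polarPow f α (ρ, θ) := by
    refine (lintegral_le_tsum_arc n (arcIndex n w.arg) _ _).trans ?_
    refine ENNReal.tsum_le_tsum fun d => ?_
    rw [Measure.restrict_restrict (measurableSet_arc _ _), ← lintegral_const_mul' _ _ ENNReal.ofReal_ne_top]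
    refine le_trans (setLIntegral_mono' ((measurableSet_arc _ _).inter measurableSet_Ioc) ?_)
      (lintegral_mono_set inter_subset_left)
    rintro θ ⟨hθ1, hθ2⟩
    rw [hFe, polarPow_eq hρ0, mul_comm]
    gcongr
    apply norm_weight_le_decay hw hwn.2 hρ0 _ hθ1
    rw [abs_le]
    constructor <;> linarith [hθ2.1, hθ2.2]
  calc ‖f ζ‖ₑ ^ α ≤ ENNReal.ofReal ((9 / 4) ^ (N * α)) * ‖F ζ‖ₑ ^ α := hf1
    _ ≤ ENNReal.ofReal ((9 / 4) ^ (N * α)) * (ENNReal.ofReal (8 * 2 ^ n) * _) := by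
        gcongr
        exact hmain.trans (mul_le_mul' (ENNReal.ofReal_le_ofReal hr) hsum)
    _ = _ := by rw [← mul_assoc, ← ENNReal.ofReal_mul (by positivity)]

/-- Local suprema of `‖f‖ ^ α` are controlled by averages over the Carleson squares of the same
generation. -/
theorem IsDoublingMeasure.exists_local_bound {lam : Measure ℝ} {K : ℝ≥0} (h : IsDoublingMeasure lam K)
    {α : ℝ} (hα : 0 < α) : ∃ C : ℝ≥0, ∀ f : ℂ → ℂ, DifferentiableOn ℂ f disc → ∀ (n : ℕ) (w : ℂ),
      w ∈ disc → 1 - ‖w‖ ∈ Ioc ((2⁻¹ : ℝ) ^ (n + 1)) (2⁻¹ ^ n) → ∀ ζ, ‖ζ - w‖ ≤ (1 - ‖w‖) / 4 →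
      ‖f ζ‖ₑ ^ α ≤ C * ∑' d : ℤ, ENNReal.ofReal (decay d) ^ 6 *
        dyadicAverage (lam.prod volume) cell (polarPow f α) (n, arcIndex n w.arg + d) := by
  -- This choice makes `N * α ≥ 6`. In the embedding two powers of the decay form summable weights
  -- and the other four offset the growth in `d` of the shifted estimates.
  obtain ⟨N, hN⟩ := exists_nat_ge (6 / α)
  rw [div_le_iff₀ hα] at hN
  have := h.finite
  set E : ℝ := (9 / 4) ^ (N * α) * 3 ^ (N * α) with hE
  refine ⟨K ^ 2 * Real.toNNReal (E * (16 * Real.pi)), fun f hf n w hw hwn ζ hζ => ?_⟩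
  set a := fun d => dyadicAverage (lam.prod volume) cell (polarPow f α) (n, arcIndex n w.arg + d) with ha
  set W := lam (Ici (dyadicRadius n)) with hW
  have hW0 : W ≠ 0 := h.pos n
  have hWT : W ≠ ∞ := measure_ne_top _ _
  have hm := measurable_polarPow hf.continuousOn α
  have hcell : ∀ d : ℤ, ∫⁻ x in cell (n, arcIndex n w.arg + d), polarPow f α x ∂(lam.prod volume)
      = cellMass lam n * a d := fun d => by
    rw [ha]
    simp only [dyadicAverage, prod_cell]
    rw [← mul_assoc, ENNReal.mul_inv_cancel (h.cellMass_ne_zero n) (h.cellMass_ne_top n), one_mul]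
  have hdec : ∀ d, ENNReal.ofReal ((3 * decay d) ^ (N * α))
      ≤ ENNReal.ofReal (3 ^ (N * α)) * ENNReal.ofReal (decay d) ^ 6 := fun d => by
    have hd := decay_pos d
    rw [← ENNReal.ofReal_pow hd.le, ← ENNReal.ofReal_mul (by positivity),
      Real.mul_rpow (by norm_num) hd.le]
    apply ENNReal.ofReal_le_ofReal
    refine mul_le_mul_of_nonneg_left ?_ (by positivity)
    rw [← Real.rpow_natCast]
    exact Real.rpow_le_rpow_of_exponent_ge hd (decay_le_one d) (by exact_mod_cast hN)
  have hpt : ∀ᵐ ρ ∂(lam.restrict (Ici (dyadicRadius (n + 2)))), ‖f ζ‖ₑ ^ α ≤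
      ENNReal.ofReal (E * (8 * 2 ^ n)) * ∑' d : ℤ, ENNReal.ofReal (decay d) ^ 6 *
        ∫⁻ θ in {θ | arcIndex n θ = arcIndex n w.arg + d}, polarPow f α (ρ, θ) := by
    filter_upwards [ae_restrict_mem measurableSet_Ici, ae_restrict_of_ae h.support] with ρ h1 h2
    refine (enorm_rpow_le_tsum_arc hf hα (N := N) hw hwn hζ ⟨h1, h2.2⟩).trans ?_
    rw [hE, mul_right_comm, ENNReal.ofReal_mul (q := 3 ^ (N * α)) (by positivity), mul_assoc]
    refine mul_le_mul' le_rfl ?_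
    rw [← ENNReal.tsum_mul_left]
    refine ENNReal.tsum_le_tsum fun d => ?_
    rw [← mul_assoc]
    exact mul_le_mul' (hdec d) le_rfl
  -- The bound holds on almost every circle of radius at least `1 - 2⁻⁽ⁿ⁺²⁾`; integration in the
  -- radius turns arc integrals into integrals over squares. Two applications of doubling then
  -- return from generation `n + 2` to `n`.
  have hint := lintegral_mono_ae hpt
  rw [lintegral_const, Measure.restrict_apply_univ, lintegral_const_mul' _ _ ENNReal.ofReal_ne_top,
    lintegral_tsum] at hint
  swap
  · intro d
    exact ((Measurable.lintegral_prod_right' (f := polarPow f α) hm).const_mul _).aemeasurable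
  have hrow : ∀ d : ℤ, ∫⁻ ρ in Ici (dyadicRadius (n + 2)), ENNReal.ofReal (decay d) ^ 6 *
        (∫⁻ θ in {θ | arcIndex n θ = arcIndex n w.arg + d}, polarPow f α (ρ, θ)) ∂lam
      ≤ ENNReal.ofReal (decay d) ^ 6 * (cellMass lam n * a d) := fun d => by
    rw [lintegral_const_mul' _ _ (by finiteness), ← hcell]
    gcongr
    rw [cell, ← Measure.prod_restrict, lintegral_prod _ hm.aemeasurable]
    exact lintegral_mono_set (Ici_subset_Ici.2 (dyadicRadius_mono (by omega)))
  have hKW : W ≤ (K : ℝ≥0∞) ^ 2 * lam (Ici (dyadicRadius (n + 2))) := by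
    refine (h.doubling n).trans ?_
    rw [pow_two, mul_assoc]
    gcongr
    exact h.doubling (n + 1)
  have hfin : ‖f ζ‖ₑ ^ α * W ≤ (K ^ 2 * Real.toNNReal (E * (16 * Real.pi)) : ℝ≥0) *
      (∑' d : ℤ, ENNReal.ofReal (decay d) ^ 6 * a d) * W := by
    calc ‖f ζ‖ₑ ^ α * W ≤ ‖f ζ‖ₑ ^ α * ((K : ℝ≥0∞) ^ 2 * lam (Ici (dyadicRadius (n + 2)))) := by gcongr
      _ = (K : ℝ≥0∞) ^ 2 * (‖f ζ‖ₑ ^ α * lam (Ici (dyadicRadius (n + 2)))) := by ring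
      _ ≤ (K : ℝ≥0∞) ^ 2 * (ENNReal.ofReal (E * (8 * 2 ^ n)) *
          ∑' d : ℤ, ENNReal.ofReal (decay d) ^ 6 * (cellMass lam n * a d)) := by
          refine mul_le_mul' le_rfl (hint.trans (mul_le_mul' le_rfl ?_))
          exact ENNReal.tsum_le_tsum hrow
      _ = (K : ℝ≥0∞) ^ 2 * (ENNReal.ofReal (E * (8 * 2 ^ n)) * ENNReal.ofReal (2 * Real.pi / 2 ^ n)) *
          (∑' d : ℤ, ENNReal.ofReal (decay d) ^ 6 * a d) * W := by
          simp_rw [mul_left_comm _ (cellMass lam n), ENNReal.tsum_mul_left]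
          rw [cellMass]
          ring
      _ = _ := by
          rw [← ENNReal.ofReal_mul (by positivity)]
          push_cast
          congr 4
          field_simp
          ring
  exact (ENNReal.mul_le_mul_iff_left hW0 hWT).1 hfin

/-! ### Periodic strips and the tiling of the disc by top halves of squares -/

/-- The `p`-th power of the Bergman norm in polar coordinates. -/
noncomputable def polarNorm (lam : Measure ℝ) (p : ℝ) (f : ℂ → ℂ) : ℝ≥0∞ :=
  ∫⁻ ρ, (∫⁻ θ in Ioc (-Real.pi) Real.pi, polarPow f p (ρ, θ)) ∂lam

theorem lintegral_Ioc_periodic {F : ℝ → ℝ≥0∞} {T : ℝ} (hT : 0 < T) (hF : Function.Periodic F T)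
    (a b : ℝ) : ∫⁻ θ in Ioc a (a + T), F θ = ∫⁻ θ in Ioc b (b + T), F θ := by
  refine (isAddFundamentalDomain_Ioc hT a).setLIntegral_eq (isAddFundamentalDomain_Ioc hT b) F ?_
  rintro ⟨g, k, rfl⟩ x
  change F (k • T + x) = F x
  rw [add_comm]
  exact hF.zsmul k x

theorem lintegral_Ioc_nat_mul_periodic_le {F : ℝ → ℝ≥0∞} {T : ℝ} (hT : 0 < T)
    (hF : Function.Periodic F T) (a b : ℝ) (m : ℕ) :
    ∫⁻ θ in Ioc a (a + m * T), F θ ≤ m * ∫⁻ θ in Ioc b (b + T), F θ := by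
  induction m with
  | zero => simp
  | succ m ih =>
    have h1 : Ioc a (a + (m + 1 : ℕ) * T) = Ioc a (a + m * T) ∪ Ioc (a + m * T) (a + m * T + T) := by
      rw [Ioc_union_Ioc_eq_Ioc (by have : 0 ≤ (m : ℝ) * T := by positivity
                                   linarith) (by linarith)]
      push_cast
      congr 1; ring
    rw [h1]
    refine (lintegral_union_le _ _ _).trans ?_
    rw [lintegral_Ioc_periodic hT hF (a + m * T) b]
    push_cast
    rw [add_mul, one_mul]
    gcongr

/-- The lift of `‖f‖ ^ α` is periodic and not integrable over all angles. Cut off to `2 D` periods,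
it has a square integral of at most `2 D` times that over one period. -/
theorem lintegral_strip_le {lam : Measure ℝ} [SFinite lam] {f : ℂ → ℂ} (hf : ContinuousOn f disc)
    (α : ℝ) (D : ℕ) :
    ∫⁻ x, ((univ ×ˢ Ioc (-Real.pi - D * (2 * Real.pi)) (-Real.pi + D * (2 * Real.pi))).indicator
      (polarPow f α) x) ^ (2 : ℝ) ∂(lam.prod volume) ≤ 2 * D * polarNorm lam (2 * α) f := by
  have hm := measurable_polarPow hf α
  set I := Ioc (-Real.pi - D * (2 * Real.pi)) (-Real.pi + D * (2 * Real.pi)) with hI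
  have hms : MeasurableSet (univ ×ˢ I : Set (ℝ × ℝ)) := MeasurableSet.univ.prod measurableSet_Ioc
  have h1 : ∀ x, ((univ ×ˢ I).indicator (polarPow f α) x) ^ (2 : ℝ)
      = (univ ×ˢ I).indicator (polarPow f (2 * α)) x := fun x => by
    by_cases hx : x ∈ (univ ×ˢ I : Set (ℝ × ℝ))
    · rw [indicator_of_mem hx, indicator_of_mem hx, polarPow, polarPow, ← ENNReal.rpow_mul, mul_comm]
    · rw [indicator_of_notMem hx, indicator_of_notMem hx]; simp
  simp_rw [h1]
  rw [lintegral_indicator hms, ← Measure.prod_restrict, Measure.restrict_univ,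
    lintegral_prod _ (measurable_polarPow hf _).aemeasurable, polarNorm,
    ← lintegral_const_mul' _ _ (by finiteness)]
  refine lintegral_mono fun ρ => ?_
  have hper : Function.Periodic (fun θ => polarPow f (2 * α) (ρ, θ)) (2 * Real.pi) := fun θ => by
    simp [polarPow, periodic_circleMap 0 ρ θ]
  have h2 := lintegral_Ioc_nat_mul_periodic_le (by positivity) hper
    (-Real.pi - D * (2 * Real.pi)) (-Real.pi) (2 * D)
  have e1 : -Real.pi - D * (2 * Real.pi) + (2 * D : ℕ) * (2 * Real.pi)
      = -Real.pi + D * (2 * Real.pi) := by push_cast; ring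
  have e2 : -Real.pi + 2 * Real.pi = Real.pi := by ring
  rw [e1, e2] at h2
  push_cast at h2
  exact h2

/-- The generation of the dyadic annulus containing `w`. -/
noncomputable def generation (w : ℂ) : ℕ := ⌊Real.logb 2 (1 - ‖w‖)⁻¹⌋₊

theorem one_sub_norm_mem_of_generation {w : ℂ} (hw : w ∈ disc) :
    1 - ‖w‖ ∈ Ioc ((2⁻¹ : ℝ) ^ (generation w + 1)) (2⁻¹ ^ generation w) := by
  have hw1 : 0 < 1 - ‖w‖ := by rw [mem_disc] at hw; linarith
  have h0 : 0 ≤ Real.logb 2 (1 - ‖w‖)⁻¹ := by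
    apply Real.logb_nonneg (by norm_num)
    apply (one_le_inv₀ hw1).2
    linarith [norm_nonneg w]
  have h1 := Nat.floor_le h0
  have h2 := Nat.lt_floor_add_one (Real.logb 2 (1 - ‖w‖)⁻¹)
  rw [Real.le_logb_iff_rpow_le (by norm_num) (by positivity), Real.rpow_natCast] at h1
  have h2' : Real.logb 2 (1 - ‖w‖)⁻¹ < ((generation w + 1 : ℕ) : ℝ) := by push_cast; exact h2
  rw [Real.logb_lt_iff_lt_rpow (by norm_num) (by positivity), Real.rpow_natCast] at h2'
  rw [inv_pow, inv_pow]
  exact ⟨inv_lt_of_inv_lt₀ hw1 h2', le_inv_of_le_inv₀ (by positivity) h1⟩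

/-- The index of the top half of the Carleson square containing `w`. -/
noncomputable def topIndex (w : ℂ) : ℕ × ℤ := (generation w, arcIndex (generation w) w.arg)

theorem measurable_generation : Measurable generation := by
  unfold generation Real.logb
  apply Nat.measurable_floor.comp
  fun_prop

theorem measurable_topIndex : Measurable topIndex := by
  refine measurable_generation.prodMk ?_
  unfold arcIndex
  apply Int.measurable_floor.comp
  have := measurable_generation
  have h2 : Measurable fun w => (2 : ℝ) ^ generation w := measurable_const.pow this
  fun_prop

/-- The Carleson square with index `Q` in the disc. -/
def square (Q : ℕ × ℤ) : Set ℂ := {w | w ∈ disc ∧ dyadicRadius Q.1 ≤ ‖w‖ ∧ arcIndex Q.1 w.arg = Q.2}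

theorem dyadicRadius_le_norm_iff {w : ℂ} (hw : w ∈ disc) {n : ℕ} :
    dyadicRadius n ≤ ‖w‖ ↔ n ≤ generation w := by
  have h := one_sub_norm_mem_of_generation hw
  simp only [dyadicRadius]
  constructor
  · intro h1
    have h2 : (2⁻¹ : ℝ) ^ (generation w + 1) < 2⁻¹ ^ n := h.1.trans_le (by linarith)
    have := (pow_lt_pow_iff_right_of_lt_one₀ (by norm_num) (by norm_num)).1 h2
    omega
  · intro h1
    have : (2⁻¹ : ℝ) ^ generation w ≤ 2⁻¹ ^ n := pow_le_pow_of_le_one (by norm_num) (by norm_num) h1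
    linarith [h.2]

/-- Passing to ancestors does not increase the size of a shift of position. -/
theorem abs_ediv_sub_ediv_le (a d M : ℤ) (hM : 1 ≤ M) : |(a - d) / M - a / M| ≤ |d| := by
  have h1 : ∀ x e : ℤ, 0 ≤ e → x / M ≤ (x + e) / M ∧ (x + e) / M ≤ x / M + e := fun x e he => by
    constructor
    · exact Int.ediv_le_ediv (by omega) (by omega)
    · rw [← Int.add_mul_ediv_right x e (by omega)]
      exact Int.ediv_le_ediv (by omega) (by nlinarith)
  rcases le_total 0 d with hd | hd
  · have := h1 (a - d) d hd
    rw [sub_add_cancel] at this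
    rw [abs_of_nonneg hd, abs_le]; constructor <;> omega
  · have := h1 a (-d) (by omega)
    rw [← sub_eq_add_neg] at this
    rw [abs_of_nonpos hd, abs_le]; constructor <;> omega

/-- The top halves attached to shifted descendants of `R` lie in at most `2 |d| + 1` squares of one
generation, neighbours of the square with the index of `R` lowered by `n₀` generations. -/
theorem mem_square_of_topIndex {w : ℂ} (hw : w ∈ disc) {n₀ : ℕ} {d : ℤ} {R Q : ℕ × ℤ}
    (hRQ : IsAncestor R Q) (h : topIndex w = (Q.1 + n₀, Q.2 - d)) :
    ∃ i ∈ Finset.Icc (-|d|) |d|, w ∈ square (R.1 + n₀, R.2 + i) := by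
  obtain ⟨h1, h2⟩ := Prod.ext_iff.1 h
  have hg : generation w = Q.1 + n₀ := h1
  have ha : arcIndex (generation w) w.arg = Q.2 - d := h2
  have hle : R.1 + n₀ ≤ generation w := by have := hRQ.1; omega
  have h3 := arcIndex_ediv hle w.arg
  have h4 : Q.2 / 2 ^ (Q.1 - R.1) = R.2 := congrArg Prod.snd hRQ.2
  have h5 : generation w - (R.1 + n₀) = Q.1 - R.1 := by omega
  rw [ha, h5] at h3
  have h6 := abs_ediv_sub_ediv_le Q.2 d (2 ^ (Q.1 - R.1)) (one_le_pow₀ (by norm_num))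
  rw [h3, h4, abs_le] at h6
  refine ⟨arcIndex (R.1 + n₀) w.arg - R.2, by simpa using h6, hw, (dyadicRadius_le_norm_iff hw).2 hle, ?_⟩
  change arcIndex (R.1 + n₀) w.arg = _
  ring

theorem abs_sub_le_of_arcIndex_eq_add {n : ℕ} {θ θ₀ : ℝ} {d : ℤ} (h : arcIndex n θ = arcIndex n θ₀ + d) :
    |θ - θ₀| < 2 * Real.pi * (|(d : ℝ)| + 1) := by
  have h1 := arcIndex_eq_iff.1 h
  have h2 := arcIndex_eq_iff.1 (rfl : arcIndex n θ₀ = arcIndex n θ₀)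
  have hc : 0 < 2 * Real.pi / 2 ^ n := by positivity
  have hc2 : 2 * Real.pi / 2 ^ n ≤ 2 * Real.pi := div_le_self (by positivity) (one_le_pow₀ (by norm_num))
  set c := 2 * Real.pi / 2 ^ n
  set k := arcIndex n θ₀
  obtain ⟨h3, h4⟩ := h1
  obtain ⟨h5, h6⟩ := h2
  push_cast at h3 h4
  have h7 : |θ - θ₀| < c * (|(d : ℝ)| + 1) := by
    rw [abs_lt]
    constructor
    · nlinarith [neg_abs_le (d : ℝ)]
    · nlinarith [le_abs_self (d : ℝ)]
  refine h7.trans_le ?_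
  gcongr

/-! ### Carleson embedding for shifted squares and for the local maximal function -/

section Shift

variable {lam : Measure ℝ} {K : ℝ≥0} {t : ℝ} {μ : Measure ℂ} {n₀ : ℕ} {ε : ℝ≥0∞}

/-- The part of the disc that carries the generations from `n₀` on. -/
def outerDisc (n₀ : ℕ) : Set ℂ := {w | w ∈ disc ∧ dyadicRadius n₀ ≤ ‖w‖}

theorem measurableSet_outerDisc (n₀ : ℕ) : MeasurableSet (outerDisc n₀) :=
  measurableSet_disc.inter (measurableSet_le measurable_const measurable_norm)

/-- This is the Carleson condition for the masses of top halves shifted by `d`. Their disjointness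
turns the sum into the measure of a union, covered by `2 |d| + 1` squares. -/
theorem tsum_descendants_le (hμ : ∀ n ≥ n₀, ∀ k, μ (square (n, k)) ≤ ε * cellMass lam n ^ t) (d : ℤ)
    (R : ℕ × ℤ) :
    ∑' Q : {Q // IsAncestor R Q}, μ (outerDisc n₀ ∩ topIndex ⁻¹' {(Q.1.1 + n₀, Q.1.2 - d)})
      ≤ (2 * d.natAbs + 1) * ε * cellMass lam (R.1 + n₀) ^ t := by
  refine (tsum_meas_le_meas_iUnion_of_disjoint μ (fun Q => (measurableSet_outerDisc n₀).inter
    (measurable_topIndex (measurableSet_singleton _))) ?_).trans ?_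
  · intro Q Q' hne
    refine Disjoint.mono inter_subset_right inter_subset_right (Disjoint.preimage _ ?_)
    rw [disjoint_singleton]
    intro h
    apply hne
    obtain ⟨h1, h2⟩ := Prod.ext_iff.1 h
    ext
    · simpa using h1
    · simpa using h2
  · calc _ ≤ μ (⋃ i ∈ Finset.Icc (-|d|) |d|, square (R.1 + n₀, R.2 + i)) := by
          apply measure_mono
          refine iUnion_subset fun Q => ?_
          rintro w ⟨hw, hw2⟩
          obtain ⟨i, hi, h⟩ := mem_square_of_topIndex hw.1 Q.2 hw2
          exact mem_biUnion (Finset.mem_coe.2 hi) h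
      _ ≤ ∑ i ∈ Finset.Icc (-|d|) |d|, ε * cellMass lam (R.1 + n₀) ^ t :=
          (measure_biUnion_finset_le _ _).trans (Finset.sum_le_sum fun i _ => hμ _ (by omega) _)
      _ = _ := by
          rw [Finset.sum_const, Int.card_Icc, nsmul_eq_mul, mul_assoc]
          congr 1
          have : (|d| + 1 - -|d|).toNat = 2 * d.natAbs + 1 := by
            rw [Int.abs_eq_natAbs]; omega
          rw [this]
          push_cast
          rfl

theorem IsDoublingMeasure.tsum_shift_le (h : IsDoublingMeasure lam K) (ht : 1 ≤ t)
    (hμ : ∀ n ≥ n₀, ∀ k, μ (square (n, k)) ≤ ε * cellMass lam n ^ t) {f : ℂ → ℂ}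
    (hf : ContinuousOn f disc) {α : ℝ} (hN : polarNorm lam (2 * α) f ≠ ∞) (d : ℤ) :
    ∑' Q : ℕ × ℤ, μ (outerDisc n₀ ∩ topIndex ⁻¹' {Q}) *
      dyadicAverage (lam.prod volume) cell (polarPow f α) (Q.1, Q.2 + d) ^ (2 * t)
      ≤ (2 * d.natAbs + 1) * ε * (64 * (d.natAbs + 2) * polarNorm lam (2 * α) f) ^ t := by
  have := h.finite
  -- An argument lies in `(-π, π]`, and a shift by `d` arcs moves an angle by less than `2π (|d| +
  -- 1)`. Hence `D` periods on either side of `-π` contain every angle that matters.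
  set D : ℕ := d.natAbs + 2 with hD
  set I := Ioc (-Real.pi - D * (2 * Real.pi)) (-Real.pi + D * (2 * Real.pi)) with hI
  set u := (univ ×ˢ I).indicator (polarPow f α) with hu
  have hms : MeasurableSet (univ ×ˢ I : Set (ℝ × ℝ)) := MeasurableSet.univ.prod measurableSet_Ioc
  have hum : Measurable u := (measurable_polarPow hf α).indicator hms
  have hu2 := lintegral_strip_le (lam := lam) hf α D
  rw [← hI, ← hu] at hu2
  -- The forest is truncated so that its roots have generation `n₀`, since the hypothesis on `μ` is
  -- available only from there on.
  have hS : IsDyadicFamily fun Q : ℕ × ℤ => cell (Q.1 + n₀, Q.2) := by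
    refine ⟨fun Q => isDyadicFamily_cell.1 _, fun Q n hn => ?_, fun n k l hkl => isDyadicFamily_cell.3 _ _ _ hkl⟩
    have := isDyadicFamily_cell.2 (Q.1 + n₀, Q.2) (n + n₀) (by simpa using hn)
    simpa [ancestor, Nat.add_sub_add_right] using this
  have hemb := hS.carleson_embedding (m := lam.prod volume) (u := u) (t := t)
    (b := fun Q => μ (outerDisc n₀ ∩ topIndex ⁻¹' {(Q.1 + n₀, Q.2 - d)}))
    (ε := (2 * d.natAbs + 1) * ε)
    (fun Q => by rw [prod_cell]; exact h.cellMass_ne_zero _)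
    (fun Q => by rw [prod_cell]; exact h.cellMass_ne_top _) hum
    (ne_top_of_le_ne_top (by finiteness) hu2) ht
    (fun R => by rw [prod_cell]; exact tsum_descendants_le hμ d R)
  have hinj : Function.Injective fun Q : ℕ × ℤ => (Q.1 + n₀, Q.2 - d) := by
    rintro ⟨a, b⟩ ⟨a', b'⟩ hab
    simpa using hab
  rw [← hinj.tsum_eq]
  · calc _ = ∑' Q : ℕ × ℤ, μ (outerDisc n₀ ∩ topIndex ⁻¹' {(Q.1 + n₀, Q.2 - d)}) *
          dyadicAverage (lam.prod volume) (fun Q : ℕ × ℤ => cell (Q.1 + n₀, Q.2)) u Q ^ (2 * t) := by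
          refine tsum_congr fun Q => ?_
          dsimp only
          -- An empty top half has weight zero. Otherwise a point in it places the shifted square
          -- inside the strip, where `u` agrees with the untruncated function.
          rcases (outerDisc n₀ ∩ topIndex ⁻¹' {(Q.1 + n₀, Q.2 - d)}).eq_empty_or_nonempty with he | ⟨w, hw, hw2⟩
          · rw [he]; simp
          congr 2
          rw [dyadicAverage, dyadicAverage, sub_add_cancel]
          congr 1
          apply setLIntegral_congr_fun (isDyadicFamily_cell.1 _)
          rintro ⟨ρ, θ⟩ ⟨_, hθ⟩
          have hθ : arcIndex (Q.1 + n₀) θ = Q.2 := hθ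
          obtain ⟨h1, h2⟩ := Prod.ext_iff.1 (show topIndex w = _ from hw2)
          have h1 : generation w = Q.1 + n₀ := h1
          have h2 : arcIndex (generation w) w.arg = Q.2 - d := h2
          rw [h1] at h2
          have h3 : |θ - w.arg| < 2 * Real.pi * (|(d : ℝ)| + 1) :=
            abs_sub_le_of_arcIndex_eq_add (n := Q.1 + n₀) (by rw [hθ, h2]; ring)
          have h4 := Complex.arg_le_pi w
          have h5 := Complex.neg_pi_lt_arg w
          have hDr : (D : ℝ) = |(d : ℝ)| + 2 := by
            rw [hD]; push_cast; rw [Nat.cast_natAbs]; push_cast; rfl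
          rw [abs_lt] at h3
          have hmem : θ ∈ I := by
            rw [hI, mem_Ioc, hDr]
            constructor <;> nlinarith [Real.pi_pos]
          have hmem' : (ρ, θ) ∈ (univ ×ˢ I : Set (ℝ × ℝ)) := ⟨mem_univ _, hmem⟩
          rw [hu, indicator_of_mem hmem']
    _ ≤ _ := hemb
    _ ≤ _ := by
          refine mul_le_mul' le_rfl (ENNReal.rpow_le_rpow ?_ (by linarith))
          calc 32 * ∫⁻ x, u x ^ (2 : ℝ) ∂(lam.prod volume)
              ≤ 32 * (2 * D * polarNorm lam (2 * α) f) := by gcongr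
            _ = _ := by rw [hD]; push_cast; ring
  · intro Q hQ
    have : (outerDisc n₀ ∩ topIndex ⁻¹' {Q}).Nonempty := by
      by_contra he
      rw [not_nonempty_iff_eq_empty] at he
      simp [he] at hQ
    obtain ⟨w, hw, hw2⟩ := this
    have h1 : generation w = Q.1 := congrArg Prod.fst hw2
    have h2 := (dyadicRadius_le_norm_iff hw.1).1 hw.2
    exact ⟨(Q.1 - n₀, Q.2 + d), by ext <;> simp; omega⟩

end Shift

theorem tsum_decay_sq_ne_top : ∑' d : ℤ, ENNReal.ofReal (decay d) ^ 2 ≠ ∞ := by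
  have hs : Summable fun d : ℤ => decay d ^ 2 := by
    have h1 : Summable fun d : ℤ => 1 / (d : ℝ) ^ 2 + (if d = 0 then 1 else 0) :=
      (Real.summable_one_div_int_pow.2 (by norm_num)).add
        (summable_of_ne_finset_zero (s := {0}) (by intro b hb; simpa using hb))
    refine Summable.of_nonneg_of_le (fun d => by positivity) (fun d => ?_) h1
    rcases eq_or_ne d 0 with rfl | hd
    · simp [decay]
    · have hd' : 0 < |(d : ℝ)| := by simpa using hd
      rw [if_neg hd, add_zero, decay, inv_pow, one_div, ← sq_abs (d : ℝ)]
      apply inv_anti₀ (by positivity)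
      gcongr
      linarith
  simp_rw [← ENNReal.ofReal_pow (decay_pos _).le]
  rw [← ENNReal.ofReal_tsum_of_nonneg (fun d => by positivity) hs]
  exact ENNReal.ofReal_ne_top

theorem tsum_mul_rpow_le {ι : Type*} (c x : ι → ℝ≥0∞) {s : ℝ} (hs : 0 < s) :
    (∑' i, c i * x i) ^ s ≤ (∑' i, c i) ^ s * ∑' i, x i ^ s := by
  have h1 : ∀ i, x i ≤ (∑' i, x i ^ s) ^ s⁻¹ := fun i => by
    rw [ENNReal.le_rpow_inv_iff hs]
    exact ENNReal.le_tsum i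
  calc (∑' i, c i * x i) ^ s ≤ (∑' i, c i * (∑' i, x i ^ s) ^ s⁻¹) ^ s := by
        gcongr with i
        exact h1 i
    _ = _ := by
        rw [ENNReal.tsum_mul_right, ENNReal.mul_rpow_of_nonneg _ _ hs.le, ENNReal.rpow_inv_rpow hs.ne']

/-- From `x ^ (8 t) ≤ x ^ (3 + t)`, one factor `x` absorbs `2 |d| + 1`, the factor `x ^ t` absorbs
`(|d| + 2) ^ t`, and `x ^ 2` is left for summation over `d`. -/
theorem decay_rpow_mul_le (d : ℤ) {t : ℝ} (ht : 1 ≤ t) (ε N : ℝ≥0∞) :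
    (ENNReal.ofReal (decay d) ^ 4) ^ (2 * t) *
      ((2 * d.natAbs + 1) * ε * (64 * (d.natAbs + 2) * N) ^ t)
      ≤ 2 * ε * (128 * N) ^ t * ENNReal.ofReal (decay d) ^ 2 := by
  set x := ENNReal.ofReal (decay d) with hx
  have ht0 : 0 ≤ t := by linarith
  have hx1 : x ≤ 1 := ENNReal.ofReal_le_one.2 (decay_le_one d)
  have hnat : ((d.natAbs : ℕ) : ℝ≥0∞) = ENNReal.ofReal |(d : ℝ)| := by
    rw [← ENNReal.ofReal_natCast, Nat.cast_natAbs, Int.cast_abs]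
  have h1 : x * (2 * d.natAbs + 1) ≤ 2 := by
    rw [hnat, hx, ← ENNReal.ofReal_ofNat, ← ENNReal.ofReal_one, ← ENNReal.ofReal_mul (by norm_num),
      ← ENNReal.ofReal_add (by positivity) (by norm_num), ← ENNReal.ofReal_mul (decay_pos d).le]
    apply ENNReal.ofReal_le_ofReal
    rw [decay, inv_mul_le_iff₀ (by positivity)]
    linarith
  have h2 : x * (d.natAbs + 2) ≤ 2 := by
    rw [hnat, hx, ← ENNReal.ofReal_ofNat, ← ENNReal.ofReal_add (by positivity) (by norm_num),
      ← ENNReal.ofReal_mul (decay_pos d).le]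
    apply ENNReal.ofReal_le_ofReal
    rw [decay, inv_mul_le_iff₀ (by positivity)]
    linarith [abs_nonneg (d : ℝ)]
  have h3 : (x ^ 4) ^ (2 * t) ≤ x ^ 2 * x * x ^ t := by
    have e1 : (x ^ 4) ^ (2 * t) = x ^ (8 * t) := by
      rw [← ENNReal.rpow_natCast, ← ENNReal.rpow_mul]; congr 1; push_cast; ring
    have e2 : x ^ 2 * x * x ^ t = x ^ (3 + t) := by
      rw [← pow_succ, ← ENNReal.rpow_natCast, ← ENNReal.rpow_add_of_nonneg _ _ (by norm_num) ht0]
      norm_num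
    rw [e1, e2]
    exact ENNReal.rpow_le_rpow_of_exponent_ge hx1 (by linarith)
  calc _ ≤ x ^ 2 * x * x ^ t * ((2 * d.natAbs + 1) * ε * (64 * (d.natAbs + 2) * N) ^ t) := by gcongr
    _ = x ^ 2 * (x * (2 * d.natAbs + 1)) * ε * (x ^ t * (64 * (d.natAbs + 2) * N) ^ t) := by ring
    _ = x ^ 2 * (x * (2 * d.natAbs + 1)) * ε * (64 * (x * (d.natAbs + 2)) * N) ^ t := by
        rw [← ENNReal.mul_rpow_of_nonneg _ _ ht0]
        congr 2; ring
    _ ≤ x ^ 2 * 2 * ε * (64 * 2 * N) ^ t := by gcongr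
    _ = _ := by norm_num; ring

/-- The Carleson embedding theorem for the local maximal function of a Bergman space function. -/
theorem IsDoublingMeasure.exists_embedding {lam : Measure ℝ} {K : ℝ≥0} (h : IsDoublingMeasure lam K)
    {p q : ℝ} (hp : 0 < p) (hpq : p ≤ q) : ∃ C : ℝ≥0, ∀ f : ℂ → ℂ, DifferentiableOn ℂ f disc →
      polarNorm lam p f ≠ ∞ → ∃ G : ℂ → ℝ≥0∞, Measurable G ∧
      (∀ w ∈ disc, ∀ ζ, ‖ζ - w‖ ≤ (1 - ‖w‖) / 4 → ‖f ζ‖ₑ ≤ G w) ∧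
      ∀ (μ : Measure ℂ) (n₀ : ℕ) (ε : ℝ≥0∞),
        (∀ n ≥ n₀, ∀ k, μ (square (n, k)) ≤ ε * cellMass lam n ^ (q / p)) →
        ∫⁻ w in outerDisc n₀, G w ^ q ∂μ ≤ C * ε * polarNorm lam p f ^ (q / p) := by
  have hα : 0 < p / 2 := by positivity
  obtain ⟨C₀, hC₀⟩ := h.exists_local_bound hα
  have hq : 0 < q := by linarith
  have ht : 1 ≤ q / p := (one_le_div hp).2 hpq
  set t := q / p with htdef
  have ht0 : 0 < t := by linarith
  have hsum := tsum_decay_sq_ne_top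
  set D := ∑' d : ℤ, ENNReal.ofReal (decay d) ^ 2 with hD
  set C : ℝ≥0∞ := C₀ ^ (2 * t) * D ^ (2 * t) * (2 * 128 ^ t * D) with hC
  have hCT : C ≠ ∞ := by
    rw [hC]
    have h1 : (2 * t) ≥ 0 := by positivity
    refine ENNReal.mul_ne_top (ENNReal.mul_ne_top ?_ ?_) (ENNReal.mul_ne_top (ENNReal.mul_ne_top (by norm_num) ?_) hsum)
    · exact ENNReal.rpow_ne_top_of_nonneg h1 ENNReal.coe_ne_top
    · exact ENNReal.rpow_ne_top_of_nonneg h1 hsum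
    · exact ENNReal.rpow_ne_top_of_nonneg ht0.le (by norm_num)
  refine ⟨C.toNNReal, fun f hf hN => ?_⟩
  rw [ENNReal.coe_toNNReal hCT]
  set a := dyadicAverage (lam.prod volume) cell (polarPow f (p / 2)) with ha
  -- The majorant is constant on top halves and depends on `f` only, so the same `G` serves every
  -- measure `μ`.
  set H : ℕ × ℤ → ℝ≥0∞ := fun Q =>
    (C₀ * ∑' d : ℤ, ENNReal.ofReal (decay d) ^ 6 * a (Q.1, Q.2 + d)) ^ (p / 2)⁻¹ with hH
  refine ⟨fun w => H (topIndex w), (measurable_of_countable H).comp measurable_topIndex, ?_, ?_⟩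
  · intro w hw ζ hζ
    rw [hH, ENNReal.le_rpow_inv_iff hα]
    exact hC₀ f hf _ w hw (one_sub_norm_mem_of_generation hw) ζ hζ
  intro μ n₀ ε hμ
  have hHq : ∀ Q, H Q ^ q ≤ C₀ ^ (2 * t) * (D ^ (2 * t) *
      ∑' d : ℤ, (ENNReal.ofReal (decay d) ^ 4) ^ (2 * t) * a (Q.1, Q.2 + d) ^ (2 * t)) := fun Q => by
    rw [hH]
    dsimp only
    have e : (p / 2)⁻¹ * q = 2 * t := by rw [htdef]; field_simp
    rw [← ENNReal.rpow_mul, e, ENNReal.mul_rpow_of_nonneg _ _ (by positivity)]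
    gcongr
    have := tsum_mul_rpow_le (fun d : ℤ => ENNReal.ofReal (decay d) ^ 2)
      (fun d : ℤ => ENNReal.ofReal (decay d) ^ 4 * a (Q.1, Q.2 + d)) (s := 2 * t) (by positivity)
    simp_rw [← mul_assoc, ← pow_add, ENNReal.mul_rpow_of_nonneg _ _ (show 0 ≤ 2 * t by positivity)] at this
    exact this
  have hcover : ∫⁻ w in outerDisc n₀, H (topIndex w) ^ q ∂μ
      ≤ ∑' Q, μ (outerDisc n₀ ∩ topIndex ⁻¹' {Q}) * H Q ^ q := by
    have e : outerDisc n₀ = ⋃ Q, outerDisc n₀ ∩ topIndex ⁻¹' {Q} := by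
      rw [← inter_iUnion, eq_comm, inter_eq_left]
      exact fun w _ => mem_iUnion.2 ⟨topIndex w, rfl⟩
    conv_lhs => rw [e]
    refine (lintegral_iUnion_le _ _).trans (ENNReal.tsum_le_tsum fun Q => le_of_eq ?_)
    rw [setLIntegral_congr_fun (g := fun _ => H Q ^ q)
      ((measurableSet_outerDisc n₀).inter (measurable_topIndex (measurableSet_singleton _))),
      setLIntegral_const, mul_comm]
    rintro w ⟨_, hw⟩
    have hw : topIndex w = Q := hw
    simp only [hw]
  refine hcover.trans ?_
  set N := polarNorm lam p f with hNdef
  have h2α : 2 * (p / 2) = p := by ring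
  calc ∑' Q, μ (outerDisc n₀ ∩ topIndex ⁻¹' {Q}) * H Q ^ q
      ≤ ∑' Q : ℕ × ℤ, μ (outerDisc n₀ ∩ topIndex ⁻¹' {Q}) * (C₀ ^ (2 * t) * (D ^ (2 * t) *
      ∑' d : ℤ, (ENNReal.ofReal (decay d) ^ 4) ^ (2 * t) * a (Q.1, Q.2 + d) ^ (2 * t))) :=
        ENNReal.tsum_le_tsum fun Q => mul_le_mul' le_rfl (hHq Q)
    _ = C₀ ^ (2 * t) * D ^ (2 * t) * ∑' d : ℤ, (ENNReal.ofReal (decay d) ^ 4) ^ (2 * t) *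
        ∑' Q : ℕ × ℤ, μ (outerDisc n₀ ∩ topIndex ⁻¹' {Q}) * a (Q.1, Q.2 + d) ^ (2 * t) := by
        simp_rw [← ENNReal.tsum_mul_left]
        rw [ENNReal.tsum_comm]
        refine tsum_congr fun d => tsum_congr fun Q => ?_
        ring
    _ ≤ C₀ ^ (2 * t) * D ^ (2 * t) * ∑' d : ℤ, 2 * ε * (128 * N) ^ t * ENNReal.ofReal (decay d) ^ 2 := by
        refine mul_le_mul' le_rfl (ENNReal.tsum_le_tsum fun d => ?_)
        refine le_trans (mul_le_mul' le_rfl ?_) (decay_rpow_mul_le d ht ε N)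
        have := h.tsum_shift_le ht hμ hf.continuousOn (α := p / 2) (by rwa [h2α]) d
        rw [h2α] at this
        exact this
    _ = _ := by
        rw [ENNReal.tsum_mul_left, ENNReal.mul_rpow_of_nonneg _ _ ht0.le, hC]
        ring

/-! ### Test functions adapted to Carleson squares -/

/-- A disc function concentrated on the Carleson square with index `(n, k)`. -/
noncomputable def bump (n : ℕ) (k : ℤ) (z : ℂ) : ℂ :=
  (2⁻¹ ^ n : ℝ) / (1 - conj (circleMap 0 (dyadicRadius n) (2 * Real.pi / 2 ^ n * k)) * z)

theorem conj_circleMap_mul_circleMap (r θ₀ ρ θ : ℝ) :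
    conj (circleMap 0 r θ₀) * circleMap 0 ρ θ = circleMap 0 (r * ρ) (θ - θ₀) := by
  simp only [circleMap, zero_add, map_mul, Complex.conj_ofReal, ← Complex.exp_conj, Complex.conj_I]
  push_cast
  rw [mul_mul_mul_comm, ← Complex.exp_add]
  congr 2
  ring

theorem norm_one_sub_conj_mul_ge {n : ℕ} {θ₀ : ℝ} {z : ℂ} (hz : z ∈ disc) :
    2⁻¹ ^ n ≤ ‖1 - conj (circleMap 0 (dyadicRadius n) θ₀) * z‖ ∧
      1 - ‖z‖ ≤ ‖1 - conj (circleMap 0 (dyadicRadius n) θ₀) * z‖ := by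
  have hz := mem_disc.1 hz
  have h := norm_sub_norm_le 1 (conj (circleMap 0 (dyadicRadius n) θ₀) * z)
  rw [norm_mul, RCLike.norm_conj, norm_circleMap_zero, abs_of_nonneg (dyadicRadius_nonneg n), norm_one] at h
  have h1 := dyadicRadius_lt_one n
  have h2 := dyadicRadius_nonneg n
  have h3 : 1 - dyadicRadius n = 2⁻¹ ^ n := by simp [dyadicRadius]
  constructor <;> nlinarith [norm_nonneg z]

theorem norm_bump (n : ℕ) (k : ℤ) (z : ℂ) : ‖bump n k z‖ =
    2⁻¹ ^ n / ‖1 - conj (circleMap 0 (dyadicRadius n) (2 * Real.pi / 2 ^ n * k)) * z‖ := by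
  rw [bump, norm_div, Complex.norm_real, Real.norm_of_nonneg (by positivity)]

theorem differentiableOn_bump (n : ℕ) (k : ℤ) :
    DifferentiableOn ℂ (bump n k) disc := by
  unfold bump
  refine DifferentiableOn.div (differentiableOn_const _) (by fun_prop) fun z hz => ?_
  rw [← norm_pos_iff]
  exact lt_of_lt_of_le (by positivity) (norm_one_sub_conj_mul_ge hz).1

theorem norm_bump_le (n : ℕ) (k : ℤ) {z : ℂ} (hz : z ∈ disc) :
    ‖bump n k z‖ ≤ 2⁻¹ ^ n * (1 - ‖z‖)⁻¹ := by
  rw [norm_bump, div_eq_mul_inv]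
  have : 0 < 1 - ‖z‖ := by rw [mem_disc] at hz; linarith
  gcongr
  exact (norm_one_sub_conj_mul_ge hz).2

/-- On the square the denominator is at most `(2 + 7) 2⁻ⁿ`: the radial part contributes `2 · 2⁻ⁿ`
and the angular part at most the arc length `2π 2⁻ⁿ ≤ 7 · 2⁻ⁿ`. -/
theorem le_norm_bump {n : ℕ} {k : ℤ} {z : ℂ} (hz : z ∈ square (n, k)) :
    1 ≤ 9 * ‖bump n k z‖ := by
  obtain ⟨hz0, hz1, hz2⟩ := hz
  have hz2 : arcIndex n z.arg = k := hz2
  have hz1 : dyadicRadius n ≤ ‖z‖ := hz1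
  have hpos := (norm_one_sub_conj_mul_ge (n := n) (θ₀ := 2 * Real.pi / 2 ^ n * k) hz0).1
  have h2 : (0 : ℝ) < 2⁻¹ ^ n := by positivity
  rw [norm_bump, ← mul_div_assoc, le_div_iff₀ (by linarith), one_mul]
  have h3 := arcIndex_eq_iff.1 hz2
  set θ₀ := 2 * Real.pi / 2 ^ n * (k : ℝ) with hθ₀
  have hr0 := dyadicRadius_nonneg n
  have hr1 := dyadicRadius_lt_one n
  have hzz : z = circleMap 0 ‖z‖ z.arg := by
    rw [circleMap, zero_add, Complex.norm_mul_exp_arg_mul_I]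
  have e : 1 - conj (circleMap 0 (dyadicRadius n) θ₀) * z
      = ((1 - dyadicRadius n * ‖z‖ : ℝ) : ℂ) + (dyadicRadius n * ‖z‖ : ℝ) * (1 - Complex.exp (Complex.I * (z.arg - θ₀ : ℝ))) := by
    conv_lhs => rw [hzz]
    rw [conj_circleMap_mul_circleMap, circleMap]
    push_cast
    rw [mul_comm Complex.I]
    ring
  have hz1' := mem_disc.1 hz0
  rw [e]
  refine (norm_add_le _ _).trans ?_
  have hx : 0 ≤ dyadicRadius n * ‖z‖ := by positivity
  have hx1 : dyadicRadius n * ‖z‖ ≤ 1 := by nlinarith [norm_nonneg z]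
  rw [Complex.norm_real, Real.norm_of_nonneg (by linarith), norm_mul, Complex.norm_real,
    Real.norm_of_nonneg hx, norm_sub_rev]
  have h4 := Real.norm_exp_I_mul_ofReal_sub_one_le (x := z.arg - θ₀)
  have h5 : ‖z.arg - θ₀‖ ≤ 7 * 2⁻¹ ^ n := by
    have h6 : 2 * Real.pi / 2 ^ n ≤ 7 * 2⁻¹ ^ n := by
      rw [inv_pow, ← div_eq_mul_inv]
      gcongr
      linarith [Real.pi_lt_d2]
    have h7 := h3.1
    have h8 := h3.2
    rw [mul_add, mul_one] at h8
    rw [Real.norm_eq_abs, abs_le]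
    constructor <;> linarith
  have h9 : 1 - dyadicRadius n = 2⁻¹ ^ n := by simp [dyadicRadius]
  have h10 : 1 - dyadicRadius n * ‖z‖ ≤ 2 * 2⁻¹ ^ n := by nlinarith
  have h11 : dyadicRadius n * ‖z‖ * ‖Complex.exp (Complex.I * (z.arg - θ₀ : ℝ)) - 1‖ ≤ 1 * (7 * 2⁻¹ ^ n) :=
    mul_le_mul hx1 (h4.trans h5) (norm_nonneg _) zero_le_one
  linarith

/-- The index `j` satisfies `2 ^ j ≤ 2 ^ n |1 - c̄ z| < 2 ^ (j + 1)`, with `c` the pole parameter of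
the bump. Smallness of the denominator confines both the radius and the angle. For `j ≥ n` the
truncated subtraction gives radius `0` and no radial restriction. -/
theorem norm_bump_circleMap_le {n : ℕ} {k : ℤ} {ρ θ : ℝ} (hρ : ρ ∈ Ioo (0 : ℝ) 1)
    (hθ : |θ - 2 * Real.pi / 2 ^ n * k| ≤ Real.pi) :
    ∃ j : ℕ, ‖bump n k (circleMap 0 ρ θ)‖ ≤ 2⁻¹ ^ j ∧ dyadicRadius (n - (j + 1)) ≤ ρ ∧
      |θ - 2 * Real.pi / 2 ^ n * k| ≤ 2 ^ (j + 1) * (Real.pi / 2 ^ n) := by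
  have hz : circleMap 0 ρ θ ∈ disc := by
    rw [mem_disc, norm_circleMap_zero, abs_of_pos hρ.1]; exact hρ.2
  rw [norm_bump]
  set θ₀ := 2 * Real.pi / 2 ^ n * (k : ℝ)
  obtain ⟨h1, h2⟩ := norm_one_sub_conj_mul_ge (n := n) (θ₀ := θ₀) hz
  have h3 : |θ - θ₀| / Real.pi ≤ ‖1 - conj (circleMap 0 (dyadicRadius n) θ₀) * circleMap 0 ρ θ‖ := by
    rw [conj_circleMap_mul_circleMap]
    exact abs_div_pi_le_norm_one_sub (mul_nonneg (dyadicRadius_nonneg n) hρ.1.le) hθ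
  set x := ‖1 - conj (circleMap 0 (dyadicRadius n) θ₀) * circleMap 0 ρ θ‖
  have h2n : (0 : ℝ) < 2 ^ n := by positivity
  have hx : 0 < x := lt_of_lt_of_le (by positivity) h1
  rw [inv_pow, inv_le_iff_one_le_mul₀ h2n] at h1
  obtain ⟨j, hj1, hj2⟩ := exists_nat_pow_near h1 (by norm_num : (1 : ℝ) < 2)
  refine ⟨j, ?_, ?_, ?_⟩
  · rw [inv_pow, inv_pow, inv_eq_one_div, inv_eq_one_div, div_div]
    apply one_div_le_one_div_of_le (by positivity)
    linarith
  · rw [norm_circleMap_zero, abs_of_pos hρ.1] at h2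
    rcases le_or_gt (j + 1) n with hjn | hjn
    · have e : (2 : ℝ) ^ n = 2 ^ (n - (j + 1)) * 2 ^ (j + 1) := by rw [← pow_add, Nat.sub_add_cancel hjn]
      rw [dyadicRadius, inv_pow]
      have h4 : x < (2 ^ (n - (j + 1)))⁻¹ := by
        rw [e, ← mul_assoc] at hj2
        have h5 : x * 2 ^ (n - (j + 1)) < 1 := by
          by_contra hcon
          push Not at hcon
          nlinarith [pow_pos (two_pos : (0 : ℝ) < 2) (j + 1)]
        rwa [lt_inv_comm₀ hx (by positivity), ← one_div, lt_div_iff₀ hx, mul_comm]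
      linarith
    · rw [show n - (j + 1) = 0 by omega, dyadicRadius_zero]
      exact hρ.1.le
  · rw [div_le_iff₀ Real.pi_pos] at h3
    rw [← mul_div_assoc, le_div_iff₀ h2n]
    have : x * 2 ^ n * Real.pi ≤ 2 ^ (j + 1) * Real.pi := by
      have := Real.pi_pos
      gcongr
    nlinarith

namespace IsDoublingMeasure

variable {lam : Measure ℝ} {K : ℝ≥0}

theorem one_le_const (h : IsDoublingMeasure lam K) : 1 ≤ (K : ℝ≥0∞) := by
  have := h.finite
  have h1 : 1 * lam (Ici (dyadicRadius 0)) ≤ K * lam (Ici (dyadicRadius 0)) := by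
    rw [one_mul]
    refine (h.doubling 0).trans ?_
    gcongr
    exact dyadicRadius_mono (Nat.zero_le _)
  exact (ENNReal.mul_le_mul_iff_left (h.pos 0) (measure_ne_top _ _)).1 h1

theorem measure_Ici_sub_le (h : IsDoublingMeasure lam K) (n m : ℕ) :
    lam (Ici (dyadicRadius (n - m))) ≤ K ^ m * lam (Ici (dyadicRadius n)) := by
  induction m with
  | zero => simp
  | succ m ih =>
    rcases le_or_gt n m with hm | hm
    · rw [show n - (m + 1) = n - m by omega]
      refine ih.trans ?_
      gcongr
      · exact h.one_le_const
      · omega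
    · refine (h.doubling _).trans ?_
      rw [show n - (m + 1) + 1 = n - m by omega, pow_succ', mul_assoc]
      gcongr

/-- The `p`-th powers of the bump functions have norm comparable to the measure of the square. -/
theorem polarNorm_bump_le (h : IsDoublingMeasure lam K) {p : ℝ} (hp : 0 < p) {N : ℕ}
    (hN : 4 * (K : ℝ) ≤ 2 ^ (N * p)) (n : ℕ) (k : ℤ) :
    polarNorm lam p (fun z => bump n k z ^ N) ≤ 4 * K * cellMass lam n := by
  have := h.finite
  set θ₀ := 2 * Real.pi / 2 ^ n * (k : ℝ) with hθ₀
  set x : ℝ≥0∞ := ENNReal.ofReal (2⁻¹ ^ (N * p)) with hx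
  set A : ℕ → Set ℝ := fun j => Ici (dyadicRadius (n - (j + 1)))
  set B : ℕ → Set ℝ := fun j => {θ | |θ - θ₀| ≤ 2 ^ (j + 1) * (Real.pi / 2 ^ n)}
  have hB : ∀ j, B j = Icc (θ₀ - 2 ^ (j + 1) * (Real.pi / 2 ^ n)) (θ₀ + 2 ^ (j + 1) * (Real.pi / 2 ^ n)) := fun j => by
    ext θ
    change |θ - θ₀| ≤ _ ↔ _
    rw [abs_le, mem_Icc]
    constructor <;> rintro ⟨h1, h2⟩ <;> constructor <;> linarith
  have hBm : ∀ j, MeasurableSet (B j) := fun j => by rw [hB]; exact measurableSet_Icc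
  have hBv : ∀ j, volume (B j) = 2 ^ (j + 1) * ENNReal.ofReal (2 * Real.pi / 2 ^ n) := fun j => by
    rw [hB, Real.volume_Icc]
    have : (2 : ℝ≥0∞) ^ (j + 1) = ENNReal.ofReal (2 ^ (j + 1)) := by
      rw [ENNReal.ofReal_pow (by norm_num)]; simp
    rw [this, ← ENNReal.ofReal_mul (by positivity)]
    congr 1; ring
  have hpt : ∀ ρ ∈ Ioo (0 : ℝ) 1, ∫⁻ θ in Ioc (-Real.pi) Real.pi,
      polarPow (fun z => bump n k z ^ N) p (ρ, θ)
      ≤ ∑' j : ℕ, x ^ j * ((A j).indicator 1 ρ * volume (B j)) := by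
    intro ρ hρ
    have hper : Function.Periodic (fun θ => polarPow (fun z => bump n k z ^ N) p (ρ, θ)) (2 * Real.pi) := fun θ => by
      simp [polarPow, periodic_circleMap 0 ρ θ]
    have h1 := lintegral_Ioc_periodic (by positivity) hper (-Real.pi) (θ₀ - Real.pi)
    rw [show -Real.pi + 2 * Real.pi = Real.pi by ring,
      show θ₀ - Real.pi + 2 * Real.pi = θ₀ + Real.pi by ring] at h1
    rw [h1]
    calc _ ≤ ∫⁻ θ in Ioc (θ₀ - Real.pi) (θ₀ + Real.pi),
          ∑' j : ℕ, x ^ j * ((A j).indicator 1 ρ * (B j).indicator 1 θ) := by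
          refine setLIntegral_mono' measurableSet_Ioc fun θ hθ => ?_
          rw [polarPow_eq ⟨hρ.1.le, hρ.2⟩]
          obtain ⟨j, hj1, hj2, hj3⟩ := norm_bump_circleMap_le (n := n) (k := k) hρ
            (show |θ - θ₀| ≤ Real.pi by rw [abs_le]; constructor <;> linarith [hθ.1, hθ.2])
          refine le_trans ?_ (ENNReal.le_tsum j)
          have hj2 : ρ ∈ A j := hj2
          have hj3 : θ ∈ B j := hj3
          rw [indicator_of_mem hj2, indicator_of_mem hj3, ← ofReal_norm, norm_pow,
            ENNReal.ofReal_rpow_of_nonneg (by positivity) hp.le]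
          simp only [Pi.one_apply, mul_one]
          rw [hx, ← ENNReal.ofReal_pow (by positivity)]
          apply ENNReal.ofReal_le_ofReal
          calc (‖bump n k (circleMap 0 ρ θ)‖ ^ N) ^ p ≤ (((2⁻¹ : ℝ) ^ j) ^ N) ^ p := by gcongr
            _ = (2⁻¹ ^ (N * p)) ^ j := by
              rw [← pow_mul, ← Real.rpow_natCast, ← Real.rpow_mul (by norm_num),
                ← Real.rpow_natCast _ j, ← Real.rpow_mul (by norm_num)]
              congr 1
              push_cast
              ring
      _ ≤ ∫⁻ θ, ∑' j : ℕ, x ^ j * ((A j).indicator 1 ρ * (B j).indicator 1 θ) :=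
          setLIntegral_le_lintegral _ _
      _ = _ := by
          rw [lintegral_tsum fun j => ((measurable_one.indicator (hBm j)).const_mul _ |>.const_mul _).aemeasurable]
          refine tsum_congr fun j => ?_
          rw [lintegral_const_mul _ ((measurable_one.indicator (hBm j)).const_mul _),
            lintegral_const_mul _ (measurable_one.indicator (hBm j)), lintegral_indicator_one (hBm j)]
  -- The region with index `j` has mass at most a constant times `(2 K) ^ j` times that of the
  -- square, and there the power of the bump is at most `x ^ j`. The choice of `N` makes the ratio
  -- `2 K x` at most `1 / 2`.
  have hK : 2 * (K : ℝ≥0∞) * x ≤ 2⁻¹ := by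
    have h1 : 2 * (K : ℝ) * 2⁻¹ ^ (N * p) ≤ 2⁻¹ := by
      have h2 : (0 : ℝ) < 2 ^ (N * p) := by positivity
      rw [Real.inv_rpow (by norm_num), ← div_eq_mul_inv, div_le_iff₀ h2]
      linarith
    have h2 := ENNReal.ofReal_le_ofReal h1
    rw [ENNReal.ofReal_mul (by positivity), ENNReal.ofReal_mul (by positivity)] at h2
    simpa [hx, ENNReal.ofReal_inv_of_pos] using h2
  calc polarNorm lam p (fun z => bump n k z ^ N)
      ≤ ∫⁻ ρ, (∑' j : ℕ, x ^ j * ((A j).indicator 1 ρ * volume (B j))) ∂lam := by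
        apply lintegral_mono_ae
        filter_upwards [h.support] with ρ hρ using hpt ρ hρ
    _ = ∑' j : ℕ, x ^ j * (lam (A j) * volume (B j)) := by
        have hA : ∀ j, Measurable ((A j).indicator (1 : ℝ → ℝ≥0∞)) := fun j =>
          measurable_one.indicator measurableSet_Ici
        rw [lintegral_tsum fun j => (((hA j).mul_const _).const_mul _).aemeasurable]
        refine tsum_congr fun j => ?_
        rw [lintegral_const_mul _ ((hA j).mul_const _), lintegral_mul_const _ (hA j),
          lintegral_indicator_one measurableSet_Ici]
    _ ≤ ∑' j : ℕ, (2 * K * cellMass lam n) * 2⁻¹ ^ j := by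
        refine ENNReal.tsum_le_tsum fun j => ?_
        calc x ^ j * (lam (A j) * volume (B j))
            ≤ x ^ j * (K ^ (j + 1) * lam (Ici (dyadicRadius n)) * volume (B j)) := by
              gcongr
              exact h.measure_Ici_sub_le n (j + 1)
          _ = (2 * K * cellMass lam n) * (2 * K * x) ^ j := by
              rw [hBv, cellMass]
              ring
          _ ≤ _ := by gcongr
    _ = _ := by
        rw [ENNReal.tsum_mul_left, ENNReal.tsum_geometric, ENNReal.one_sub_inv_two, inv_inv]
        ring

/-- Normalized test functions adapted to the Carleson squares. -/
theorem exists_test_functions (h : IsDoublingMeasure lam K) {p : ℝ} (hp : 0 < p) :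
    ∃ (C : ℝ≥0) (N : ℕ) (η : ℕ → ℝ) (g : ℕ → ℤ → ℂ → ℂ), Tendsto η atTop (𝓝 0) ∧ ∀ n k,
      DifferentiableOn ℂ (g n k) disc ∧ polarNorm lam p (g n k) ≤ C ∧
      (∀ w ∈ square (n, k), 1 ≤ C * cellMass lam n * ‖g n k w‖ₑ ^ p) ∧
      ∀ z ∈ disc, ‖g n k z‖ ≤ η n * (1 - ‖z‖)⁻¹ ^ N := by
  have := h.finite
  have hK1 : 1 ≤ (K : ℝ) := by exact_mod_cast h.one_le_const
  obtain ⟨N, hN⟩ : ∃ N : ℕ, 4 * (K : ℝ) ≤ 2 ^ (N * p) := by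
    obtain ⟨N, hN⟩ := exists_nat_ge (Real.logb 2 (4 * K) / p)
    rw [div_le_iff₀ hp] at hN
    exact ⟨N, (Real.logb_le_iff_le_rpow (by norm_num) (by positivity)).1 hN⟩
  set M : ℕ → ℝ := fun n => (cellMass lam n).toReal with hM
  have hMe : ∀ n, ENNReal.ofReal (M n) = cellMass lam n := fun n => ENNReal.ofReal_toReal (h.cellMass_ne_top n)
  have hMpos : ∀ n, 0 < M n := fun n => ENNReal.toReal_pos (h.cellMass_ne_zero n) (h.cellMass_ne_top n)
  set s : ℕ → ℝ := fun n => M n ^ (-p⁻¹) with hs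
  have hspos : ∀ n, 0 < s n := fun n => Real.rpow_pos_of_pos (hMpos n) _
  have hsp : ∀ n, ENNReal.ofReal (s n) ^ p = (cellMass lam n)⁻¹ := fun n => by
    rw [ENNReal.ofReal_rpow_of_pos (hspos n), hs, ← Real.rpow_mul (hMpos n).le,
      neg_mul, inv_mul_cancel₀ hp.ne', Real.rpow_neg_one, ENNReal.ofReal_inv_of_pos (hMpos n), hMe]
  have hge : ∀ n k z, ‖(s n : ℂ) * bump n k z ^ N‖ₑ ^ p = (cellMass lam n)⁻¹ * ‖bump n k z ^ N‖ₑ ^ p := fun n k z => by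
    rw [enorm_mul, ENNReal.mul_rpow_of_nonneg _ _ hp.le, ← hsp, ← ofReal_norm (s n : ℂ), Complex.norm_real,
      Real.norm_of_nonneg (hspos n).le]
  refine ⟨4 * K + Real.toNNReal (9 ^ (N * p)), N, fun n => s n * (2⁻¹ ^ n) ^ N,
    fun n k z => s n * bump n k z ^ N, ?_, fun n k => ⟨?_, ?_, ?_, ?_⟩⟩
  · have hM0 : ∀ n, M 0 ≤ (2 * K) ^ n * M n := fun n => by
      have h1 := h.measure_Ici_sub_le n n
      rw [Nat.sub_self] at h1
      have h2 : cellMass lam 0 ≤ (2 * K) ^ n * cellMass lam n := by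
        calc cellMass lam 0 ≤ K ^ n * lam (Ici (dyadicRadius n)) * ENNReal.ofReal (2 * Real.pi / 2 ^ 0) := by
              rw [cellMass]; gcongr
          _ = K ^ n * lam (Ici (dyadicRadius n)) * (2 ^ n * ENNReal.ofReal (2 * Real.pi / 2 ^ n)) := by
              have : (2 : ℝ≥0∞) ^ n = ENNReal.ofReal (2 ^ n) := by
                rw [ENNReal.ofReal_pow (by norm_num)]; simp
              rw [this, ← ENNReal.ofReal_mul (by positivity)]
              congr 2
              field_simp
          _ = _ := by rw [cellMass]; ring
      have h3 := ENNReal.toReal_mono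
        (ENNReal.mul_ne_top (ENNReal.pow_ne_top (by simp [ENNReal.mul_eq_top])) (h.cellMass_ne_top n)) h2
      simpa using h3
    -- Iterated doubling gives `M n ≥ M 0 / (2 K) ^ n`, while the bump contributes `2 ^ (-n N p) ≤
    -- (4 K) ^ (-n)` after raising to the power `p`; the quotient is at most `2⁻ⁿ / M 0`.
    have hb : ∀ n, s n * (2⁻¹ ^ n) ^ N ≤ ((M 0)⁻¹ * 2⁻¹ ^ n) ^ p⁻¹ := fun n => by
      have hη : 0 ≤ s n * (2⁻¹ ^ n) ^ N := mul_nonneg (hspos n).le (by positivity)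
      have hMn := hMpos n
      have hMz := hMpos 0
      rw [Real.le_rpow_inv_iff_of_pos hη (by positivity) hp,
        Real.mul_rpow (hspos n).le (by positivity), hs, ← Real.rpow_mul hMn.le, neg_mul,
        inv_mul_cancel₀ hp.ne', Real.rpow_neg_one]
      have e : (((2⁻¹ : ℝ) ^ n) ^ N) ^ p = ((2 ^ (N * p)) ^ n)⁻¹ := by
        rw [← inv_pow, ← Real.inv_rpow (by norm_num), ← pow_mul, ← Real.rpow_natCast,
          ← Real.rpow_mul (by norm_num), ← Real.rpow_natCast _ n, ← Real.rpow_mul (by norm_num)]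
        congr 1
        push_cast
        ring
      rw [e, ← mul_inv, inv_pow, ← mul_inv]
      apply inv_anti₀ (by positivity)
      calc M 0 * 2 ^ n ≤ ((2 * K) ^ n * M n) * 2 ^ n := by gcongr; exact hM0 n
        _ = M n * (4 * K) ^ n := by
          rw [show (4 : ℝ) * K = 2 * K * 2 by ring, mul_pow _ (2 : ℝ)]
          ring
        _ ≤ _ := by gcongr
    refine squeeze_zero (fun n => mul_nonneg (hspos n).le (by positivity)) hb ?_
    have h1 : Tendsto (fun n : ℕ => (M 0)⁻¹ * (2⁻¹ : ℝ) ^ n) atTop (𝓝 0) := by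
      simpa using (tendsto_pow_atTop_nhds_zero_of_lt_one (by norm_num : (0 : ℝ) ≤ 2⁻¹) (by norm_num)).const_mul (M 0)⁻¹
    have h2 := h1.rpow_const (p := p⁻¹) (Or.inr (by positivity))
    rwa [Real.zero_rpow (by positivity)] at h2
  · exact (differentiableOn_const _).mul ((differentiableOn_bump n k).pow N)
  · have e : polarNorm lam p (fun z => s n * bump n k z ^ N)
        = (cellMass lam n)⁻¹ * polarNorm lam p (fun z => bump n k z ^ N) := by
      have hc : (cellMass lam n)⁻¹ ≠ ∞ := ENNReal.inv_ne_top.2 (h.cellMass_ne_zero n)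
      rw [polarNorm, polarNorm, ← lintegral_const_mul' _ _ hc]
      refine lintegral_congr fun ρ => ?_
      rw [← lintegral_const_mul' _ _ hc]
      refine lintegral_congr fun θ => ?_
      simp only [polarPow]
      by_cases hz : circleMap 0 ρ θ ∈ disc
      · rw [indicator_of_mem hz, indicator_of_mem hz, hge]
      · rw [indicator_of_notMem hz, indicator_of_notMem hz]
        simp [ENNReal.zero_rpow_of_pos hp]
    rw [e]
    calc _ ≤ (cellMass lam n)⁻¹ * (4 * K * cellMass lam n) := by gcongr; exact h.polarNorm_bump_le hp hN n k
      _ = 4 * K := by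
        rw [mul_comm, mul_assoc, ENNReal.mul_inv_cancel (h.cellMass_ne_zero n) (h.cellMass_ne_top n), mul_one]
      _ ≤ _ := by push_cast; exact le_self_add
  · intro w hw
    rw [hge]
    have h1 := le_norm_bump hw
    have h2 : 1 ≤ ENNReal.ofReal (9 ^ (N * p)) * ‖bump n k w ^ N‖ₑ ^ p := by
      rw [← ofReal_norm, norm_pow, ENNReal.ofReal_rpow_of_nonneg (by positivity) hp.le,
        ← ENNReal.ofReal_mul (by positivity), ENNReal.one_le_ofReal, ← Real.rpow_natCast,
        ← Real.rpow_mul (norm_nonneg _), ← Real.mul_rpow (by norm_num) (norm_nonneg _)]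
      exact Real.one_le_rpow h1 (by positivity)
    calc 1 ≤ ENNReal.ofReal (9 ^ (N * p)) * ‖bump n k w ^ N‖ₑ ^ p := h2
      _ ≤ ((4 * K + Real.toNNReal (9 ^ (N * p)) : ℝ≥0) : ℝ≥0∞) * ‖bump n k w ^ N‖ₑ ^ p := by
        gcongr
        push_cast
        exact le_add_self
      _ = _ := by
        rw [mul_assoc, ← mul_assoc (cellMass lam n), ENNReal.mul_inv_cancel (h.cellMass_ne_zero n)
          (h.cellMass_ne_top n), one_mul]
  · intro z hz
    rw [norm_mul, Complex.norm_real, Real.norm_of_nonneg (hspos n).le, norm_pow, mul_assoc, ← mul_pow]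
    have := hspos n
    gcongr
    exact norm_bump_le n k hz

end IsDoublingMeasure

/-! ### The Carleson scale of a doubling weight and the growth estimate -/

theorem lebesgueNorm_rpow {q : ℝ} (hq : 0 < q) (ν : Measure ℂ) (g : ℂ → ℂ) :
    lebesgueNorm q ν g ^ q = ∫⁻ z in disc, ‖g z‖ₑ ^ q ∂ν := by
  rw [lebesgueNorm, eLpNorm_eq_lintegral_rpow_enorm_toReal (by simpa using hq) ENNReal.ofReal_ne_top,
    ENNReal.toReal_ofReal hq.le, one_div, ENNReal.rpow_inv_rpow hq.ne']

theorem bergmanNorm_rpow {p : ℝ} (hp : 0 < p) {ω : ℝ → ℝ} {lam : Measure ℝ}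
    (hlam : ∀ g : ℂ → ℝ≥0∞, Measurable g → ∫⁻ z, g z ∂(weightMeasure ω) =
      ∫⁻ ρ, (∫⁻ θ in Ioc (-Real.pi) Real.pi, g (circleMap 0 ρ θ)) ∂lam)
    {f : ℂ → ℂ} (hf : ContinuousOn f disc) : bergmanNorm p ω f ^ p = polarNorm lam p f := by
  rw [bergmanNorm, eLpNorm_eq_lintegral_rpow_enorm_toReal (by simpa using hp) ENNReal.ofReal_ne_top,
    ENNReal.toReal_ofReal hp.le, one_div, ENNReal.rpow_inv_rpow hp.ne', polarNorm]
  have h := hlam _ ((measurable_indicator_disc hf).enorm.pow_const p)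
  refine Eq.trans (lintegral_congr_ae ?_) h
  refine (withDensity_absolutelyContinuous _ _).ae_le ?_
  filter_upwards [ae_restrict_mem measurableSet_disc] with z hz
  rw [indicator_of_mem hz]

theorem mem_bergman_of_bergmanNorm {p : ℝ} {ω : ℝ → ℝ} {f : ℂ → ℂ} (hf : DifferentiableOn ℂ f disc)
    (h : bergmanNorm p ω f ≠ ∞) : f ∈ bergman p ω := by
  refine ⟨hf, AEStronglyMeasurable.mono_ac (withDensity_absolutelyContinuous _ _)
    (hf.continuousOn.aestronglyMeasurable measurableSet_disc), h.lt_top⟩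

theorem bergmanNorm_ne_top {p : ℝ} {ω : ℝ → ℝ} {f : ℂ → ℂ} (hf : f ∈ bergman p ω) :
    bergmanNorm p ω f ≠ ∞ := hf.2.2.ne

theorem aestronglyMeasurable_of_continuousOn {ν : Measure ℂ} {f : ℂ → ℂ} (hf : ContinuousOn f disc) :
    AEStronglyMeasurable f (ν.restrict disc) := hf.aestronglyMeasurable measurableSet_disc

/-- A sequence of weights on the Carleson squares of the `n`-th generation for which the Carleson
embedding of the Bergman space holds and is tested by explicit functions. -/
structure IsCarlesonScale (p q : ℝ) (ω : ℝ → ℝ) (m : ℕ → ℝ≥0∞) (C : ℝ≥0) : Prop where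
  ne_zero : ∀ n, m n ≠ 0
  ne_top : ∀ n, m n ≠ ∞
  antitone : Antitone m
  one_mem : (fun _ => 1) ∈ bergman p ω
  embedding : ∀ f ∈ bergman p ω, ∃ G : ℂ → ℝ≥0∞, Measurable G ∧
    (∀ w ∈ disc, ∀ ζ, ‖ζ - w‖ ≤ (1 - ‖w‖) / 4 → ‖f ζ‖ₑ ≤ G w) ∧
    ∀ (μ : Measure ℂ) (n₀ : ℕ) (ε : ℝ≥0∞), (∀ n ≥ n₀, ∀ k, μ (square (n, k)) ≤ ε * m n) →
      ∫⁻ w in outerDisc n₀, G w ^ q ∂μ ≤ C * ε * bergmanNorm p ω f ^ q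
  test : ∃ (N : ℕ) (η : ℕ → ℝ) (g : ℕ → ℤ → ℂ → ℂ), Tendsto η atTop (𝓝 0) ∧ ∀ n k,
    g n k ∈ bergman p ω ∧ bergmanNorm p ω (g n k) ≤ C ∧
    (∀ w ∈ square (n, k), 1 ≤ C * m n * ‖g n k w‖ₑ ^ q) ∧
    ∀ z ∈ disc, ‖g n k z‖ ≤ η n * (1 - ‖z‖)⁻¹ ^ N

theorem cellMass_antitone (lam : Measure ℝ) : Antitone (cellMass lam) := by
  refine antitone_nat_of_succ_le fun n => ?_
  rw [cellMass, cellMass]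
  gcongr
  · exact dyadicRadius_mono n.le_succ
  · norm_num
  · exact n.le_succ

theorem IsUpperDoubling.exists_isCarlesonScale {ω : ℝ → ℝ} (hω : IsUpperDoubling ω) {p q : ℝ}
    (hp : 0 < p) (hpq : p ≤ q) : ∃ m C, IsCarlesonScale p q ω m C := by
  obtain ⟨lam, K, h, hlam⟩ := hω.exists_isDoublingMeasure
  have := h.finite
  obtain ⟨C₁, hC₁⟩ := h.exists_embedding hp hpq
  obtain ⟨C₂, N, η, g, hη, hg⟩ := h.exists_test_functions hp
  have hq : 0 < q := hp.trans_le hpq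
  have hqp : 0 < q / p := by positivity
  have hnorm : ∀ {f : ℂ → ℂ}, DifferentiableOn ℂ f disc → bergmanNorm p ω f ^ p = polarNorm lam p f :=
    fun hf => bergmanNorm_rpow hp hlam hf.continuousOn
  have hmem : ∀ {f : ℂ → ℂ}, DifferentiableOn ℂ f disc → polarNorm lam p f ≠ ∞ → f ∈ bergman p ω :=
    fun hf hf' => mem_bergman_of_bergmanNorm hf fun htop => hf' <| by
      rw [← hnorm hf, htop, ENNReal.top_rpow_of_pos hp]
  -- The extra powers of `C₂` come from passing from `p`-th powers of norms and values to norms and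
  -- `q`-th powers.
  refine ⟨fun n => cellMass lam n ^ (q / p), C₁ + C₂ ^ p⁻¹ + C₂ ^ (q / p), ⟨?_, ?_, ?_, ?_, ?_, ?_⟩⟩
  · exact fun n => (ENNReal.rpow_pos (pos_iff_ne_zero.2 (h.cellMass_ne_zero n)) (h.cellMass_ne_top n)).ne'
  · exact fun n => ENNReal.rpow_ne_top_of_nonneg hqp.le (h.cellMass_ne_top n)
  · exact fun a b hab => ENNReal.rpow_le_rpow (cellMass_antitone lam hab) hqp.le
  · refine hmem (differentiableOn_const _) (ne_top_of_le_ne_top ?_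
      (show polarNorm lam p (fun _ => 1) ≤ ∫⁻ ρ, (∫⁻ θ in Ioc (-Real.pi) Real.pi, 1) ∂lam from ?_))
    · simp [ENNReal.mul_eq_top]
    · refine lintegral_mono fun ρ => lintegral_mono fun θ => ?_
      simp only [polarPow]
      by_cases hz : circleMap 0 ρ θ ∈ disc
      · simp [indicator_of_mem hz]
      · simp [indicator_of_notMem hz, hp]
  · rintro f hf
    obtain ⟨G, hG, hGf, hGμ⟩ := hC₁ f hf.1 (by
      rw [← hnorm hf.1]; exact ENNReal.rpow_ne_top_of_nonneg hp.le (bergmanNorm_ne_top hf))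
    refine ⟨G, hG, hGf, fun μ n₀ ε hμ => (hGμ μ n₀ ε hμ).trans ?_⟩
    rw [← hnorm hf.1, ← ENNReal.rpow_mul, mul_div_cancel₀ _ hp.ne']
    gcongr
    rw [add_assoc]
    exact le_self_add
  · refine ⟨N, η, g, hη, fun n k => ?_⟩
    obtain ⟨h1, h2, h3, h4⟩ := hg n k
    refine ⟨hmem h1 (ne_top_of_le_ne_top (by simp) h2), ?_, fun w hw => ?_, h4⟩
    · rw [← hnorm h1, ← ENNReal.le_rpow_inv_iff hp] at h2
      refine h2.trans ?_
      rw [← ENNReal.coe_rpow_of_nonneg _ (by positivity)]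
      norm_cast
      exact le_add_right (le_add_self)
    · have h5 := ENNReal.rpow_le_rpow (h3 w hw) hqp.le
      rw [ENNReal.one_rpow, ENNReal.mul_rpow_of_nonneg _ _ hqp.le, ENNReal.mul_rpow_of_nonneg _ _ hqp.le,
        ← ENNReal.rpow_mul, mul_div_cancel₀ _ hp.ne', ← ENNReal.coe_rpow_of_nonneg _ hqp.le] at h5
      refine h5.trans ?_
      gcongr
      exact le_add_self

namespace IsCarlesonScale

variable {p q : ℝ} {ω : ℝ → ℝ} {m : ℕ → ℝ≥0∞} {C : ℝ≥0}

/-- Growth of `f` at a point is the embedding for the Dirac mass there. Squares containing `w` have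
generation at most `n`, so by monotonicity of `m` the mass satisfies the Carleson condition with `ε
= (m n)⁻¹`. -/
theorem enorm_rpow_le (h : IsCarlesonScale p q ω m C) (hq : 0 < q) {f : ℂ → ℂ} (hf : f ∈ bergman p ω)
    {n : ℕ} {w : ℂ} (hw : ‖w‖ < dyadicRadius n) :
    ‖f w‖ₑ ^ q ≤ C * (m n)⁻¹ * bergmanNorm p ω f ^ q := by
  have hwd : w ∈ disc := mem_disc.2 (hw.trans (dyadicRadius_lt_one n))
  obtain ⟨G, hG, hGf, hGμ⟩ := h.embedding f hf
  have h1 := hGμ (Measure.dirac w) 0 (m n)⁻¹ fun j _ k => by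
    by_cases hwk : w ∈ square (j, k)
    · have hjn : j ≤ n := by
        by_contra! hcon
        exact absurd (hw.trans_le ((dyadicRadius_mono hcon.le).trans hwk.2.1)) (lt_irrefl _)
      calc Measure.dirac w (square (j, k)) ≤ 1 := prob_le_one
        _ = (m n)⁻¹ * m n := (ENNReal.inv_mul_cancel (h.ne_zero n) (h.ne_top n)).symm
        _ ≤ _ := by gcongr; exact h.antitone hjn
    · rw [Measure.dirac_apply, indicator_of_notMem hwk]
      exact zero_le
  refine le_trans ?_ h1
  have hwo : w ∈ outerDisc 0 := ⟨hwd, by rw [dyadicRadius_zero]; exact norm_nonneg w⟩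
  have hres : (Measure.dirac w).restrict (outerDisc 0) = Measure.dirac w :=
    Measure.restrict_eq_self_of_ae_mem ((ae_dirac_iff (measurableSet_outerDisc 0)).2 hwo)
  rw [hres, lintegral_dirac' _ (hG.pow_const q)]
  gcongr
  exact hGf w hwd w (by
    rw [sub_self, norm_zero]
    have := mem_disc.1 hwd
    linarith)

theorem enorm_le (h : IsCarlesonScale p q ω m C) (hq : 0 < q) {f : ℂ → ℂ} (hf : f ∈ bergman p ω)
    {n : ℕ} {w : ℂ} (hw : ‖w‖ < dyadicRadius n) :
    ‖f w‖ₑ ≤ (C * (m n)⁻¹) ^ q⁻¹ * bergmanNorm p ω f := by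
  have h1 := h.enorm_rpow_le hq hf hw
  rwa [← ENNReal.le_rpow_inv_iff hq, ENNReal.mul_rpow_of_nonneg _ _ (inv_nonneg.2 hq.le),
    ENNReal.rpow_rpow_inv hq.ne'] at h1

end IsCarlesonScale

/-! ### Push-forward measures and the pointwise estimate of the difference -/

theorem measurableSet_square (Q : ℕ × ℤ) : MeasurableSet (square Q) :=
  measurableSet_disc.inter ((measurableSet_le measurable_const measurable_norm).inter
    (((measurable_arcIndex Q.1).comp Complex.measurable_arg) (measurableSet_singleton Q.2)))

/-- The image under `φ` of the measure `|u|^q dν` on the disc. -/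
noncomputable def pushMeasure (q : ℝ) (ν : Measure ℂ) (u φ : ℂ → ℂ) : Measure ℂ :=
  ((ν.restrict disc).withDensity fun z => ‖disc.indicator u z‖ₑ ^ q).map (disc.indicator φ)

theorem lintegral_pushMeasure {q : ℝ} {ν : Measure ℂ} {u φ : ℂ → ℂ} (hu : ContinuousOn u disc)
    (hφ : ContinuousOn φ disc) {F : ℂ → ℝ≥0∞} (hF : Measurable F) :
    ∫⁻ w, F w ∂(pushMeasure q ν u φ) = ∫⁻ z in disc, ‖u z‖ₑ ^ q * F (φ z) ∂ν := by
  have hφm := measurable_indicator_disc hφ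
  have hum := measurable_indicator_disc hu
  rw [pushMeasure, lintegral_map hF hφm,
    lintegral_withDensity_eq_lintegral_mul _ (hum.enorm.pow_const q)
      (show Measurable fun z => F (disc.indicator φ z) from hF.comp hφm)]
  refine setLIntegral_congr_fun measurableSet_disc fun z hz => ?_
  simp only [Pi.mul_apply, indicator_of_mem hz]

theorem pushMeasure_apply {q : ℝ} {ν : Measure ℂ} {u φ : ℂ → ℂ} (hu : ContinuousOn u disc)
    (hφ : ContinuousOn φ disc) {S : Set ℂ} (hS : MeasurableSet S) :
    pushMeasure q ν u φ S = ∫⁻ z in disc, ‖u z‖ₑ ^ q * S.indicator 1 (φ z) ∂ν := by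
  rw [← lintegral_indicator_one hS, lintegral_pushMeasure hu hφ (measurable_one.indicator hS)]

theorem weightedCompOp_apply (u φ f : ℂ → ℂ) (z : ℂ) : weightedCompOp u φ f z = u z * f (φ z) := rfl

theorem compOp_sub_apply (φ ψ f : ℂ → ℂ) (z : ℂ) : (compOp φ - compOp ψ) f z = f (φ z) - f (ψ z) := rfl

theorem lebesgueNorm_weightedCompOp_rpow {q : ℝ} (hq : 0 < q) (ν : Measure ℂ) (u φ f : ℂ → ℂ) :
    lebesgueNorm q ν (weightedCompOp u φ f) ^ q = ∫⁻ z in disc, ‖u z‖ₑ ^ q * ‖f (φ z)‖ₑ ^ q ∂ν := by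
  rw [lebesgueNorm_rpow hq]
  refine lintegral_congr fun z => ?_
  rw [weightedCompOp_apply, enorm_mul, ENNReal.mul_rpow_of_nonneg _ _ hq.le]

/-- Testing on a function which is large on `S` controls the mass of `S`. -/
theorem pushMeasure_le {q : ℝ} (hq : 0 < q) {ν : Measure ℂ} {u φ : ℂ → ℂ} (hu : ContinuousOn u disc)
    (hφ : ContinuousOn φ disc) {S : Set ℂ} (hS : MeasurableSet S) {f : ℂ → ℂ} {c : ℝ≥0∞} (hc : c ≠ ∞)
    (hf : ∀ w ∈ S, 1 ≤ c * ‖f w‖ₑ ^ q) :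
    pushMeasure q ν u φ S ≤ c * lebesgueNorm q ν (weightedCompOp u φ f) ^ q := by
  rw [pushMeasure_apply hu hφ hS, lebesgueNorm_weightedCompOp_rpow hq, ← lintegral_const_mul' _ _ hc]
  refine lintegral_mono fun z => ?_
  by_cases hz : φ z ∈ S
  · simp only [indicator_of_mem hz, Pi.one_apply, mul_one]
    calc ‖u z‖ₑ ^ q = ‖u z‖ₑ ^ q * 1 := (mul_one _).symm
      _ ≤ ‖u z‖ₑ ^ q * (c * ‖f (φ z)‖ₑ ^ q) := by gcongr; exact hf _ hz
      _ = _ := by ring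
  · simp [indicator_of_notMem hz]

theorem one_sub_conj_mul_ne_zero {a b : ℂ} (ha : a ∈ disc) (hb : b ∈ disc) : 1 - conj b * a ≠ 0 := by
  rw [mem_disc] at ha hb
  intro h
  have h1 : ‖conj b * a‖ = 1 := by rw [← sub_eq_zero.1 h, norm_one]
  rw [norm_mul, RCLike.norm_conj] at h1
  nlinarith [norm_nonneg a, norm_nonneg b]

theorem continuousOn_delta {φ ψ : ℂ → ℂ} (hφ : IsAnalyticSelfMap φ) (hψ : IsAnalyticSelfMap ψ) :
    ContinuousOn (delta φ ψ) disc := by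
  have h1 := hφ.1.continuousOn
  have h2 := hψ.1.continuousOn
  unfold delta
  refine ContinuousOn.div (h2.sub h1) (continuousOn_const.sub ?_) fun z hz =>
    one_sub_conj_mul_ne_zero (hφ.2 hz) (hψ.2 hz)
  exact (Complex.continuous_conj.comp_continuousOn h2).mul h1

/-- Points at small pseudohyperbolic distance are close relative to the distance to the circle. -/
theorem norm_sub_le_of_pseudo {a b : ℂ} (ha : a ∈ disc) (hb : b ∈ disc)
    (hd : ‖(b - a) / (1 - conj b * a)‖ < 1 / 20) :
    ‖b - a‖ ≤ 40 / 19 * ‖(b - a) / (1 - conj b * a)‖ * (1 - ‖a‖) := by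
  have hne := one_sub_conj_mul_ne_zero ha hb
  set d := ‖(b - a) / (1 - conj b * a)‖ with hdd
  have h1 : ‖b - a‖ = d * ‖1 - conj b * a‖ := by
    rw [hdd, norm_div, div_mul_cancel₀ _ (norm_ne_zero_iff.2 hne)]
  have h2 : 1 - conj b * a = (1 - conj a * a) - conj (b - a) * a := by
    rw [map_sub]; ring
  have ha' := mem_disc.1 ha
  have h3 : ‖1 - conj a * a‖ ≤ 2 * (1 - ‖a‖) := by
    have : 1 - conj a * a = ((1 - ‖a‖ ^ 2 : ℝ) : ℂ) := by
      rw [Complex.conj_mul']; push_cast; ring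
    rw [this, Complex.norm_real, Real.norm_of_nonneg (by nlinarith [norm_nonneg a])]
    nlinarith [norm_nonneg a]
  have h4 : ‖1 - conj b * a‖ ≤ 2 * (1 - ‖a‖) + ‖b - a‖ := by
    rw [h2]
    refine (norm_sub_le _ _).trans (add_le_add h3 ?_)
    rw [norm_mul, RCLike.norm_conj]
    exact mul_le_of_le_one_right (norm_nonneg _) ha'.le
  have hd0 : 0 ≤ d := norm_nonneg _
  have h5 : ‖b - a‖ ≤ d * (2 * (1 - ‖a‖) + ‖b - a‖) := h1.le.trans (by gcongr)
  nlinarith [norm_nonneg (b - a)]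

/-- The Schwarz lemma on the disc of radius `(1 - ‖a‖) / 4` about `a`, which contains `b` because
`(40 / 19) / 20 < 1 / 4`. The resulting constant is `2 * 4 * 40 / 19 = 320 / 19 ≤ 20`. -/
theorem enorm_sub_le_of_pseudo {f : ℂ → ℂ} (hf : DifferentiableOn ℂ f disc) {a b : ℂ} (ha : a ∈ disc)
    (hb : b ∈ disc) (hd : ‖(b - a) / (1 - conj b * a)‖ < 1 / 20) {L : ℝ≥0∞}
    (hL : ∀ ζ, ‖ζ - a‖ ≤ (1 - ‖a‖) / 4 → ‖f ζ‖ₑ ≤ L) :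
    ‖f a - f b‖ₑ ≤ 20 * ‖(b - a) / (1 - conj b * a)‖ₑ * L := by
  have hab := norm_sub_le_of_pseudo ha hb hd
  set d := (b - a) / (1 - conj b * a) with hdd
  have ha' := mem_disc.1 ha
  rcases eq_or_ne b a with hba | hba
  · simp [hba]
  have hd0 : d ≠ 0 := div_ne_zero (sub_ne_zero.2 hba) (one_sub_conj_mul_ne_zero ha hb)
  rcases eq_or_ne L ∞ with hLt | hLt
  · rw [hLt, ENNReal.mul_top (mul_ne_zero (by norm_num) (enorm_ne_zero.2 hd0))]
    exact le_top
  have hR : 0 < (1 - ‖a‖) / 4 := by linarith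
  have hLr : ∀ ζ, ‖ζ - a‖ ≤ (1 - ‖a‖) / 4 → ‖f ζ‖ ≤ L.toReal := fun ζ hζ => by
    rw [← toReal_enorm]; exact ENNReal.toReal_mono hLt (hL ζ hζ)
  have hfa := hLr a (by simpa using hR.le)
  have hsub : Metric.ball a ((1 - ‖a‖) / 4) ⊆ disc := fun ζ hζ => by
    rw [mem_ball_iff_norm] at hζ
    rw [mem_disc]
    have := norm_le_norm_add_norm_sub' ζ a
    linarith
  have h1 := Complex.dist_le_div_mul_dist_of_mapsTo_ball (hf.mono hsub) (R₂ := 2 * L.toReal)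
    (fun ζ hζ => by
      rw [mem_ball_iff_norm] at hζ
      rw [mem_closedBall_iff_norm]
      linarith [norm_sub_le (f ζ) (f a), hLr ζ hζ.le])
    (show b ∈ Metric.ball a ((1 - ‖a‖) / 4) by
      rw [mem_ball_iff_norm]
      nlinarith)
  rw [dist_comm, dist_eq_norm, dist_eq_norm] at h1
  have h2 : ‖f a - f b‖ ≤ 20 * ‖d‖ * L.toReal := by
    refine h1.trans ?_
    calc 2 * L.toReal / ((1 - ‖a‖) / 4) * ‖b - a‖
        ≤ 2 * L.toReal / ((1 - ‖a‖) / 4) * (40 / 19 * ‖d‖ * (1 - ‖a‖)) := by gcongr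
      _ = 320 / 19 * (‖d‖ * L.toReal) := by
        have : 1 - ‖a‖ ≠ 0 := by linarith
        field_simp
        ring
      _ ≤ _ := by nlinarith [mul_nonneg (norm_nonneg d) (ENNReal.toReal_nonneg (a := L))]
  rw [← ofReal_norm]
  refine (ENNReal.ofReal_le_ofReal h2).trans_eq ?_
  rw [ENNReal.ofReal_mul (by positivity), ENNReal.ofReal_mul (by positivity), ENNReal.ofReal_toReal hLt,
    ofReal_norm]
  simp

theorem add_rpow_le_two_rpow_mul {q : ℝ} (hq : 0 ≤ q) (x y : ℝ≥0∞) :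
    (x + y) ^ q ≤ 2 ^ q * (x ^ q + y ^ q) := by
  have h : x + y ≤ 2 * max x y := by
    rw [two_mul]; exact add_le_add (le_max_left _ _) (le_max_right _ _)
  refine (ENNReal.rpow_le_rpow h hq).trans ?_
  rw [ENNReal.mul_rpow_of_nonneg _ _ hq]
  gcongr
  rcases max_cases x y with h | h <;> rw [h.1]
  · exact le_self_add
  · exact le_add_self

theorem enorm_sub_rpow_le {q : ℝ} (hq : 0 ≤ q) (x y : ℂ) :
    ‖x - y‖ₑ ^ q ≤ 2 ^ q * (‖x‖ₑ ^ q + ‖y‖ₑ ^ q) :=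
  (ENNReal.rpow_le_rpow enorm_sub_le hq).trans (add_rpow_le_two_rpow_mul hq _ _)

/-- The part of the disc where `φ` and `ψ` are close to each other and `φ` is away from the circle. -/
def innerPart (φ ψ : ℂ → ℂ) (n : ℕ) : Set ℂ :=
  {z | z ∈ disc ∧ ‖φ z‖ < dyadicRadius n ∧ ‖delta φ ψ z‖ < 1 / 20}

theorem innerPart_zero (φ ψ : ℂ → ℂ) : innerPart φ ψ 0 = ∅ := by
  ext z
  simp only [innerPart, dyadicRadius_zero, mem_ofPred_eq, mem_empty_iff_false, iff_false]
  exact fun h => (norm_nonneg _).not_gt h.2.1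

theorem isOpen_innerPart {φ ψ : ℂ → ℂ} (hφ : IsAnalyticSelfMap φ) (hψ : IsAnalyticSelfMap ψ) (n : ℕ) :
    IsOpen (innerPart φ ψ n) := by
  have h1 := hφ.1.continuousOn.norm.isOpen_inter_preimage isOpen_disc (isOpen_Iio (a := dyadicRadius n))
  have h2 := (continuousOn_delta hφ hψ).norm.isOpen_inter_preimage isOpen_disc (isOpen_Iio (a := (1 / 20 : ℝ)))
  convert h1.inter h2 using 1
  ext z
  simp only [innerPart, mem_ofPred_eq, mem_inter_iff, mem_preimage, mem_Iio]
  tauto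

theorem aemeasurable_enorm_rpow {ν : Measure ℂ} {f : ℂ → ℂ} (hf : ContinuousOn f disc) (q : ℝ) :
    AEMeasurable (fun z => ‖f z‖ₑ ^ q) (ν.restrict disc) :=
  ((aestronglyMeasurable_of_continuousOn hf).enorm).pow_const q

/-- The basic estimate of the difference of two composition operators. -/
theorem lebesgueNorm_sub_rpow_le {q : ℝ} (hq : 0 < q) {ν : Measure ℂ} {φ ψ f : ℂ → ℂ}
    (hφ : IsAnalyticSelfMap φ) (hψ : IsAnalyticSelfMap ψ) (hf : DifferentiableOn ℂ f disc)
    {G : ℂ → ℝ≥0∞} (hG : Measurable G)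
    (hGf : ∀ w ∈ disc, ∀ ζ, ‖ζ - w‖ ≤ (1 - ‖w‖) / 4 → ‖f ζ‖ₑ ≤ G w) (n : ℕ) :
    lebesgueNorm q ν ((compOp φ - compOp ψ) f) ^ q ≤ 40 ^ q *
        (lebesgueNorm q ν (weightedCompOp (delta φ ψ) φ f) ^ q +
          lebesgueNorm q ν (weightedCompOp (delta φ ψ) ψ f) ^ q +
          ∫⁻ w in outerDisc n, G w ^ q ∂(pushMeasure q ν (delta φ ψ) φ)) +
      ∫⁻ z in innerPart φ ψ n, ‖f (φ z) - f (ψ z)‖ₑ ^ q ∂ν := by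
  have hδ := continuousOn_delta hφ hψ
  have hφc := hφ.1.continuousOn
  have hψc := hψ.1.continuousOn
  have hOm := measurableSet_outerDisc n
  have hfφ : ContinuousOn (fun z => f (φ z)) disc := hf.continuousOn.comp hφc hφ.2
  have hfψ : ContinuousOn (fun z => f (ψ z)) disc := hf.continuousOn.comp hψc hψ.2
  have hIm := (isOpen_innerPart hφ hψ n).measurableSet
  have hIs : innerPart φ ψ n ⊆ disc := fun z hz => hz.1
  have h40 : (40 : ℝ≥0∞) ^ q ≠ ∞ := ENNReal.rpow_ne_top_of_nonneg hq.le (by norm_num)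
  rw [← lintegral_indicator hOm, lintegral_pushMeasure hδ hφc ((hG.pow_const q).indicator hOm),
    lebesgueNorm_weightedCompOp_rpow hq, lebesgueNorm_weightedCompOp_rpow hq, lebesgueNorm_rpow hq]
  have hX : AEMeasurable (fun z => ‖delta φ ψ z‖ₑ ^ q * ‖f (φ z)‖ₑ ^ q) (ν.restrict disc) :=
    (aemeasurable_enorm_rpow (ν := ν) hδ q).mul (aemeasurable_enorm_rpow hfφ q)
  have hY : AEMeasurable (fun z => ‖delta φ ψ z‖ₑ ^ q * ‖f (ψ z)‖ₑ ^ q) (ν.restrict disc) :=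
    (aemeasurable_enorm_rpow (ν := ν) hδ q).mul (aemeasurable_enorm_rpow hfψ q)
  have hI : ∫⁻ z in innerPart φ ψ n, ‖f (φ z) - f (ψ z)‖ₑ ^ q ∂ν
      = ∫⁻ z in disc, (innerPart φ ψ n).indicator (fun z => ‖f (φ z) - f (ψ z)‖ₑ ^ q) z ∂ν := by
    rw [lintegral_indicator hIm, Measure.restrict_restrict hIm, inter_eq_left.2 hIs]
  rw [hI, ← lintegral_add_left' hX,
    ← lintegral_add_left' (show AEMeasurable (fun z => ‖delta φ ψ z‖ₑ ^ q * ‖f (φ z)‖ₑ ^ q +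
      ‖delta φ ψ z‖ₑ ^ q * ‖f (ψ z)‖ₑ ^ q) (ν.restrict disc) from hX.add hY), ← lintegral_const_mul' _ _ h40,
    ← lintegral_add_right']
  swap
  · exact (aemeasurable_enorm_rpow (hfφ.sub hfψ) q).indicator hIm
  refine setLIntegral_mono' measurableSet_disc fun z hz => ?_
  simp only [compOp_sub_apply]
  -- For close points with `φ z` in the outer disc, the majorant `G` bounds the difference; close
  -- points with `φ z` inside are left in the last integral. For distant points `20 |δ| ≥ 1`, and
  -- the triangle inequality suffices, with constant `40 = 20 * 2`.
  by_cases hd : ‖delta φ ψ z‖ < 1 / 20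
  · by_cases hr : ‖φ z‖ < dyadicRadius n
    · rw [indicator_of_mem (show z ∈ innerPart φ ψ n from ⟨hz, hr, hd⟩)]
      exact le_add_self
    · have hO : φ z ∈ outerDisc n := ⟨hφ.2 hz, not_lt.1 hr⟩
      rw [indicator_of_mem hO]
      refine le_add_right ?_
      have h1 := enorm_sub_le_of_pseudo hf (hφ.2 hz) (hψ.2 hz) hd (hGf _ (hφ.2 hz))
      have h2 := ENNReal.rpow_le_rpow h1 hq.le
      rw [ENNReal.mul_rpow_of_nonneg _ _ hq.le, ENNReal.mul_rpow_of_nonneg _ _ hq.le, mul_assoc] at h2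
      refine h2.trans ?_
      gcongr
      · norm_num
      · exact le_add_self
  · refine le_add_right ?_
    have h1 : 1 ≤ 20 * ‖delta φ ψ z‖ₑ := by
      rw [← ofReal_norm, show (20 : ℝ≥0∞) = ENNReal.ofReal 20 by simp, ← ENNReal.ofReal_mul (by norm_num),
        ENNReal.one_le_ofReal]
      linarith
    have h2 : 1 ≤ 20 ^ q * ‖delta φ ψ z‖ₑ ^ q := by
      rw [← ENNReal.mul_rpow_of_nonneg _ _ hq.le]
      exact ENNReal.one_le_rpow h1 hq
    calc ‖f (φ z) - f (ψ z)‖ₑ ^ q ≤ 1 * (2 ^ q * (‖f (φ z)‖ₑ ^ q + ‖f (ψ z)‖ₑ ^ q)) := by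
          rw [one_mul]; exact enorm_sub_rpow_le hq.le _ _
      _ ≤ (20 ^ q * ‖delta φ ψ z‖ₑ ^ q) * (2 ^ q * (‖f (φ z)‖ₑ ^ q + ‖f (ψ z)‖ₑ ^ q)) := by gcongr
      _ = 40 ^ q * (‖delta φ ψ z‖ₑ ^ q * ‖f (φ z)‖ₑ ^ q + ‖delta φ ψ z‖ₑ ^ q * ‖f (ψ z)‖ₑ ^ q) := by
          rw [show (40 : ℝ≥0∞) = 20 * 2 by norm_num, ENNReal.mul_rpow_of_nonneg _ _ hq.le]
          ring
      _ ≤ _ := mul_le_mul' le_rfl le_self_add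

theorem memLebesgue_sub {q : ℝ} (hq : 0 < q) {ν : Measure ℂ} {φ ψ f : ℂ → ℂ}
    (hφ : IsAnalyticSelfMap φ) (hψ : IsAnalyticSelfMap ψ) (hf : DifferentiableOn ℂ f disc)
    (h : lebesgueNorm q ν ((compOp φ - compOp ψ) f) ^ q ≠ ∞) :
    MemLebesgue q ν ((compOp φ - compOp ψ) f) :=
  ⟨aestronglyMeasurable_of_continuousOn ((hf.continuousOn.comp hφ.1.continuousOn hφ.2).sub
    (hf.continuousOn.comp hψ.1.continuousOn hψ.2)), lt_top_iff_ne_top.2 fun htop => h <| by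
      rw [lebesgueNorm, htop, ENNReal.top_rpow_of_pos hq]⟩

/-! ### Boundedness of the difference -/

namespace IsCarlesonScale

variable {p q : ℝ} {ω : ℝ → ℝ} {m : ℕ → ℝ≥0∞} {C : ℝ≥0} {ν : Measure ℂ} {φ ψ : ℂ → ℂ}

/-- The squares have small measure as soon as the operator is bounded. -/
theorem exists_pushMeasure_square_le (h : IsCarlesonScale p q ω m C) (hq : 0 < q) {u : ℂ → ℂ}
    (hu : ContinuousOn u disc) (hφ : ContinuousOn φ disc)
    (hT : IsBoundedOp p q ω ν (weightedCompOp u φ)) :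
    ∃ ε : ℝ≥0∞, ε ≠ ∞ ∧ ∀ n k, pushMeasure q ν u φ (square (n, k)) ≤ ε * m n := by
  obtain ⟨A, hA⟩ := hT.2
  obtain ⟨N, η, g, -, hg⟩ := h.test
  refine ⟨C * (A * C) ^ q, ENNReal.mul_ne_top (by simp)
    (ENNReal.rpow_ne_top_of_nonneg hq.le (ENNReal.mul_ne_top (by simp) (by simp))), fun n k => ?_⟩
  obtain ⟨h1, h2, h3, -⟩ := hg n k
  refine (pushMeasure_le hq hu hφ (measurableSet_square (n, k))
    (ENNReal.mul_ne_top (by simp) (h.ne_top n)) h3).trans ?_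
  calc C * m n * lebesgueNorm q ν (weightedCompOp u φ (g n k)) ^ q
      ≤ C * m n * (A * C) ^ q := by
        gcongr
        exact (hA _ h1).trans (by gcongr)
    _ = _ := by ring

/-- The norm estimate for the difference when the push-forward measure is a Carleson measure. -/
theorem lebesgueNorm_sub_rpow_le (h : IsCarlesonScale p q ω m C) (hq : 0 < q)
    (hφ : IsAnalyticSelfMap φ) (hψ : IsAnalyticSelfMap ψ) {f : ℂ → ℂ} (hf : f ∈ bergman p ω)
    {n₀ : ℕ} {ε : ℝ≥0∞}
    (hε : ∀ n ≥ n₀, ∀ k, pushMeasure q ν (delta φ ψ) φ (square (n, k)) ≤ ε * m n) :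
    lebesgueNorm q ν ((compOp φ - compOp ψ) f) ^ q ≤ 40 ^ q *
        (lebesgueNorm q ν (weightedCompOp (delta φ ψ) φ f) ^ q +
          lebesgueNorm q ν (weightedCompOp (delta φ ψ) ψ f) ^ q +
          C * ε * bergmanNorm p ω f ^ q) +
      ∫⁻ z in innerPart φ ψ n₀, ‖f (φ z) - f (ψ z)‖ₑ ^ q ∂ν := by
  obtain ⟨G, hG, hGf, hGμ⟩ := h.embedding f hf
  refine (DoublingBergman.lebesgueNorm_sub_rpow_le hq hφ hψ hf.1 hG hGf n₀).trans ?_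
  gcongr
  exact hGμ _ n₀ ε hε

/-- With `n₀ = 0` the inner part is empty, as the zeroth dyadic radius is `0`. -/
theorem lebesgueNorm_sub_rpow_le' (h : IsCarlesonScale p q ω m C) (hq : 0 < q)
    (hφ : IsAnalyticSelfMap φ) (hψ : IsAnalyticSelfMap ψ) {f : ℂ → ℂ} (hf : f ∈ bergman p ω)
    {ε : ℝ≥0∞} (hε : ∀ n k, pushMeasure q ν (delta φ ψ) φ (square (n, k)) ≤ ε * m n) :
    lebesgueNorm q ν ((compOp φ - compOp ψ) f) ^ q ≤ 40 ^ q *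
        (lebesgueNorm q ν (weightedCompOp (delta φ ψ) φ f) ^ q +
          lebesgueNorm q ν (weightedCompOp (delta φ ψ) ψ f) ^ q +
          C * ε * bergmanNorm p ω f ^ q) := by
  have := h.lebesgueNorm_sub_rpow_le (n₀ := 0) hq hφ hψ hf fun n _ k => hε n k
  rwa [innerPart_zero, Measure.restrict_empty, lintegral_zero_measure, add_zero] at this

theorem memLebesgue_sub (h : IsCarlesonScale p q ω m C) (hq : 0 < q)
    (hφ : IsAnalyticSelfMap φ) (hψ : IsAnalyticSelfMap ψ) {f : ℂ → ℂ} (hf : f ∈ bergman p ω)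
    {ε : ℝ≥0∞} (hεt : ε ≠ ∞) (hε : ∀ n k, pushMeasure q ν (delta φ ψ) φ (square (n, k)) ≤ ε * m n)
    (h1 : MemLebesgue q ν (weightedCompOp (delta φ ψ) φ f))
    (h2 : MemLebesgue q ν (weightedCompOp (delta φ ψ) ψ f)) :
    MemLebesgue q ν ((compOp φ - compOp ψ) f) := by
  have ht : ∀ {x : ℝ≥0∞}, x ≠ ∞ → x ^ q ≠ ∞ := fun hx => ENNReal.rpow_ne_top_of_nonneg hq.le hx
  refine DoublingBergman.memLebesgue_sub hq hφ hψ hf.1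
    (ne_top_of_le_ne_top ?_ (h.lebesgueNorm_sub_rpow_le' hq hφ hψ hf hε))
  exact ENNReal.mul_ne_top (ht (by norm_num)) (ENNReal.add_ne_top.2 ⟨ENNReal.add_ne_top.2
    ⟨ht h1.2.ne, ht h2.2.ne⟩, ENNReal.mul_ne_top (ENNReal.mul_ne_top (by simp) hεt)
      (ht (bergmanNorm_ne_top hf))⟩)

theorem isBoundedOp_sub (h : IsCarlesonScale p q ω m C) (hq : 0 < q)
    (hφ : IsAnalyticSelfMap φ) (hψ : IsAnalyticSelfMap ψ)
    (h1 : IsBoundedOp p q ω ν (weightedCompOp (delta φ ψ) φ))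
    (h2 : IsBoundedOp p q ω ν (weightedCompOp (delta φ ψ) ψ)) :
    IsBoundedOp p q ω ν (compOp φ - compOp ψ) := by
  obtain ⟨ε, hεt, hε⟩ := h.exists_pushMeasure_square_le hq (continuousOn_delta hφ hψ) hφ.1.continuousOn h1
  refine ⟨fun f hf => h.memLebesgue_sub hq hφ hψ hf hεt hε (h1.1 f hf) (h2.1 f hf), ?_⟩
  obtain ⟨A, hA⟩ := h1.2
  obtain ⟨B, hB⟩ := h2.2
  have ht : ∀ {x : ℝ≥0∞}, x ≠ ∞ → x ^ q ≠ ∞ := fun hx => ENNReal.rpow_ne_top_of_nonneg hq.le hx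
  have hD : (40 ^ q * ((A : ℝ≥0∞) ^ q + (B : ℝ≥0∞) ^ q + C * ε)) ^ q⁻¹ ≠ ∞ :=
    ENNReal.rpow_ne_top_of_nonneg (by positivity) <| ENNReal.mul_ne_top (ht (by norm_num)) <|
      ENNReal.add_ne_top.2 ⟨ENNReal.add_ne_top.2 ⟨ht (by simp), ht (by simp)⟩,
        ENNReal.mul_ne_top (by simp) hεt⟩
  refine ⟨(((40 ^ q * ((A : ℝ≥0∞) ^ q + (B : ℝ≥0∞) ^ q + C * ε)) ^ q⁻¹ : ℝ≥0∞)).toNNReal, fun f hf => ?_⟩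
  rw [ENNReal.coe_toNNReal hD, ← ENNReal.rpow_le_rpow_iff hq, ENNReal.mul_rpow_of_nonneg _ _ hq.le,
    ENNReal.rpow_inv_rpow hq.ne']
  calc lebesgueNorm q ν ((compOp φ - compOp ψ) f) ^ q
      ≤ 40 ^ q * ((A * bergmanNorm p ω f) ^ q + (B * bergmanNorm p ω f) ^ q +
          C * ε * bergmanNorm p ω f ^ q) := by
        refine (h.lebesgueNorm_sub_rpow_le' hq hφ hψ hf hε).trans ?_
        gcongr
        · exact hA f hf
        · exact hB f hf
    _ = _ := by
        rw [ENNReal.mul_rpow_of_nonneg _ _ hq.le, ENNReal.mul_rpow_of_nonneg _ _ hq.le]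
        ring

end IsCarlesonScale

/-! ### Normal families and compact operators on null sequences -/

/-- A locally bounded sequence of analytic functions on the disc has a pointwise convergent
subsequence with analytic limit. -/
theorem exists_subseq_tendsto_of_locally_bounded {F : ℕ → ℂ → ℂ} (hF : ∀ j, DifferentiableOn ℂ (F j) disc)
    (hB : ∀ r < (1 : ℝ), ∃ B : ℝ, ∀ j z, ‖z‖ ≤ r → ‖F j z‖ ≤ B) :
    ∃ (f : ℂ → ℂ) (k : ℕ → ℕ), DifferentiableOn ℂ f disc ∧ StrictMono k ∧
      ∀ z ∈ disc, Tendsto (fun j => F (k j) z) atTop (𝓝 (f z)) := by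
  choose! B hB using hB
  set a : ℕ → ℕ → ℂ := fun j n => (n.factorial : ℂ)⁻¹ * iteratedDeriv n (F j) 0 with ha
  have hab : ∀ r, 0 < r → r < 1 → ∀ j n, ‖a j n‖ ≤ B r / r ^ n := fun r hr hr1 j n => by
    have h1 := Complex.norm_iteratedDeriv_le_of_forall_mem_sphere_norm_le n hr
      (((hF j).mono fun z hz => by
        rw [closure_ball 0 hr.ne', mem_closedBall_zero_iff] at hz
        exact mem_disc.2 (hz.trans_lt hr1)).diffContOnCl)
      (fun z hz => hB r hr1 j z (mem_sphere_zero_iff_norm.1 hz).le)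
    rw [ha, norm_mul, norm_inv, Complex.norm_natCast,
      inv_mul_le_iff₀ (by exact_mod_cast n.factorial_pos), ← mul_div_assoc]
    exact h1
  have hsum : ∀ j, ∀ z ∈ disc, HasSum (fun n => a j n * z ^ n) (F j z) := fun j z hz => by
    have := Complex.hasSum_taylorSeries_on_ball (hF j) hz
    simpa [ha, mul_comm, mul_left_comm] using this
  -- Cauchy estimates at radius `1 / 2` put the Taylor coefficient sequences in a compact product of
  -- discs. Coefficientwise convergence is then upgraded to pointwise convergence by dominated
  -- summation, with Cauchy estimates at radii close to `1`.
  have hcpt : IsCompact (Set.pi univ fun n : ℕ => Metric.closedBall (0 : ℂ) (B (1 / 2) / (1 / 2) ^ n)) :=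
    isCompact_univ_pi fun n => isCompact_closedBall _ _
  obtain ⟨b, -, k, hk, hb⟩ := hcpt.tendsto_subseq (x := a) fun j n _ => by
    rw [mem_closedBall_zero_iff]
    exact hab _ (by norm_num) (by norm_num) j n
  have hb : ∀ n, Tendsto (fun j => a (k j) n) atTop (𝓝 (b n)) := tendsto_pi_nhds.1 hb
  have hbb : ∀ r, 0 < r → r < 1 → ∀ n, ‖b n‖ ≤ B r / r ^ n := fun r hr hr1 n =>
    le_of_tendsto' (hb n).norm fun j => hab r hr hr1 _ n
  have hterm : ∀ {c : ℂ} {r s : ℝ} {n : ℕ} {z : ℂ}, ‖c‖ ≤ B r / r ^ n → ‖z‖ ≤ s →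
      ‖c * z ^ n‖ ≤ B r * (s / r) ^ n := fun {c r s n z} hc hz => by
    rw [norm_mul, norm_pow, div_pow, ← mul_div_assoc, mul_div_right_comm]
    have := (norm_nonneg c).trans hc
    gcongr
  have hgeo : ∀ {r s : ℝ}, 0 ≤ s → s < r → Summable fun n : ℕ => B r * (s / r) ^ n := fun {r s} hs hsr =>
    (summable_geometric_of_lt_one (div_nonneg hs (hs.trans hsr.le))
      ((div_lt_one (hs.trans_lt hsr)).2 hsr)).mul_left _
  refine ⟨fun z => ∑' n, b n * z ^ n, k, ?_, hk, fun z hz => ?_⟩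
  · intro z hz
    obtain ⟨s, hzs, hs1⟩ := exists_between (mem_disc.1 hz)
    obtain ⟨r, hsr, hr1⟩ := exists_between hs1
    have hs0 : 0 ≤ s := (norm_nonneg z).trans hzs.le
    refine DifferentiableAt.differentiableWithinAt ?_
    refine (Complex.differentiableOn_tsum_of_summable_norm (hgeo hs0 hsr) (fun n => by fun_prop)
      (Metric.isOpen_ball (x := (0 : ℂ)) (ε := s)) fun n w hw => ?_).differentiableAt
      (Metric.isOpen_ball.mem_nhds (mem_ball_zero_iff.2 hzs))
    exact hterm (hbb r (hs0.trans_lt hsr) hr1 n) (mem_ball_zero_iff.1 hw).le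
  · obtain ⟨r, hzr, hr1⟩ := exists_between (mem_disc.1 hz)
    have hr0 := (norm_nonneg z).trans_lt hzr
    have h1 := tendsto_tsum_of_dominated_convergence (hgeo (norm_nonneg z) hzr)
      (fun n => (hb n).mul_const (z ^ n))
      (Eventually.of_forall fun j n => hterm (hab r hr0 hr1 (k j) n) le_rfl)
    refine h1.congr fun j => (hsum (k j) z hz).tsum_eq

namespace IsCarlesonScale

variable {p q : ℝ} {ω : ℝ → ℝ} {m : ℕ → ℝ≥0∞} {C : ℝ≥0} {ν : Measure ℂ} {φ ψ : ℂ → ℂ}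

/-- The growth estimate makes bounded sequences locally bounded, and Fatou's lemma keeps the
pointwise limit in the Bergman space. -/
theorem exists_subseq_tendsto (h : IsCarlesonScale p q ω m C) (hq : 0 < q) {F : ℕ → ℂ → ℂ}
    (hF : ∀ j, F j ∈ bergman p ω) {M : ℝ≥0} (hM : ∀ j, bergmanNorm p ω (F j) ≤ M) :
    ∃ f ∈ bergman p ω, ∃ k : ℕ → ℕ, StrictMono k ∧ bergmanNorm p ω f ≤ M ∧
      ∀ z ∈ disc, Tendsto (fun j => F (k j) z) atTop (𝓝 (f z)) := by
  obtain ⟨f, k, hf, hk, hfk⟩ := exists_subseq_tendsto_of_locally_bounded (fun j => (hF j).1) fun r hr => by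
    obtain ⟨n, hn⟩ := exists_pow_lt_of_lt_one (sub_pos.2 hr) (by norm_num : (2⁻¹ : ℝ) < 1)
    have hfin : (C * (m n)⁻¹) ^ q⁻¹ * M ≠ ∞ := ENNReal.mul_ne_top (ENNReal.rpow_ne_top_of_nonneg
      (by positivity) (ENNReal.mul_ne_top (by simp) (ENNReal.inv_ne_top.2 (h.ne_zero n)))) (by simp)
    refine ⟨((C * (m n)⁻¹) ^ q⁻¹ * M).toReal, fun j z hz => ?_⟩
    rw [← toReal_enorm]
    refine ENNReal.toReal_mono hfin ((h.enorm_le hq (hF j) (n := n) ?_).trans ?_)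
    · rw [dyadicRadius]; linarith
    · gcongr; exact hM j
  have hfM : bergmanNorm p ω f ≤ M := by
    refine le_trans (Lp.eLpNorm_lim_le_liminf_eLpNorm (f := fun j => F (k j)) (fun j => (hF (k j)).2.1) f ?_) ?_
    · refine (withDensity_absolutelyContinuous _ _).ae_le ?_
      filter_upwards [ae_restrict_mem measurableSet_disc] with z hz using hfk z hz
    · exact liminf_le_of_le (by isBoundedDefault) fun b hb => by
        obtain ⟨j, hj⟩ := hb.exists
        exact hj.trans (hM _)
  exact ⟨f, mem_bergman_of_bergmanNorm hf (ne_top_of_le_ne_top (by simp) hfM), k, hk, hfM, hfk⟩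

end IsCarlesonScale

/-- Every subsequence has a further one whose images converge in norm, hence almost everywhere along
another. Pointwise convergence to zero identifies the limit as zero. -/
theorem IsCompactOp.tendsto_lebesgueNorm {p q : ℝ} (hq : 0 < q) {ω : ℝ → ℝ} {ν : Measure ℂ} {u φ : ℂ → ℂ}
    (hφ : MapsTo φ disc disc) (hT : IsCompactOp p q ω ν (weightedCompOp u φ)) {F : ℕ → ℂ → ℂ}
    (hF : ∀ j, F j ∈ bergman p ω) {M : ℝ≥0} (hM : ∀ j, bergmanNorm p ω (F j) ≤ M)
    (h0 : ∀ z ∈ disc, Tendsto (fun j => F j z) atTop (𝓝 0)) :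
    Tendsto (fun j => lebesgueNorm q ν (weightedCompOp u φ (F j))) atTop (𝓝 0) := by
  refine tendsto_of_subseq_tendsto fun ns hns => ?_
  obtain ⟨g, hg, k, hk, hgk⟩ := hT.2 (fun j => F (ns j)) (fun j => hF _) ⟨M, fun j => hM _⟩
  refine ⟨k, ?_⟩
  have h1 := tendstoInMeasure_of_tendsto_eLpNorm (f := fun n => weightedCompOp u φ (F (ns (k n))))
    (by simpa using hq) (fun j => (hT.1 _ (hF _)).1) hg.1 hgk
  obtain ⟨ms, hms, hae⟩ := h1.exists_seq_tendsto_ae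
  have hg0 : g =ᵐ[ν.restrict disc] 0 := by
    filter_upwards [hae, ae_restrict_mem measurableSet_disc] with z hz hzd
    refine tendsto_nhds_unique hz ?_
    have h2 : Tendsto (fun j => F (ns (k (ms j))) (φ z)) atTop (𝓝 0) :=
      (h0 _ (hφ hzd)).comp (hns.comp (hk.tendsto_atTop.comp hms.tendsto_atTop))
    simpa [weightedCompOp_apply] using h2.const_mul (u z)
  refine hgk.congr fun j => ?_
  refine eLpNorm_congr_ae ?_
  filter_upwards [hg0] with z hz
  simp [hz]

/-! ### Compactness of the difference -/

namespace IsCarlesonScale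

variable {p q : ℝ} {ω : ℝ → ℝ} {m : ℕ → ℝ≥0∞} {C : ℝ≥0} {ν : Measure ℂ} {φ ψ : ℂ → ℂ}

/-- The measure of the squares is small compared to the scale if the operator is compact. -/
theorem exists_forall_pushMeasure_square_le (h : IsCarlesonScale p q ω m C) (hq : 0 < q) {u : ℂ → ℂ}
    (hu : ContinuousOn u disc) (hφ : IsAnalyticSelfMap φ)
    (hT : IsCompactOp p q ω ν (weightedCompOp u φ)) {e : ℝ≥0∞} (he : 0 < e) :
    ∃ n₀, ∀ n ≥ n₀, ∀ k, pushMeasure q ν u φ (square (n, k)) ≤ e * m n := by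
  obtain ⟨N, η, g, hη, hg⟩ := h.test
  -- In each generation a violating square is selected if there is one. The corresponding test
  -- functions are bounded and tend to zero pointwise, so compactness excludes violations in all
  -- late generations.
  have hex : ∀ n, ∃ k : ℤ, (∃ k', ¬pushMeasure q ν u φ (square (n, k')) ≤ e * m n) →
      ¬pushMeasure q ν u φ (square (n, k)) ≤ e * m n := fun n => by
    by_cases hn : ∃ k', ¬pushMeasure q ν u φ (square (n, k')) ≤ e * m n
    · exact ⟨hn.choose, fun _ => hn.choose_spec⟩
    · exact ⟨0, fun h => absurd h hn⟩
  choose k hk using hex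
  have h1 := hT.tendsto_lebesgueNorm hq hφ.2 (F := fun n => g n (k n)) (fun n => (hg n (k n)).1)
    (fun n => (hg n (k n)).2.1) fun z hz => by
      refine squeeze_zero_norm (fun n => (hg n (k n)).2.2.2 z hz) ?_
      simpa using hη.mul_const ((1 - ‖z‖)⁻¹ ^ N)
  have h2 := ENNReal.Tendsto.const_mul (a := (C : ℝ≥0∞)) (h1.ennrpow_const q) (Or.inr (by simp))
  rw [ENNReal.zero_rpow_of_pos hq, mul_zero] at h2
  obtain ⟨n₀, hn₀⟩ := eventually_atTop.1 (h2.eventually (Iic_mem_nhds he))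
  refine ⟨n₀, fun n hn j => ?_⟩
  by_contra hcon
  refine hk n ⟨j, hcon⟩ ?_
  refine (pushMeasure_le hq hu hφ.1.continuousOn (measurableSet_square (n, k n))
    (ENNReal.mul_ne_top (by simp) (h.ne_top n)) (hg n (k n)).2.2.1).trans ?_
  calc C * m n * lebesgueNorm q ν (weightedCompOp u φ (g n (k n))) ^ q
      = C * lebesgueNorm q ν (weightedCompOp u φ (g n (k n))) ^ q * m n := by ring
    _ ≤ _ := by gcongr; exact hn₀ n hn

/-- From some generation on, compactness gives the bound. The earlier generations are covered by the
finite total mass, finite because the constant function `1` lies in the Bergman space. -/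
theorem exists_pushMeasure_square_le_of_isCompactOp (h : IsCarlesonScale p q ω m C) (hq : 0 < q)
    {u : ℂ → ℂ} (hu : ContinuousOn u disc) (hφ : IsAnalyticSelfMap φ)
    (hT : IsCompactOp p q ω ν (weightedCompOp u φ)) :
    ∃ ε : ℝ≥0∞, ε ≠ ∞ ∧ ∀ n k, pushMeasure q ν u φ (square (n, k)) ≤ ε * m n := by
  obtain ⟨n₀, hn₀⟩ := h.exists_forall_pushMeasure_square_le hq hu hφ hT one_pos
  have huniv : pushMeasure q ν u φ univ ≠ ∞ := by
    refine ne_top_of_le_ne_top ?_ (pushMeasure_le hq hu hφ.1.continuousOn MeasurableSet.univ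
      (f := fun _ => 1) ENNReal.one_ne_top (by simp))
    rw [one_mul]
    exact ENNReal.rpow_ne_top_of_nonneg hq.le (hT.1 _ h.one_mem).2.ne
  refine ⟨1 + pushMeasure q ν u φ univ * (m n₀)⁻¹, ENNReal.add_ne_top.2 ⟨ENNReal.one_ne_top,
    ENNReal.mul_ne_top huniv (ENNReal.inv_ne_top.2 (h.ne_zero _))⟩, fun n k => ?_⟩
  rcases le_total n₀ n with hn | hn
  · exact (hn₀ n hn k).trans (by gcongr; exact le_self_add)
  · calc pushMeasure q ν u φ (square (n, k)) ≤ pushMeasure q ν u φ univ := measure_mono (subset_univ _)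
      _ = pushMeasure q ν u φ univ * (m n₀)⁻¹ * m n₀ := by
        rw [mul_assoc, ENNReal.inv_mul_cancel (h.ne_zero _) (h.ne_top _), mul_one]
      _ ≤ _ := by
        gcongr
        · exact le_add_self
        · exact h.antitone hn

/-- The `ν`-mass of the inner part may be infinite, so boundedness of `F j` there is not enough. The
Schwarz bound supplies the factor `|δ| ^ q`, which is integrable because `δ C_φ` maps `1` into
`L^q_ν`. -/
theorem tendsto_lintegral_innerPart (h : IsCarlesonScale p q ω m C) (hq : 0 < q)
    (hφ : IsAnalyticSelfMap φ) (hψ : IsAnalyticSelfMap ψ)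
    (hδ : MemLebesgue q ν (weightedCompOp (delta φ ψ) φ fun _ => 1)) {F : ℕ → ℂ → ℂ}
    (hF : ∀ j, F j ∈ bergman p ω) {M : ℝ≥0} (hM : ∀ j, bergmanNorm p ω (F j) ≤ M)
    (h0 : ∀ z ∈ disc, Tendsto (fun j => F j z) atTop (𝓝 0)) (n : ℕ) :
    Tendsto (fun j => ∫⁻ z in innerPart φ ψ n, ‖F j (φ z) - F j (ψ z)‖ₑ ^ q ∂ν) atTop (𝓝 0) := by
  have hIm := (isOpen_innerPart hφ hψ n).measurableSet
  have hIs : innerPart φ ψ n ⊆ disc := fun z hz => hz.1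
  set L : ℝ≥0∞ := (C * (m (n + 1))⁻¹) ^ q⁻¹ * M
  have hL : L ≠ ∞ := ENNReal.mul_ne_top (ENNReal.rpow_ne_top_of_nonneg
    (by positivity) (ENNReal.mul_ne_top (by simp) (ENNReal.inv_ne_top.2 (h.ne_zero _)))) (by simp)
  have hlim := tendsto_lintegral_of_dominated_convergence' (μ := ν.restrict (innerPart φ ψ n))
    (F := fun j z => ‖F j (φ z) - F j (ψ z)‖ₑ ^ q) (f := fun _ => 0)
    (fun z => (20 * L) ^ q * ‖delta φ ψ z‖ₑ ^ q) (fun j => ?_) (fun j => ?_) ?_ ?_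
  · simpa using hlim
  · refine (aemeasurable_enorm_rpow ?_ q).mono_measure (Measure.restrict_mono hIs le_rfl)
    exact ((hF j).1.continuousOn.comp hφ.1.continuousOn hφ.2).sub
      ((hF j).1.continuousOn.comp hψ.1.continuousOn hψ.2)
  · filter_upwards [ae_restrict_mem hIm] with z hz
    obtain ⟨hz, hzr, hzd⟩ := hz
    rw [← ENNReal.mul_rpow_of_nonneg _ _ hq.le]
    refine ENNReal.rpow_le_rpow ?_ hq.le
    refine (enorm_sub_le_of_pseudo (hF j).1 (hφ.2 hz) (hψ.2 hz) hzd (L := L) fun ζ hζ => ?_).trans_eq ?_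
    -- One more generation is needed, since `ζ` may be farther out than `φ z`; still `1 - ‖ζ‖ ≥ (3 /
    -- 4) (1 - ‖φ z‖) > 2⁻⁽ⁿ⁺¹⁾`.
    · refine (h.enorm_le hq (hF j) (n := n + 1) ?_).trans (mul_le_mul' le_rfl (hM j))
      have h1 := norm_le_norm_add_norm_sub' ζ (φ z)
      rw [dyadicRadius] at hzr ⊢
      rw [pow_succ]
      have : (0 : ℝ) < 2⁻¹ ^ n := by positivity
      linarith
    · rw [delta]; ring
  · have h1 : ∫⁻ z in disc, ‖delta φ ψ z‖ₑ ^ q ∂ν ≠ ∞ := by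
      have h2 := lebesgueNorm_weightedCompOp_rpow hq ν (delta φ ψ) φ fun _ => 1
      simp only [enorm_one, ENNReal.one_rpow, mul_one] at h2
      rw [← h2]
      exact ENNReal.rpow_ne_top_of_nonneg hq.le hδ.2.ne
    have hc : (20 * L) ^ q ≠ ∞ :=
      ENNReal.rpow_ne_top_of_nonneg hq.le (ENNReal.mul_ne_top (by norm_num) hL)
    rw [lintegral_const_mul' _ _ hc]
    exact ENNReal.mul_ne_top hc (ne_top_of_le_ne_top h1 (lintegral_mono_set hIs))
  · filter_upwards [ae_restrict_mem hIm] with z hz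
    have h1 := ((h0 _ (hφ.2 hz.1)).sub (h0 _ (hψ.2 hz.1))).enorm.ennrpow_const q
    simpa [ENNReal.zero_rpow_of_pos hq] using h1

theorem tendsto_lebesgueNorm_sub (h : IsCarlesonScale p q ω m C) (hq : 0 < q)
    (hφ : IsAnalyticSelfMap φ) (hψ : IsAnalyticSelfMap ψ)
    (h1 : IsCompactOp p q ω ν (weightedCompOp (delta φ ψ) φ))
    (h2 : IsCompactOp p q ω ν (weightedCompOp (delta φ ψ) ψ)) {F : ℕ → ℂ → ℂ}
    (hF : ∀ j, F j ∈ bergman p ω) {M : ℝ≥0} (hM : ∀ j, bergmanNorm p ω (F j) ≤ M)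
    (h0 : ∀ z ∈ disc, Tendsto (fun j => F j z) atTop (𝓝 0)) :
    Tendsto (fun j => lebesgueNorm q ν ((compOp φ - compOp ψ) (F j))) atTop (𝓝 0) := by
  have h40 : (40 : ℝ≥0∞) ^ q ≠ ∞ := ENNReal.rpow_ne_top_of_nonneg hq.le (by norm_num)
  suffices hs : Tendsto (fun j => lebesgueNorm q ν ((compOp φ - compOp ψ) (F j)) ^ q) atTop (𝓝 0) by
    have := hs.ennrpow_const q⁻¹
    simpa only [ENNReal.rpow_rpow_inv hq.ne', ENNReal.zero_rpow_of_pos (inv_pos.2 hq)] using this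
  rw [ENNReal.tendsto_nhds_zero]
  intro ε hε
  set B : ℝ≥0∞ := 40 ^ q * (C * (M : ℝ≥0∞) ^ q)
  have hB : B ≠ ∞ := ENNReal.mul_ne_top h40 (ENNReal.mul_ne_top (by simp)
    (ENNReal.rpow_ne_top_of_nonneg hq.le (by simp)))
  -- The threshold `ε / 2 / B` makes the embedding term at most `ε / 2` for every `j`. With `n₀`
  -- then fixed, the other three terms tend to zero.
  obtain ⟨n₀, hn₀⟩ := h.exists_forall_pushMeasure_square_le hq (continuousOn_delta hφ hψ) hφ h1
    (e := ε / 2 / B) (ENNReal.div_pos (ENNReal.half_pos hε.ne').ne' hB)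
  have hX := (h1.tendsto_lebesgueNorm hq hφ.2 hF hM h0).ennrpow_const q
  have hY := (h2.tendsto_lebesgueNorm hq hψ.2 hF hM h0).ennrpow_const q
  have hZ := h.tendsto_lintegral_innerPart hq hφ hψ (h1.1 _ h.one_mem) hF hM h0 n₀
  have hsum := (ENNReal.Tendsto.const_mul (a := (40 : ℝ≥0∞) ^ q) (hX.add hY) (Or.inr h40)).add hZ
  simp only [ENNReal.zero_rpow_of_pos hq, add_zero, mul_zero] at hsum
  filter_upwards [hsum.eventually (Iic_mem_nhds (ENNReal.half_pos hε.ne'))] with j hj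
  have hj : _ ≤ ε / 2 := hj
  have hj2 : 40 ^ q * (C * (ε / 2 / B) * bergmanNorm p ω (F j) ^ q) ≤ ε / 2 :=
    calc 40 ^ q * (C * (ε / 2 / B) * bergmanNorm p ω (F j) ^ q)
        ≤ 40 ^ q * (C * (ε / 2 / B) * (M : ℝ≥0∞) ^ q) := by gcongr; exact hM j
      _ = B * (ε / 2 / B) := by ring
      _ ≤ ε / 2 := ENNReal.mul_div_le
  refine (h.lebesgueNorm_sub_rpow_le hq hφ hψ (hF j) hn₀).trans ?_
  rw [mul_add, add_right_comm]
  exact (add_le_add hj hj2).trans_eq (ENNReal.add_halves ε)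

theorem isCompactOp_sub (h : IsCarlesonScale p q ω m C) (hq : 0 < q)
    (hφ : IsAnalyticSelfMap φ) (hψ : IsAnalyticSelfMap ψ)
    (h1 : IsCompactOp p q ω ν (weightedCompOp (delta φ ψ) φ))
    (h2 : IsCompactOp p q ω ν (weightedCompOp (delta φ ψ) ψ)) :
    IsCompactOp p q ω ν (compOp φ - compOp ψ) := by
  obtain ⟨ε, hεt, hε⟩ := h.exists_pushMeasure_square_le_of_isCompactOp hq (continuousOn_delta hφ hψ) hφ h1
  have hmem : ∀ f ∈ bergman p ω, MemLebesgue q ν ((compOp φ - compOp ψ) f) := fun f hf =>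
    h.memLebesgue_sub hq hφ hψ hf hεt hε (h1.1 f hf) (h2.1 f hf)
  refine ⟨hmem, fun F hF ⟨M, hM⟩ => ?_⟩
  obtain ⟨f, hf, k, hk, hfM, hfk⟩ := h.exists_subseq_tendsto hq hF hM
  refine ⟨_, hmem f hf, k, hk, ?_⟩
  -- For `p < 1` only a quasi-triangle inequality holds, so the bound on `F (k j) - f` carries its
  -- constant.
  have hfin : ENNReal.LpAddConst (ENNReal.ofReal p) * ((M : ℝ≥0∞) + M) ≠ ∞ :=
    ENNReal.mul_ne_top (ENNReal.LpAddConst_lt_top _).ne (by simp)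
  simp only [← map_sub]
  refine h.tendsto_lebesgueNorm_sub hq hφ hψ h1 h2 (F := fun j => F (k j) - f)
    (M := (ENNReal.LpAddConst (ENNReal.ofReal p) * ((M : ℝ≥0∞) + M)).toNNReal)
    (fun j => ⟨(hF (k j)).1.sub hf.1, (hF (k j)).2.sub hf.2⟩) (fun j => ?_) fun z hz => ?_
  · rw [ENNReal.coe_toNNReal hfin]
    refine (eLpNorm_sub_le' (hF (k j)).2.1 hf.2.1 _).trans ?_
    gcongr
    · exact hM _
    · exact hfM
  · simpa using (hfk z hz).sub_const (f z)

end IsCarlesonScale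

end DoublingBergman

theorem mainTheorem4 (p q : ℝ) (hp : 0 < p) (hpq : p ≤ q)
    (ω : ℝ → ℝ) (hω : DoublingBergman.IsUpperDoubling ω)
    (ν : MeasureTheory.Measure ℂ) (φ ψ : ℂ → ℂ)
    (hφ : DoublingBergman.IsAnalyticSelfMap φ) (hψ : DoublingBergman.IsAnalyticSelfMap ψ) :
    (DoublingBergman.IsBoundedOp p q ω ν
          (DoublingBergman.weightedCompOp (DoublingBergman.delta φ ψ) φ) →
        DoublingBergman.IsBoundedOp p q ω ν
          (DoublingBergman.weightedCompOp (DoublingBergman.delta φ ψ) ψ) →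
        DoublingBergman.IsBoundedOp p q ω ν
          (DoublingBergman.compOp φ - DoublingBergman.compOp ψ)) ∧
      (DoublingBergman.IsCompactOp p q ω ν
          (DoublingBergman.weightedCompOp (DoublingBergman.delta φ ψ) φ) →
        DoublingBergman.IsCompactOp p q ω ν
          (DoublingBergman.weightedCompOp (DoublingBergman.delta φ ψ) ψ) →
        DoublingBergman.IsCompactOp p q ω ν
          (DoublingBergman.compOp φ - DoublingBergman.compOp ψ)) := by
  obtain ⟨m, C, h⟩ := hω.exists_isCarlesonScale hp hpq
  have hq : 0 < q := hp.trans_le hpq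
  exact ⟨h.isBoundedOp_sub hq hφ hψ, h.isCompactOp_sub hq hφ hψ⟩
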